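/- **Setting.** Let $n\ge 1$, let $\|\cdot\|$ be a norm on $\mathbb R^n$ with dual norm $\|y\|_*=\sup\{\langle x,y\rangle:\|x\|\le 1\}$, and let $Q\subset\mathbb R^n$ be nonempty, compact and convex. Let $\nu$ be differentiable and $1$-strongly convex on $Q$ w.r.t. $\|\cdot\|$, $V(x,y)=\nu(y)-\nu(x)-\langle\nabla\nu(x),y-x\rangle$, $D_Q=\sup_{x,y\in Q}\|x-y\|$, and $D_{Q,V}=\sup_{x,y\in Q}\sqrt{2V(x,y)}$, which is assumed finite. Consider $\min_{x\in Q}\Psi_0(x)=f(x)+g(x)$, where $g$ is convex and differentiable on $Q$ with $\|\nabla g(x)-\nabla g(y)\|_*\le L\|x-y\|$ for $x,y\in Q$, $L>0$. For some $s>0$ let $Q_s=\{x+y: x\in Q,\ \|y\|_2\le s\}$; $f$ is convex on $Q_s$ and $f(x)=\mathbb E f(x,\xi)$ for $x\in Q_s$, where for almost every $\xi$ the function $f(\cdot,\xi)$ is differentiable on $Q_s$ with $\|\nabla f(x,\xi)\|_2\le M(\xi)$, and $\mathbb E M(\xi)^2=M^2$, $M>0$. The function $f$ is accessed only through the noisy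 values $\tilde f(x,\xi)=f(x,\xi)+\Delta(x)$, where $|\Delta(x)|\le\Delta$ on $Q_s$, by means of the estimator $$\tilde f_r'(x,\xi,e)=\frac n{2r}\bigl(\tilde f(x+re,\xi)-\tilde f(x-re,\xi)\bigr)e,\qquad 0<r\le s,$$ with $e$ uniformly distributed on the Euclidean unit sphere. Let $p_*\ge(\mathbb E\|e\|_*^4)^{1/4}$. Put $F(x)=\mathbb E f(x+rb)$ with $b$ uniformly distributed in the Euclidean unit ball, and $\Psi=F+g$. **Method (zoSA).** Given $N\ge 1$ and $x_0\in Q$, set $\overline x_0=x_0$. For $k=1,\dots,N$: set $\underline x_k=(1-\gamma_k)\overline x_{k-1}+\gamma_kx_{k-1}$ and $h_k(u)=g(\underline x_k)+\langle\nabla g(\underline x_k),u-\underline x_k\rangle$; set $u_0=\tilde u_0=x_{k-1}$ and for $t=1,\dots,T_k$ $$u_t=\arg\min_{u\in Q}\bigl\{h_k(u)+\langle\tilde f_r'(u_{t-1},\xi,e),u\rangle+\beta_kV(x_{k-1},u)+\beta_kp_tV(u_{t-1},u)\bigr\},\qquad \tilde u_t=(1-\theta_t)\tilde u_{t-1}+\theta_tu_t,$$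 with a fresh independent pair $(\xi,e)$ of independent samples in every step; set $x_k=u_{T_k}$ and $\overline x_k=(1-\gamma_k)\overline x_{k-1}+\gamma_k\tilde u_{T_k}$. The parameters are $$p_t=\frac t2,\quad \theta_t=\frac{2(t+1)}{t(t+3)},\quad \beta_k=\frac{2L}k,\quad \gamma_k=\frac2{k+1},\quad T_k=\left\lceil\frac{CNp_*^2\bigl(nM^2+\frac{n^2\Delta^2}{r^2}\bigr)k^2}{\tilde DL^2}\right\rceil,\quad \tilde D=\frac{3D_{Q,V}^2}4 .$$ **Theorem.** There is a universal constant $C>0$ such that the following holds for all problems as above. 1. For all $N\ge1$, if $x^*$ is a minimizer of $\Psi$ on $Q$, then $$\mathbb E[\Psi(\overline x_N)-\Psi(x^*)]\le\frac{12LD_{Q,V}^2}{N(N+1)}+\frac{n\Delta D_Qp_*}r .$$ 2. For all $N\ge1$, if $x^*$ is a minimizer of $\Psi_0$ on $Q$, then $$\mathbb E[\Psi_0(\overline x_N)-\Psi_0(x^*)]\le2rM+\frac{12LD_{Q,V}^2}{N(N+1)}+\frac{n\Delta D_Qp_*}r .$$ 3. Let $c_1,\dots,c_5>0$ with $2c_2+c_3/c_1<1$.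 There is a constant $K$, depending only on $c_1,\dots,c_5$, such that whenever $\varepsilon>0$ and $$c_1\frac\varepsilon M\le r\le c_2\frac\varepsilon M,\quad \Delta\le\frac{c_3\,\varepsilon^2}{nMD_Q\max\{p_*,1\}},\quad \varepsilon\le c_4\sqrt n\,MD_Q,\quad\varepsilon\le c_5LD_{Q,V}^2,$$ then for some $N\ge1$ the method finds an $\varepsilon$-solution, that is $\mathbb E[\Psi_0(\overline x_N)]-\min_Q\Psi_0\le\varepsilon$, with at most $$K\sqrt{\frac{LD_{Q,V}^2}\varepsilon}\quad\text{evaluations of }\nabla g\qquad\text{and}\qquad K\left(\sqrt{\frac{LD_{Q,V}^2}\varepsilon}+\frac{D_{Q,V}^2p_*^2nM^2}{\varepsilon^2}\right)\quad\text{calls of }\tilde f .$$ -/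

import Mathlib

open MeasureTheory ProbabilityTheory
open scoped RealInnerProductSpace

universe u v

namespace ZoSA

/-- `ℝⁿ` with its Euclidean structure. -/
abbrev E (n : ℕ) := EuclideanSpace ℝ (Fin n)

/-- The dual norm `‖y‖_* = sup {⟨x, y⟩ : ‖x‖ ≤ 1}` of a norm on `ℝⁿ`. -/
noncomputable def dualNorm {n : ℕ} (nrm : Seminorm ℝ (E n)) (y : E n) : ℝ :=
  sSup ((fun x : E n => ⟪x, y⟫) '' {x | nrm x ≤ 1})

/-- The uniform distribution on the Euclidean unit sphere of `ℝⁿ`: the normalized surface measure,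
regarded as a measure on `ℝⁿ`. -/
noncomputable def sphereUniform (n : ℕ) : Measure (E n) :=
  (((volume : Measure (E n)).toSphere Set.univ)⁻¹ • (volume : Measure (E n)).toSphere).map
    Subtype.val

/-- The uniform distribution on the closed Euclidean unit ball of `ℝⁿ`. -/
noncomputable def ballUniform (n : ℕ) : Measure (E n) :=
  (volume : Measure (E n))[|Metric.closedBall (0 : E n) 1]

/-- A minimizer of `φ` over `Q` (in the method below it exists and is unique). -/
noncomputable def argminOn {n : ℕ} (Q : Set (E n)) (φ : E n → ℝ) : E n :=
  Classical.epsilon fun u => u ∈ Q ∧ IsMinOn φ Q u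

/-- The data of a composite problem `min_Q f + g` together with its geometry and its oracles. -/
structure Problem (n : ℕ) (Ξ : Type u) [MeasurableSpace Ξ] where
  /-- the norm `‖·‖` -/
  nrm : Seminorm ℝ (E n)
  /-- the feasible set -/
  Q : Set (E n)
  /-- the function generating the Bregman divergence, and its gradient -/
  ν : E n → ℝ
  gradν : E n → E n
  /-- the smooth part, and the first-order oracle -/
  g : E n → ℝ
  gradg : E n → E n
  /-- the nonsmooth part `f(x)` and its stochastic realizations `f(x, ξ)` -/
  f : E n → ℝ
  fξ : E n → Ξ → ℝ
  /-- the law of `ξ` -/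
  P : Measure Ξ
  /-- the bound `M(ξ)` on the gradients of `f(·, ξ)` -/
  Mξ : Ξ → ℝ
  /-- the noise `Δ(x)` of the zeroth-order oracle -/
  noise : E n → ℝ
  /-- the constants: smoothness of `g`, second moment of `M(ξ)`, size of the noise, and the radius
  of the neighbourhood of `Q` on which `f` is considered -/
  L : ℝ
  M : ℝ
  Δ : ℝ
  s : ℝ

namespace Problem

variable {n : ℕ} {Ξ : Type u} [MeasurableSpace Ξ]

/-- The Euclidean neighbourhood `Q_s = {x + y : x ∈ Q, ‖y‖₂ ≤ s}`. -/
def Qs (S : Problem n Ξ) : Set (E n) := {z | ∃ x ∈ S.Q, ∃ y : E n, ‖y‖ ≤ S.s ∧ z = x + y}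

/-- The Bregman divergence `V(x, y)`. -/
noncomputable def V (S : Problem n Ξ) (x y : E n) : ℝ := S.ν y - S.ν x - ⟪S.gradν x, y - x⟫

/-- `D_Q`, the diameter of `Q` in the norm `‖·‖`. -/
noncomputable def DQ (S : Problem n Ξ) : ℝ := sSup {d | ∃ x ∈ S.Q, ∃ y ∈ S.Q, d = S.nrm (x - y)}

/-- The values `√(2 V(x, y))`, `x, y ∈ Q`. -/
noncomputable def bregmanValues (S : Problem n Ξ) : Set ℝ :=
  {d | ∃ x ∈ S.Q, ∃ y ∈ S.Q, d = √(2 * S.V x y)}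

/-- `D_{Q,V}`, the diameter of `Q` with respect to the Bregman divergence. -/
noncomputable def DQV (S : Problem n Ξ) : ℝ := sSup S.bregmanValues

/-- The original objective `Ψ₀ = f + g`. -/
def Ψ₀ (S : Problem n Ξ) (x : E n) : ℝ := S.f x + S.g x

/-- The smoothed function `F(x) = E f(x + r b)`, `b` uniform in the unit ball; this is the function
whose gradient is `E[(n / r) f(x + r e) e]` with `e` uniform on the unit sphere. -/
noncomputable def F (S : Problem n Ξ) (r : ℝ) (x : E n) : ℝ := ∫ b, S.f (x + r • b) ∂ballUniform n

/-- The smoothed objective `Ψ = F + g`. -/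
noncomputable def Ψ (S : Problem n Ξ) (r : ℝ) (x : E n) : ℝ := S.F r x + S.g x

/-- The biased stochastic zeroth-order oracle `f̃(x, ξ) = f(x, ξ) + Δ(x)`. -/
def ftilde (S : Problem n Ξ) (x : E n) (ξ : Ξ) : ℝ := S.fξ x ξ + S.noise x

/-- The two-point estimator `f̃'_r(x, ξ, e)`. It makes two calls of `f̃`. -/
noncomputable def zoGrad (S : Problem n Ξ) (r : ℝ) (x : E n) (ξ : Ξ) (e : E n) : E n :=
  ((n : ℝ) / (2 * r) * (S.ftilde (x + r • e) ξ - S.ftilde (x - r • e) ξ)) • e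

/-- The linearization `l_g(x, ·)` of `g` at `x`. It makes one call of `∇g`. -/
noncomputable def lg (S : Problem n Ξ) (x y : E n) : ℝ := S.g x + ⟪S.gradg x, y - x⟫

/-- The standing assumptions on the problem. Gradients on `Q` and `Q_s` are taken within these sets,
so nothing is required outside of them; any choice of them is allowed when `Q` has empty
interior. -/
structure Assumptions (S : Problem n Ξ) : Prop where
  nrm_definite : ∀ x, S.nrm x = 0 → x = 0
  Q_compact : IsCompact S.Q
  Q_convex : Convex ℝ S.Q
  ν_diff : ∀ x ∈ S.Q, HasGradientWithinAt S.ν (S.gradν x) S.Q x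
  ν_strong : ∀ x ∈ S.Q, ∀ y ∈ S.Q,
    S.ν x + ⟪S.gradν x, y - x⟫ + 1 / 2 * S.nrm (y - x) ^ 2 ≤ S.ν y
  V_bdd : BddAbove S.bregmanValues
  g_convex : ConvexOn ℝ S.Q S.g
  g_diff : ∀ x ∈ S.Q, HasGradientWithinAt S.g (S.gradg x) S.Q x
  g_smooth : ∀ x ∈ S.Q, ∀ y ∈ S.Q,
    dualNorm S.nrm (S.gradg x - S.gradg y) ≤ S.L * S.nrm (x - y)
  L_pos : 0 < S.L
  P_prob : IsProbabilityMeasure S.P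
  fξ_meas : Measurable fun z : E n × Ξ => S.fξ z.1 z.2
  f_convex : ConvexOn ℝ S.Qs S.f
  f_mean : ∀ x ∈ S.Qs, Integrable (S.fξ x) S.P ∧ ∫ ξ, S.fξ x ξ ∂S.P = S.f x
  fξ_grad : ∀ᵐ ξ ∂S.P, ∀ x ∈ S.Qs, ∃ G : E n,
    HasGradientWithinAt (fun y => S.fξ y ξ) G S.Qs x ∧ ‖G‖ ≤ S.Mξ ξ
  Mξ_sq : Integrable (fun ξ => S.Mξ ξ ^ 2) S.P ∧ ∫ ξ, S.Mξ ξ ^ 2 ∂S.P = S.M ^ 2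
  M_pos : 0 < S.M
  noise_meas : Measurable S.noise
  noise_bdd : ∀ x ∈ S.Qs, |S.noise x| ≤ S.Δ

/-- `p` is an upper bound for the fourth root of `E ‖e‖_*⁴`, `e` uniform on the unit sphere. -/
def IsPStar (S : Problem n Ξ) (p : ℝ) : Prop :=
  (∫ e, dualNorm S.nrm e ^ 4 ∂sphereUniform n) ^ (1 / 4 : ℝ) ≤ p

end Problem

/-- The parameters of the method. Index `0` of the sequences is never used. -/
structure Params where
  p : ℕ → ℝ
  θ : ℕ → ℝ
  β : ℕ → ℝ
  γ : ℕ → ℝ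
  T : ℕ → ℕ

/-- State of the prox-sliding procedure: `u_t`, `ũ_t` and the number of calls of `f̃` so far. -/
structure PSState (n : ℕ) where
  u : E n
  utilde : E n
  zoCalls : ℕ

/-- State of the method: `x_k`, `x̄_k` and the numbers of calls of `∇g` and of `f̃` so far. -/
structure State (n : ℕ) where
  x : E n
  xbar : E n
  gradCalls : ℕ
  zoCalls : ℕ

section Algorithm

variable {n : ℕ} {Ξ : Type u} [MeasurableSpace Ξ]

/-- The prox-sliding procedure `PS(h, x, β, ·)` after `t` steps, with samples `ξ_t, e_t`. -/
noncomputable def PS (S : Problem n Ξ) (r : ℝ) (par : Params) (h : E n → ℝ) (x : E n) (β : ℝ)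
    (ξ : ℕ → Ξ) (e : ℕ → E n) : ℕ → PSState n
  | 0 => ⟨x, x, 0⟩
  | t + 1 =>
    let old := PS S r par h x β ξ e t
    let G := S.zoGrad r old.u (ξ t) (e t)
    let new := argminOn S.Q fun w =>
      h w + ⟪G, w⟫ + β * S.V x w + β * par.p (t + 1) * S.V old.u w
    ⟨new, (1 - par.θ (t + 1)) • old.utilde + par.θ (t + 1) • new, old.zoCalls + 2⟩

/-- The zeroth-order sliding algorithm after `k` outer iterations; the inner step number `t` of the
outer iteration `k` uses the samples `ξ (k, t)` and `e (k, t)`. -/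
noncomputable def run (S : Problem n Ξ) (r : ℝ) (par : Params) (x₀ : E n)
    (ξ : ℕ × ℕ → Ξ) (e : ℕ × ℕ → E n) : ℕ → State n
  | 0 => ⟨x₀, x₀, 0, 0⟩
  | k + 1 =>
    let old := run S r par x₀ ξ e k
    let γ := par.γ (k + 1)
    let xlow := (1 - γ) • old.xbar + γ • old.x
    let res := PS S r par (S.lg xlow) old.x (par.β (k + 1))
      (fun t => ξ (k + 1, t)) (fun t => e (k + 1, t)) (par.T (k + 1))
    ⟨res.u, (1 - γ) • old.xbar + γ • res.utilde, old.gradCalls + 1, old.zoCalls + res.zoCalls⟩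

/-- The prescribed parameters, with `D̃ = 3 D_{Q,V}² / 4`; the `T_k` are rounded up. -/
noncomputable def params (S : Problem n Ξ) (r p C : ℝ) (N : ℕ) : Params where
  p t := (t : ℝ) / 2
  θ t := 2 * ((t : ℝ) + 1) / ((t : ℝ) * ((t : ℝ) + 3))
  β k := 2 * S.L / (k : ℝ)
  γ k := 2 / ((k : ℝ) + 1)
  T k := ⌈C * (N : ℝ) * p ^ 2 * ((n : ℝ) * S.M ^ 2 + (n : ℝ) ^ 2 * S.Δ ^ 2 / r ^ 2) * (k : ℝ) ^ 2 /
    (3 * S.DQV ^ 2 / 4 * S.L ^ 2)⌉₊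

/-- The method with the prescribed parameters and `N` outer iterations: its final state. -/
noncomputable def zoSA (S : Problem n Ξ) (r p C : ℝ) (N : ℕ) (x₀ : E n)
    (ξ : ℕ × ℕ → Ξ) (e : ℕ × ℕ → E n) : State n :=
  run S r (params S r p C N) x₀ ξ e N

/-- The samples `(ξ_i, e_i)` are independent over all steps `i`, and in each of them `ξ_i` has the
law of `ξ`, `e_i` is uniform on the unit sphere, and the two are independent. -/
structure IsSampling (S : Problem n Ξ) {Ω : Type v} [MeasurableSpace Ω] (μ : Measure Ω)
    (ξ : ℕ × ℕ → Ω → Ξ) (e : ℕ × ℕ → Ω → E n) : Prop where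
  meas_ξ : ∀ i, Measurable (ξ i)
  meas_e : ∀ i, Measurable (e i)
  indep : iIndepFun (fun i ω => (ξ i ω, e i ω)) μ
  law : ∀ i, μ.map (fun ω => (ξ i ω, e i ω)) = S.P.prod (sphereUniform n)

end Algorithm

end ZoSA

/-! The method is accelerated gradient sliding applied to `Ψ = F + g`, where `F` averages `f` over a
Euclidean ball of radius `r`. Averaging preserves convexity and moves `f` by at most `r M` on `Q`,
which accounts for the term `2 r M`. The rest depends on the estimator being a stochastic
subgradient of `F` with controlled bias and controlled second moment in the dual norm.

Bias: the derivative of a ball average under translation is a surface integral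
(`hasDerivAt_integral_ball`). By symmetry of the sphere, the noiseless estimator averages to the
gradient of `F`, in the form of the subgradient inequality `F_sub_le_integral`. The noise changes
the pairing with `v - u` by at most `n Δ D_Q ‖e‖_* / r`, hence by `n Δ D_Q p / r` in the mean.

Second moment: the pointwise bound `2 r M(ξ)` on the increment `f(v + re, ξ) - f(v - re, ξ)` would
only give order `n² M²`. Concentration on the sphere (`integral_sub_neg_pow_four_le`) saves a factor
`n`: the odd part of a `K`-Lipschitz function has fourth moment of order `K⁴ / n²`. For the proof,
the odd part is extended homogeneously to `ℝⁿ`. The Maurey-Pisier rotation argument bounds the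
Gaussian fourth moment of the extension independently of the dimension, and the radial factor `n (n
+ 2)` is divided out. Cauchy-Schwarz against `E ‖e‖_*⁴ ≤ p⁴` then yields `sigmaSq`.

Optimization: for every realization, the three-point inequality of the prox step is summed over the
inner steps with weights `t + 1`, and the resulting inequality over the outer steps with weights `k
(k + 1) / 2`; both sums telescope (`run_bound`). What remains are step errors. Each iterate is
independent of the fresh sample, so the mean of a step error is at most the bias plus `2 σ² / (β_k
p_t)`, and `T_k` is just large enough for the variance terms to add up to order `L D_{Q,V}²`. Taking
expectations requires measurable iterates although gradients are only given within `Q`; this follows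
from uniqueness of the minimizers and from difference quotients.

Complexity: `N` of order `√(L D_{Q,V}² / ε)` suffices, and the sum of the `T_k` is of order `N⁴`
times the variance over `L² D_{Q,V}²`, up to rounding. -/

namespace ZoSA

set_option linter.unusedSectionVars false

/-! ### Integration in polar coordinates. -/

section Polar

open Set Metric Measure

variable {V : Type*} [NormedAddCommGroup V] [NormedSpace ℝ V] [FiniteDimensional ℝ V]
  [MeasurableSpace V] [BorelSpace V] (μ : Measure V) [μ.IsAddHaarMeasure]

/-- The origin is a null set, and its complement is the product of the sphere and a half-line. -/
theorem integral_eq_integral_toSphere_prod [Nontrivial V] (f : V → ℝ) :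
    ∫ x, f x ∂μ = ∫ p : sphere (0 : V) 1 × Ioi (0 : ℝ), f (p.2.1 • p.1.1)
      ∂(μ.toSphere.prod (volumeIoiPow (Module.finrank ℝ V - 1))) := by
  have h : ∫ x, f x ∂μ = ∫ x : ({0}ᶜ : Set V), f x ∂(μ.comap (↑)) := by
    rw [integral_subtype_comap (measurableSet_singleton (0 : V)).compl, restrict_compl_singleton]
  rw [← μ.measurePreserving_homeomorphUnitSphereProd.integral_comp
    (homeomorphUnitSphereProd V).measurableEmbedding, h]
  congr 1
  funext x
  have hx : ‖(x : V)‖ ≠ 0 := norm_ne_zero_iff.2 x.2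
  simp [smul_smul, mul_inv_cancel₀ hx]

theorem integrable_toSphere_prod {f : V → ℝ} (hf : Integrable f μ) :
    Integrable (fun p : sphere (0 : V) 1 × Ioi (0 : ℝ) => f (p.2.1 • p.1.1))
      (μ.toSphere.prod (volumeIoiPow (Module.finrank ℝ V - 1))) := by
  rw [← μ.measurePreserving_homeomorphUnitSphereProd.integrable_comp_emb
    (homeomorphUnitSphereProd V).measurableEmbedding]
  have h := (integrableOn_iff_comap_subtypeVal (measurableSet_singleton (0 : V)).compl).1
    (hf.integrableOn (s := {0}ᶜ))
  refine h.congr (Filter.Eventually.of_forall fun (x : ({0}ᶜ : Set V)) => ?_)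
  have hx : ‖(x : V)‖ ≠ 0 := norm_ne_zero_iff.2 x.2
  simp [smul_smul, mul_inv_cancel₀ hx]

theorem integral_volumeIoiPow (m : ℕ) (a : ℝ → ℝ) :
    ∫ ρ : Ioi (0 : ℝ), a ρ ∂(volumeIoiPow m) = ∫ ρ in Ioi (0 : ℝ), ρ ^ m * a ρ := by
  simp only [Measure.volumeIoiPow, ENNReal.ofReal]
  rw [integral_withDensity_eq_integral_smul,
    integral_subtype_comap measurableSet_Ioi fun ρ => Real.toNNReal (ρ ^ m) • a ρ]
  · refine setIntegral_congr_fun measurableSet_Ioi fun x hx => ?_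
    simp only [NNReal.smul_def, Real.coe_toNNReal _ (pow_nonneg (le_of_lt (mem_Ioi.1 hx)) _),
      smul_eq_mul]
  · exact (measurable_subtype_coe.pow_const _).real_toNNReal

/-- The integral of a product of an angular and a radial function. -/
theorem integral_angular_mul_radial [Nontrivial V] (f : V → ℝ) (φ : sphere (0 : V) 1 → ℝ) (a : ℝ → ℝ)
    (hf : ∀ (e : sphere (0 : V) 1) (ρ : ℝ), 0 < ρ → f (ρ • e.1) = φ e * a ρ) :
    ∫ x, f x ∂μ = (∫ e, φ e ∂μ.toSphere) *
      ∫ ρ in Ioi (0 : ℝ), ρ ^ (Module.finrank ℝ V - 1) * a ρ := by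
  rw [integral_eq_integral_toSphere_prod, ← integral_volumeIoiPow, ← integral_prod_mul]
  exact integral_congr_ae (Filter.Eventually.of_forall fun p => hf p.1 p.2.1 p.2.2)

end Polar

/-! ### Rotations mixing the two factors of `V × V`. -/

section Rotation

variable {V : Type*} [NormedAddCommGroup V] [InnerProductSpace ℝ V]

theorem rotation_norm_sq (θ : ℝ) (z : V × V) :
    ‖(ContinuousLinearMap.rotation θ z).1‖ ^ 2 + ‖(ContinuousLinearMap.rotation θ z).2‖ ^ 2
      = ‖z.1‖ ^ 2 + ‖z.2‖ ^ 2 := by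
  rw [ContinuousLinearMap.rotation_apply]
  simp only [neg_smul]
  rw [neg_add_eq_sub, norm_add_sq_real, norm_sub_sq_real]
  simp only [norm_smul, inner_smul_left, inner_smul_right, mul_pow, Real.norm_eq_abs, sq_abs,
    RCLike.conj_to_real, real_inner_comm z.1 z.2]
  linear_combination (‖z.1‖ ^ 2 + ‖z.2‖ ^ 2) * Real.sin_sq_add_cos_sq θ

theorem rotation_rotation (θ η : ℝ) (z : V × V) :
    ContinuousLinearMap.rotation θ (ContinuousLinearMap.rotation η z)
      = ContinuousLinearMap.rotation (θ + η) z := by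
  simp only [ContinuousLinearMap.rotation_apply, Real.cos_add, Real.sin_add]
  ext <;> module

theorem rotation_zero (z : V × V) : ContinuousLinearMap.rotation 0 z = z := by
  simp [ContinuousLinearMap.rotation_apply]

/-- The rotation of `V × V` as a linear isometry for the Euclidean norm. -/
noncomputable def rotationIso (V : Type*) [NormedAddCommGroup V] [InnerProductSpace ℝ V] (θ : ℝ) :
    WithLp 2 (V × V) ≃ₗᵢ[ℝ] WithLp 2 (V × V) where
  toFun z := WithLp.toLp 2 (ContinuousLinearMap.rotation θ z.ofLp)
  invFun z := WithLp.toLp 2 (ContinuousLinearMap.rotation (-θ) z.ofLp)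
  map_add' x y := by simp
  map_smul' c x := by simp
  left_inv z := by simp [rotation_rotation, rotation_zero]
  right_inv z := by simp [rotation_rotation, rotation_zero]
  norm_map' z := by
    have h := rotation_norm_sq θ z.ofLp
    refine (sq_eq_sq₀ (norm_nonneg _) (norm_nonneg _)).1 ?_
    rw [WithLp.prod_norm_sq_eq_of_L2, WithLp.prod_norm_sq_eq_of_L2]
    exact h

/-- The rotation is an isometry for the Euclidean norm of the product, not for the sup norm of `V ×
V`; hence the passage through `WithLp 2`. -/
theorem measurePreserving_rotation [FiniteDimensional ℝ V] [MeasurableSpace V] [BorelSpace V]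
    (θ : ℝ) :
    MeasurePreserving (ContinuousLinearMap.rotation θ : V × V → V × V) := by
  have h := ((WithLp.volume_preserving_ofLp V V).comp (rotationIso V θ).measurePreserving).comp
    (WithLp.volume_preserving_toLp V V)
  exact h

end Rotation

/-! ### Dimension-free fourth moments of odd Lipschitz functions of a Gaussian vector. -/

section GaussianConcentration

open Filter Topology

variable {V : Type*} [NormedAddCommGroup V] [InnerProductSpace ℝ V] [FiniteDimensional ℝ V]
  [MeasurableSpace V] [BorelSpace V]

theorem integrable_rexp_neg_mul_sq_norm {b : ℝ} (hb : 0 < b) :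
    Integrable fun x : V => Real.exp (-b * ‖x‖ ^ 2) := by
  refine Integrable.of_integral_ne_zero ?_
  rw [GaussianFourier.integral_rexp_neg_mul_sq_norm hb]
  positivity

theorem integral_gaussian_pos : 0 < ∫ x : V, Real.exp (-(1 / 2) * ‖x‖ ^ 2) := by
  rw [GaussianFourier.integral_rexp_neg_mul_sq_norm (by norm_num)]
  positivity

theorem integrable_exp_inner_gaussian (w : V) :
    Integrable fun y : V => Real.exp ⟪w, y⟫ * Real.exp (-(1 / 2) * ‖y‖ ^ 2) := by
  have h := ((integrable_rexp_neg_mul_sq_norm (V := V) (b := 1 / 2) (by norm_num)).comp_sub_right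
    w).const_mul (Real.exp (‖w‖ ^ 2 / 2))
  refine h.congr (Eventually.of_forall fun y => ?_)
  simp only [← Real.exp_add, norm_sub_sq_real, real_inner_comm y w]
  congr 1
  ring

/-- Completing the square reduces this to translation invariance. -/
theorem integral_exp_inner_gaussian (w : V) :
    ∫ y : V, Real.exp ⟪w, y⟫ * Real.exp (-(1 / 2) * ‖y‖ ^ 2)
      = Real.exp (‖w‖ ^ 2 / 2) * ∫ y : V, Real.exp (-(1 / 2) * ‖y‖ ^ 2) := by
  rw [← integral_sub_right_eq_self (fun y : V => Real.exp (-(1 / 2) * ‖y‖ ^ 2)) w,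
    ← integral_const_mul]
  refine integral_congr_ae (Eventually.of_forall fun y => ?_)
  simp only [← Real.exp_add, norm_sub_sq_real, real_inner_comm y w]
  congr 1
  ring

theorem pow_four_le_exp_add_exp_neg (t : ℝ) : t ^ 4 ≤ 24 * (Real.exp t + Real.exp (-t)) := by
  have key : ∀ s : ℝ, 0 ≤ s → s ^ 4 ≤ 24 * Real.exp s := fun s hs => by
    have h := Real.pow_div_factorial_le_exp s hs 4
    norm_num [Nat.factorial] at h
    linarith
  rcases le_total 0 t with h | h
  · linarith [key t h, Real.exp_pos (-t)]
  · have := key (-t) (by linarith)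
    rw [Even.neg_pow (by decide)] at this
    linarith [Real.exp_pos t]

theorem integrable_inner_pow_four_gaussian (a : V) :
    Integrable fun y : V => ⟪a, y⟫ ^ 4 * Real.exp (-(1 / 2) * ‖y‖ ^ 2) := by
  refine Integrable.mono' (((integrable_exp_inner_gaussian a).add
    (integrable_exp_inner_gaussian (-a))).const_mul 24) (by fun_prop)
    (Eventually.of_forall fun y => ?_)
  rw [Real.norm_of_nonneg (by positivity)]
  have := pow_four_le_exp_add_exp_neg ⟪a, y⟫
  simp only [Pi.add_apply, inner_neg_left, ← add_mul, ← mul_assoc]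
  gcongr

/-- For a unit vector the exponential moments at `w` and `-w` give `24 · 2 · exp (1/2) ≤ 96`;
homogeneity does the rest. -/
theorem integral_inner_pow_four_gaussian_le (a : V) :
    ∫ y : V, ⟪a, y⟫ ^ 4 * Real.exp (-(1 / 2) * ‖y‖ ^ 2)
      ≤ 96 * ‖a‖ ^ 4 * ∫ y : V, Real.exp (-(1 / 2) * ‖y‖ ^ 2) := by
  set Z := ∫ y : V, Real.exp (-(1 / 2) * ‖y‖ ^ 2)
  have hZ : 0 < Z := integral_gaussian_pos
  have unit : ∀ w : V, ‖w‖ = 1 →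
      ∫ y : V, ⟪w, y⟫ ^ 4 * Real.exp (-(1 / 2) * ‖y‖ ^ 2) ≤ 96 * Z := by
    intro w hw
    calc ∫ y : V, ⟪w, y⟫ ^ 4 * Real.exp (-(1 / 2) * ‖y‖ ^ 2)
        ≤ ∫ y : V, 24 * (Real.exp ⟪w, y⟫ * Real.exp (-(1 / 2) * ‖y‖ ^ 2)
          + Real.exp ⟪-w, y⟫ * Real.exp (-(1 / 2) * ‖y‖ ^ 2)) := by
          refine integral_mono (integrable_inner_pow_four_gaussian w)
            (((integrable_exp_inner_gaussian w).add
              (integrable_exp_inner_gaussian (-w))).const_mul 24) fun y => ?_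
          have := pow_four_le_exp_add_exp_neg ⟪w, y⟫
          simp only [inner_neg_left, ← add_mul, ← mul_assoc]
          gcongr
      _ = 48 * Real.exp (1 / 2) * Z := by
          rw [integral_const_mul, integral_add (integrable_exp_inner_gaussian w)
            (integrable_exp_inner_gaussian (-w)), integral_exp_inner_gaussian,
            integral_exp_inner_gaussian, norm_neg, hw]
          change 24 * (Real.exp (1 ^ 2 / 2) * Z + Real.exp (1 ^ 2 / 2) * Z) = _
          norm_num
          ring
      _ ≤ 96 * Z := by
          have h1 : Real.exp (1 / 2) ≤ 2 := by
            have h2 : Real.exp (1 / 2) ^ 2 = Real.exp 1 := by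
              rw [← Real.exp_nat_mul]; norm_num
            have := Real.exp_one_lt_d9
            nlinarith [Real.exp_pos (1 / 2)]
          nlinarith
  rcases eq_or_ne a 0 with rfl | ha
  · simp
  have hn : 0 < ‖a‖ := norm_pos_iff.2 ha
  have h := unit (‖a‖⁻¹ • a) (by rw [norm_smul, norm_inv, norm_norm, inv_mul_cancel₀ hn.ne'])
  have e : ∀ y : V, ⟪a, y⟫ ^ 4 * Real.exp (-(1 / 2) * ‖y‖ ^ 2)
      = ‖a‖ ^ 4 * (⟪‖a‖⁻¹ • a, y⟫ ^ 4 * Real.exp (-(1 / 2) * ‖y‖ ^ 2)) := fun y => by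
    rw [real_inner_smul_left]
    field_simp
  simp_rw [e]
  rw [integral_const_mul]
  calc _ ≤ ‖a‖ ^ 4 * (96 * Z) := by gcongr
    _ = _ := by ring

/-- The density of a pair of independent Gaussian vectors, up to normalization. -/
noncomputable def pairWeight (z : V × V) : ℝ :=
  Real.exp (-(1 / 2) * ‖z.1‖ ^ 2) * Real.exp (-(1 / 2) * ‖z.2‖ ^ 2)

theorem pairWeight_pos (z : V × V) : 0 < pairWeight z := by unfold pairWeight; positivity

theorem continuous_pairWeight : Continuous (pairWeight : V × V → ℝ) := by
  unfold pairWeight; fun_prop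

theorem pairWeight_rotation (θ : ℝ) (z : V × V) :
    pairWeight (ContinuousLinearMap.rotation θ z) = pairWeight z := by
  unfold pairWeight
  rw [← Real.exp_add, ← Real.exp_add, ← mul_add, ← mul_add, rotation_norm_sq]

/-- Half of the Gaussian exponent absorbs the polynomial factor. This provides the integrable
majorant for all small rotations. -/
theorem pow_four_mul_pairWeight_le (z : V × V) :
    (‖z.1‖ + ‖z.2‖) ^ 4 * pairWeight z
      ≤ 128 * (Real.exp (-(1 / 4) * ‖z.1‖ ^ 2) * Real.exp (-(1 / 4) * ‖z.2‖ ^ 2)) := by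
  set q := ‖z.1‖ ^ 2 + ‖z.2‖ ^ 2
  have hq : 0 ≤ q := by positivity
  have h1 : (‖z.1‖ + ‖z.2‖) ^ 4 ≤ 4 * q ^ 2 := by
    have : (‖z.1‖ + ‖z.2‖) ^ 2 ≤ 2 * q := add_sq_le
    calc (‖z.1‖ + ‖z.2‖) ^ 4 = ((‖z.1‖ + ‖z.2‖) ^ 2) ^ 2 := by ring
      _ ≤ (2 * q) ^ 2 := by gcongr
      _ = _ := by ring
  have h2 : q ^ 2 ≤ 32 * Real.exp (q / 4) := by
    have h := Real.pow_div_factorial_le_exp (q / 4) (by positivity) 2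
    norm_num [Nat.factorial] at h
    nlinarith
  have e1 : pairWeight z = Real.exp (-(q / 2)) := by
    unfold pairWeight; rw [← Real.exp_add]; congr 1; simp only [q]; ring
  have e2 : Real.exp (-(1 / 4) * ‖z.1‖ ^ 2) * Real.exp (-(1 / 4) * ‖z.2‖ ^ 2)
      = Real.exp (q / 4) * Real.exp (-(q / 2)) := by
    rw [← Real.exp_add, ← Real.exp_add]; congr 1; simp only [q]; ring
  rw [e1, e2, ← mul_assoc]
  gcongr
  linarith

theorem integrable_pow_four_mul_pairWeight :
    Integrable fun z : V × V => (‖z.1‖ + ‖z.2‖) ^ 4 * pairWeight z := by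
  have h := (((integrable_rexp_neg_mul_sq_norm (V := V) (b := 1 / 4) (by norm_num)).mul_prod
    (integrable_rexp_neg_mul_sq_norm (V := V) (b := 1 / 4) (by norm_num))).const_mul 128)
  refine Integrable.mono' h ?_ (Eventually.of_forall fun z => ?_)
  · exact ((by fun_prop : Continuous fun z : V × V => (‖z.1‖ + ‖z.2‖) ^ 4).mul
      continuous_pairWeight).aestronglyMeasurable
  · rw [Real.norm_of_nonneg (mul_nonneg (by positivity) (pairWeight_pos z).le)]
    exact pow_four_mul_pairWeight_le z

variable {Φ : V → ℝ} {K : NNReal}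

theorem abs_sub_rotation_le (hΦ : LipschitzWith K Φ) {δ : ℝ} (hδ : 0 ≤ δ) (z : V × V) :
    |Φ z.1 - Φ (ContinuousLinearMap.rotation δ z).1| ≤ K * (δ * (‖z.1‖ + ‖z.2‖)) := by
  have h := hΦ.dist_le_mul z.1 (ContinuousLinearMap.rotation δ z).1
  rw [Real.dist_eq, dist_eq_norm] at h
  refine h.trans (mul_le_mul_of_nonneg_left ?_ K.2)
  have e : z.1 - (ContinuousLinearMap.rotation δ z).1
      = (1 - Real.cos δ) • z.1 - Real.sin δ • z.2 := by
    rw [ContinuousLinearMap.rotation_apply]; module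
  rw [e]
  refine (norm_sub_le _ _).trans ?_
  rw [norm_smul, norm_smul, Real.norm_eq_abs, Real.norm_eq_abs, mul_add]
  have hs : |Real.sin δ| ≤ δ := (Real.abs_sin_le_abs).trans_eq (abs_of_nonneg hδ)
  have hc : |1 - Real.cos δ| ≤ δ := by
    rw [abs_of_nonneg (by linarith [Real.cos_le_one δ])]
    rcases le_total δ 2 with h2 | h2
    · nlinarith [Real.one_sub_sq_div_two_le_cos (x := δ)]
    · linarith [Real.neg_one_le_cos δ]
  gcongr

theorem continuous_sub_rotation (hΦ : LipschitzWith K Φ) (δ : ℝ) :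
    Continuous fun z : V × V => Φ z.1 - Φ (ContinuousLinearMap.rotation δ z).1 := by
  have := hΦ.continuous
  fun_prop

theorem sub_rotation_pow_four_mul_le (hΦ : LipschitzWith K Φ) {δ : ℝ} (hδ : 0 ≤ δ) (z : V × V) :
    (Φ z.1 - Φ (ContinuousLinearMap.rotation δ z).1) ^ 4 * pairWeight z
      ≤ (K * δ) ^ 4 * ((‖z.1‖ + ‖z.2‖) ^ 4 * pairWeight z) := by
  rw [← mul_assoc, ← mul_pow]
  refine mul_le_mul_of_nonneg_right ?_ (pairWeight_pos z).le
  rw [← Even.pow_abs (by decide)]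
  gcongr
  exact (abs_sub_rotation_le hΦ hδ z).trans_eq (by ring)

theorem integrable_sub_rotation_pow_four (hΦ : LipschitzWith K Φ) {δ : ℝ} (hδ : 0 ≤ δ) :
    Integrable fun z : V × V =>
      (Φ z.1 - Φ (ContinuousLinearMap.rotation δ z).1) ^ 4 * pairWeight z := by
  refine Integrable.mono' (integrable_pow_four_mul_pairWeight.const_mul ((K * δ) ^ 4)) ?_
    (Eventually.of_forall fun z => ?_)
  · exact (((continuous_sub_rotation hΦ δ).pow 4).mul continuous_pairWeight).aestronglyMeasurable
  · rw [Real.norm_of_nonneg (mul_nonneg (by positivity) (pairWeight_pos z).le)]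
    exact sub_rotation_pow_four_mul_le hΦ hδ z

theorem sum_pow_four_le (m : ℕ) (d : ℕ → ℝ) :
    (∑ j ∈ Finset.range m, d j) ^ 4 ≤ (m : ℝ) ^ 3 * ∑ j ∈ Finset.range m, d j ^ 4 := by
  rcases Nat.eq_zero_or_pos m with rfl | hm
  · simp
  have h := pow_sum_div_card_le_sum_pow (s := Finset.range m) (f := fun j => |d j|)
    (fun i _ => abs_nonneg _) 3
  simp only [Finset.card_range, Nat.reduceAdd, Even.pow_abs (by decide : Even 4)] at h
  rw [div_le_iff₀ (by positivity)] at h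
  rw [← Even.pow_abs (by decide)]
  calc _ ≤ (∑ j ∈ Finset.range m, |d j|) ^ 4 := by
        gcongr; exact Finset.abs_sum_le_sum_abs _ _
    _ ≤ _ := by linarith

/-- Splitting a rotation by `θ` into `m` equal rotations. -/
theorem integral_sub_rotation_pow_four_le (hΦ : LipschitzWith K Φ) {θ : ℝ} (hθ : 0 ≤ θ) (m : ℕ)
    (hm : 0 < m) :
    ∫ z : V × V, (Φ z.1 - Φ (ContinuousLinearMap.rotation θ z).1) ^ 4 * pairWeight z
      ≤ ∫ z : V × V, (m : ℝ) ^ 4 *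
        ((Φ z.1 - Φ (ContinuousLinearMap.rotation (θ / m) z).1) ^ 4 * pairWeight z) := by
  have hδ : 0 ≤ θ / m := by positivity
  set D : V × V → ℝ := fun z =>
    (Φ z.1 - Φ (ContinuousLinearMap.rotation (θ / m) z).1) ^ 4 * pairWeight z with hD
  have hDi : Integrable D := integrable_sub_rotation_pow_four hΦ hδ
  have hcomp : ∀ j : ℕ,
      Integrable (fun z => D (ContinuousLinearMap.rotation (j * (θ / m)) z)) ∧
      ∫ z, D (ContinuousLinearMap.rotation (j * (θ / m)) z) = ∫ z, D z := fun j => by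
    have hmp := measurePreserving_rotation (V := V) (j * (θ / m))
    refine ⟨hmp.integrable_comp_of_integrable hDi, ?_⟩
    have hm' := hmp.map_eq
    conv_rhs => rw [← hm']
    rw [integral_map hmp.measurable.aemeasurable]
    rw [hm']; exact hDi.aestronglyMeasurable
  calc ∫ z : V × V, (Φ z.1 - Φ (ContinuousLinearMap.rotation θ z).1) ^ 4 * pairWeight z
      ≤ ∫ z : V × V, (m : ℝ) ^ 3 *
        ∑ j ∈ Finset.range m, D (ContinuousLinearMap.rotation (j * (θ / m)) z) := by
        refine integral_mono (integrable_sub_rotation_pow_four hΦ hθ)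
          ((integrable_finsetSum _ fun j _ => (hcomp j).1).const_mul _) fun z => ?_
        have tel := Finset.sum_range_sub'
          (fun j : ℕ => Φ (ContinuousLinearMap.rotation (j * (θ / m)) z).1) m
        have hmm : (m : ℝ) * (θ / m) = θ := by field_simp
        simp only [Nat.cast_zero, zero_mul, rotation_zero, hmm] at tel
        simp only [hD, pairWeight_rotation, rotation_rotation, ← tel, ← Finset.sum_mul, ← mul_assoc]
        refine mul_le_mul_of_nonneg_right ?_ (pairWeight_pos z).le
        refine (sum_pow_four_le m _).trans_eq ?_
        congr 1
        refine Finset.sum_congr rfl fun j _ => ?_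
        push_cast
        rw [show ((j : ℝ) + 1) * (θ / m) = θ / m + j * (θ / m) by ring]
    _ = _ := by
        rw [integral_const_mul, integral_finsetSum _ fun j _ => (hcomp j).1, integral_const_mul]
        simp only [(hcomp _).2, Finset.sum_const, Finset.card_range, nsmul_eq_mul]
        ring

/-- The curve `s ↦ cos (θ s) z.1 + sin (θ s) z.2` leaves `z.1` with velocity `θ z.2`, so a small
rotation probes the derivative in the direction of the second, independent vector. -/
theorem tendsto_mul_sub_rotation {θ : ℝ} {z : V × V} (h : DifferentiableAt ℝ Φ z.1) :
    Tendsto (fun m : ℕ => ((m + 1 : ℕ) : ℝ) *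
      (Φ z.1 - Φ (ContinuousLinearMap.rotation (θ / (m + 1 : ℕ)) z).1)) atTop
      (𝓝 (-(θ * fderiv ℝ Φ z.1 z.2))) := by
  have hc : HasDerivAt (fun s : ℝ => Real.cos (θ * s) • z.1 + Real.sin (θ * s) • z.2)
      (θ • z.2) 0 := by
    have h1 := (((hasDerivAt_id (0 : ℝ)).const_mul θ).cos.smul_const z.1).add
      (((hasDerivAt_id (0 : ℝ)).const_mul θ).sin.smul_const z.2)
    simp only [id_eq, mul_zero, Real.sin_zero, Real.cos_zero, neg_zero, zero_mul, mul_one, zero_smul,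
      zero_add, one_mul] at h1
    exact h1
  have hd : HasDerivAt (fun s : ℝ => Φ (Real.cos (θ * s) • z.1 + Real.sin (θ * s) • z.2))
      (fderiv ℝ Φ z.1 (θ • z.2)) 0 := by
    refine HasFDerivAt.comp_hasDerivAt (l := Φ) (x := (0 : ℝ)) ?_ hc
    simpa using h.hasFDerivAt
  have ht : Tendsto (fun m : ℕ => (((m + 1 : ℕ) : ℝ))⁻¹) atTop (𝓝[≠] 0) := by
    refine tendsto_nhdsWithin_iff.2 ⟨?_, Eventually.of_forall fun m => ?_⟩
    · exact tendsto_inv_atTop_zero.comp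
        (tendsto_natCast_atTop_atTop.comp (tendsto_add_atTop_nat 1))
    · simp only [Set.mem_compl_iff, Set.mem_singleton_iff, inv_eq_zero]; positivity
  have := ((hasDerivAt_iff_tendsto_slope_zero.1 hd).comp ht).neg
  rw [map_smul, smul_eq_mul] at this
  refine this.congr fun m => ?_
  simp [ContinuousLinearMap.rotation_apply, div_eq_mul_inv]
  ring

/-- Moments of odd Lipschitz functions of a Gaussian vector do not depend on the dimension. -/
theorem integral_pow_four_gaussian_le (hΦ : LipschitzWith K Φ) (hodd : ∀ x, Φ (-x) = -Φ x) :
    ∫ x : V, Φ x ^ 4 * Real.exp (-(1 / 2) * ‖x‖ ^ 2)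
      ≤ 6 * Real.pi ^ 4 * K ^ 4 * ∫ x : V, Real.exp (-(1 / 2) * ‖x‖ ^ 2) := by
  set Z := ∫ x : V, Real.exp (-(1 / 2) * ‖x‖ ^ 2)
  have hZ : 0 < Z := integral_gaussian_pos
  -- Rademacher's theorem; no smoothness of `Φ` is needed.
  have hdiff : ∀ᵐ z : V × V, DifferentiableAt ℝ Φ z.1 :=
    Measure.quasiMeasurePreserving_fst.ae hΦ.ae_differentiableAt
  set G : V × V → ℝ := fun z => (Real.pi * fderiv ℝ Φ z.1 z.2) ^ 4 * pairWeight z with hG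
  have hpt : ∀ᵐ z : V × V, Tendsto (fun m : ℕ => ((m + 1 : ℕ) : ℝ) ^ 4 *
      ((Φ z.1 - Φ (ContinuousLinearMap.rotation (Real.pi / (m + 1 : ℕ)) z).1) ^ 4
        * pairWeight z)) atTop (𝓝 (G z)) := by
    filter_upwards [hdiff] with z hz
    have h := ((tendsto_mul_sub_rotation (θ := Real.pi) hz).pow 4).mul_const (pairWeight z)
    have e : (-(Real.pi * fderiv ℝ Φ z.1 z.2)) ^ 4 * pairWeight z = G z := by
      rw [hG, Even.neg_pow (by decide)]
    rw [e] at h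
    refine h.congr fun m => ?_
    ring
  have hmeas : ∀ m : ℕ, AEStronglyMeasurable (fun z : V × V => ((m + 1 : ℕ) : ℝ) ^ 4 *
      ((Φ z.1 - Φ (ContinuousLinearMap.rotation (Real.pi / (m + 1 : ℕ)) z).1) ^ 4
        * pairWeight z)) volume := fun m =>
    ((integrable_sub_rotation_pow_four hΦ (by positivity)).const_mul _).aestronglyMeasurable
  have hbound : ∀ (m : ℕ) (z : V × V), ‖((m + 1 : ℕ) : ℝ) ^ 4 *
      ((Φ z.1 - Φ (ContinuousLinearMap.rotation (Real.pi / (m + 1 : ℕ)) z).1) ^ 4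
        * pairWeight z)‖ ≤ (K * Real.pi) ^ 4 * ((‖z.1‖ + ‖z.2‖) ^ 4 * pairWeight z) := by
    intro m z
    have hw := (pairWeight_pos z).le
    rw [Real.norm_of_nonneg (by positivity)]
    have := sub_rotation_pow_four_mul_le hΦ (δ := Real.pi / (m + 1 : ℕ)) (by positivity) z
    calc _ ≤ ((m + 1 : ℕ) : ℝ) ^ 4 * ((K * (Real.pi / (m + 1 : ℕ))) ^ 4
          * ((‖z.1‖ + ‖z.2‖) ^ 4 * pairWeight z)) := by gcongr
      _ = _ := by field_simp
  have hBint := (integrable_pow_four_mul_pairWeight (V := V)).const_mul ((K * Real.pi) ^ 4)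
  have hlim := tendsto_integral_of_dominated_convergence _ hmeas hBint
    (fun m => Eventually.of_forall (hbound m)) hpt
  have hGint : Integrable G := by
    refine Integrable.mono' hBint (aestronglyMeasurable_of_tendsto_ae atTop hmeas hpt) ?_
    filter_upwards [hpt] with z hz
    exact le_of_tendsto hz.norm (Eventually.of_forall fun m => hbound m z)
  have hle : ∫ z : V × V, (Φ z.1 - Φ (ContinuousLinearMap.rotation Real.pi z).1) ^ 4
      * pairWeight z ≤ ∫ z, G z :=
    ge_of_tendsto hlim (Eventually.of_forall fun m =>
      integral_sub_rotation_pow_four_le hΦ Real.pi_pos.le (m + 1) (Nat.succ_pos m))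
  -- The half turn sends `z.1` to `-z.1`, so oddness makes the difference `2 Φ z.1`.
  have hlhs : ∫ z : V × V, (Φ z.1 - Φ (ContinuousLinearMap.rotation Real.pi z).1) ^ 4
      * pairWeight z = 16 * ((∫ x : V, Φ x ^ 4 * Real.exp (-(1 / 2) * ‖x‖ ^ 2)) * Z) := by
    rw [← integral_prod_mul, ← integral_const_mul]
    refine integral_congr_ae (Eventually.of_forall fun z => ?_)
    simp only [ContinuousLinearMap.rotation_apply, Real.cos_pi, Real.sin_pi, neg_smul, one_smul,
      zero_smul, add_zero, hodd, pairWeight]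
    ring
  -- For fixed `x` the integrand is the fourth power of a linear functional of `y`, of norm at most
  -- `π K`. Division by 16 turns 96 into 6.
  have hrhs : ∫ z, G z ≤ 96 * Real.pi ^ 4 * K ^ 4 * Z * Z := by
    rw [Measure.volume_eq_prod] at hGint ⊢
    rw [integral_prod _ hGint]
    calc _ ≤ ∫ x : V, (96 * Real.pi ^ 4 * K ^ 4 * Z) * Real.exp (-(1 / 2) * ‖x‖ ^ 2) := by
          refine integral_mono hGint.integral_prod_left
            ((integrable_rexp_neg_mul_sq_norm (by norm_num)).const_mul _) fun x => ?_
          set a := (InnerProductSpace.toDual ℝ V).symm (fderiv ℝ Φ x) with ha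
          have hin : ∀ y, fderiv ℝ Φ x y = ⟪a, y⟫ := fun y => by simp [ha]
          have hnorm : ‖a‖ ≤ K := by
            rw [ha, LinearIsometryEquiv.norm_map]; exact norm_fderiv_le_of_lipschitz ℝ hΦ
          have h4 := integral_inner_pow_four_gaussian_le a
          calc ∫ y, G (x, y)
              = (Real.pi ^ 4 * Real.exp (-(1 / 2) * ‖x‖ ^ 2)) *
                ∫ y : V, ⟪a, y⟫ ^ 4 * Real.exp (-(1 / 2) * ‖y‖ ^ 2) := by
                rw [← integral_const_mul]
                refine integral_congr_ae (Eventually.of_forall fun y => ?_)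
                simp only [hG, hin, pairWeight]
                ring
            _ ≤ (Real.pi ^ 4 * Real.exp (-(1 / 2) * ‖x‖ ^ 2)) * (96 * K ^ 4 * Z) := by
                refine mul_le_mul_of_nonneg_left (h4.trans ?_) (by positivity)
                gcongr
            _ = _ := by ring
      _ = _ := by rw [integral_const_mul]
  have h16 := hlhs ▸ hle.trans hrhs
  have : (∫ x : V, Φ x ^ 4 * Real.exp (-(1 / 2) * ‖x‖ ^ 2)) * Z
      ≤ (6 * Real.pi ^ 4 * K ^ 4 * Z) * Z := by linarith
  exact le_of_mul_le_mul_right this hZ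

end GaussianConcentration

/-! ### Differentiation of the integral over a translated ball. -/

section BallDerivative

open Set Metric Measure Filter Topology

variable {V : Type*} [NormedAddCommGroup V] [InnerProductSpace ℝ V]

/-- The distance from the origin to the boundary of the ball `B(t h, 1)` in the direction `e`. -/
noncomputable def radialBound (h : V) (t : ℝ) (e : V) : ℝ :=
  t * ⟪e, h⟫ + √(1 - t ^ 2 * (‖h‖ ^ 2 - ⟪e, h⟫ ^ 2))

theorem continuous_radialBound (h : V) (t : ℝ) : Continuous (radialBound h t) := by
  unfold radialBound; fun_prop

theorem inner_sq_le_of_norm_eq_one {e : V} (he : ‖e‖ = 1) (h : V) : ⟪e, h⟫ ^ 2 ≤ ‖h‖ ^ 2 := by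
  have := abs_real_inner_le_norm e h
  rw [he, one_mul] at this
  exact sq_le_sq' (abs_le.1 this).1 (abs_le.1 this).2

/-- Membership is a quadratic inequality in `ρ`. Its lower root is negative because the origin lies
inside the ball, so only the upper root matters. -/
theorem smul_mem_ball_iff {h e : V} {t ρ : ℝ} (he : ‖e‖ = 1) (ht : |t| * ‖h‖ < 1) (hρ : 0 < ρ) :
    ρ • e ∈ ball (t • h) 1 ↔ ρ < radialBound h t e := by
  have hth : t ^ 2 * ‖h‖ ^ 2 < 1 := by
    rw [← sq_abs t, ← mul_pow]
    exact pow_lt_one₀ (by positivity) ht two_ne_zero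
  have h1 : ‖ρ • e - t • h‖ ^ 2 = ρ ^ 2 - 2 * ρ * t * ⟪e, h⟫ + t ^ 2 * ‖h‖ ^ 2 := by
    rw [norm_sub_sq_real, norm_smul, norm_smul, inner_smul_left, inner_smul_right, he]
    simp only [Real.norm_eq_abs, mul_one, sq_abs, RCLike.conj_to_real, mul_pow]
    ring
  set c := ⟪e, h⟫
  have h2 : -√(1 - t ^ 2 * (‖h‖ ^ 2 - c ^ 2)) < -(t * c) :=
    neg_lt_neg (Real.lt_sqrt_of_sq_lt (by nlinarith))
  rw [mem_ball, dist_eq_norm, ← sq_lt_one_iff₀ (norm_nonneg _), h1]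
  have h3 : ρ ^ 2 - 2 * ρ * t * c + t ^ 2 * ‖h‖ ^ 2 < 1 ↔
      (ρ - t * c) ^ 2 < 1 - t ^ 2 * (‖h‖ ^ 2 - c ^ 2) := by
    constructor <;> intro h <;> nlinarith
  rw [h3, Real.sq_lt, radialBound]
  constructor
  · rintro ⟨-, h⟩; linarith
  · intro h; constructor <;> linarith

variable [FiniteDimensional ℝ V]

theorem exists_bound_radial {φ : V → ℝ} (hφ : Continuous φ) (m : ℕ) :
    ∃ B : ℝ, 0 ≤ B ∧ ∀ (e : V) (ρ : ℝ), ‖e‖ = 1 → ρ ∈ Icc (0 : ℝ) 2 → |ρ ^ m * φ (ρ • e)| ≤ B := by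
  obtain ⟨B, hB⟩ := (isCompact_closedBall (0 : V) 2).exists_bound_of_continuousOn hφ.continuousOn
  refine ⟨2 ^ m * B, mul_nonneg (by positivity) ((norm_nonneg _).trans (hB 0 (by simp))), ?_⟩
  intro e ρ he hρ
  rw [abs_mul, abs_pow, abs_of_nonneg hρ.1]
  have := hB (ρ • e) (by
    rw [mem_closedBall_zero_iff, norm_smul, he, mul_one, Real.norm_of_nonneg hρ.1]; exact hρ.2)
  rw [Real.norm_eq_abs] at this
  have := hρ.1
  have := hρ.2
  gcongr

variable [MeasurableSpace V] [BorelSpace V] [Nontrivial V]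

/-- In polar coordinates the translation only moves the upper limit of the radial integral. Hence
the integral can be differentiated in `t` for merely continuous `φ`. -/
theorem integral_ball_eq {φ : V → ℝ} (hφ : Continuous φ) {h : V} {t : ℝ} (ht : |t| * ‖h‖ < 1) :
    ∫ x in ball (t • h) 1, φ x = ∫ e : sphere (0 : V) 1,
      (∫ ρ in (0 : ℝ)..radialBound h t e, ρ ^ (Module.finrank ℝ V - 1) * φ (ρ • e.1))
        ∂(volume : Measure V).toSphere := by
  have hint : Integrable ((ball (t • h) 1).indicator φ) := by
    rw [integrable_indicator_iff measurableSet_ball]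
    exact (hφ.continuousOn.integrableOn_compact (isCompact_closedBall (t • h) 1)).mono_set
      ball_subset_closedBall
  rw [← integral_indicator measurableSet_ball, integral_eq_integral_toSphere_prod,
    integral_prod _ (integrable_toSphere_prod _ hint)]
  congr 1
  funext e
  have he : ‖(e : V)‖ = 1 := by simp
  have hpos : 0 ≤ radialBound h t e := by
    have hth : t ^ 2 * ‖h‖ ^ 2 < 1 := by
      rw [← sq_abs t, ← mul_pow]
      exact pow_lt_one₀ (by positivity) ht two_ne_zero
    have : -(t * ⟪(e : V), h⟫) ≤ √(1 - t ^ 2 * (‖h‖ ^ 2 - ⟪(e : V), h⟫ ^ 2)) :=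
      Real.le_sqrt_of_sq_le (by nlinarith)
    unfold radialBound; linarith
  simp only
  rw [integral_volumeIoiPow _ (fun ρ => (ball (t • h) 1).indicator φ (ρ • (e : V))),
    intervalIntegral.integral_of_le hpos, integral_Ioc_eq_integral_Ioo,
    ← integral_indicator measurableSet_Ioo, ← integral_indicator measurableSet_Ioi]
  congr 1
  funext ρ
  by_cases hρ : 0 < ρ
  · rw [indicator_of_mem (mem_Ioi.2 hρ)]
    by_cases hb : ρ • (e : V) ∈ ball (t • h) 1
    · rw [indicator_of_mem hb, indicator_of_mem
        (show ρ ∈ Ioo 0 (radialBound h t e) from ⟨hρ, (smul_mem_ball_iff he ht hρ).1 hb⟩)]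
    · rw [indicator_of_notMem hb, indicator_of_notMem (fun hm => hb ?_), mul_zero]
      exact (smul_mem_ball_iff he ht hρ).2 hm.2
  · rw [indicator_of_notMem (show ρ ∉ Ioi 0 from fun hm => hρ hm),
      indicator_of_notMem (show ρ ∉ Ioo 0 (radialBound h t e) from fun hm => hρ hm.1)]

theorem abs_sqrt_sub_sqrt_le {a b : ℝ} (ha : 1 / 4 ≤ a) (hb : 1 / 4 ≤ b) :
    |√a - √b| ≤ |a - b| := by
  have h1 : 1 / 2 ≤ √a := Real.le_sqrt_of_sq_le (by linarith)
  have h2 : 1 / 2 ≤ √b := Real.le_sqrt_of_sq_le (by linarith)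
  have h3 : a - b = (√a - √b) * (√a + √b) := by
    have := Real.sq_sqrt (show 0 ≤ a by linarith)
    have := Real.sq_sqrt (show 0 ≤ b by linarith)
    nlinarith
  rw [h3, abs_mul]
  exact le_mul_of_one_le_right (abs_nonneg _) (by rw [abs_of_nonneg] <;> linarith)

theorem abs_radialBound_sub_le {h e : V} (he : ‖e‖ = 1) {t s : ℝ} (ht : |t| * ‖h‖ ≤ 1 / 2)
    (hs : |s| * ‖h‖ ≤ 1 / 2) :
    |radialBound h t e - radialBound h s e| ≤ 2 * ‖h‖ * |t - s| := by
  have hc := inner_sq_le_of_norm_eq_one he h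
  have hc' : |⟪e, h⟫| ≤ ‖h‖ := abs_le_of_sq_le_sq hc (norm_nonneg _)
  set c := ⟪e, h⟫
  have hc0 := sq_nonneg c
  have aux : ∀ u : ℝ, |u| * ‖h‖ ≤ 1 / 2 → 1 / 4 ≤ 1 - u ^ 2 * (‖h‖ ^ 2 - c ^ 2) := fun u hu => by
    have : (|u| * ‖h‖) ^ 2 ≤ (1 / 2) ^ 2 := pow_le_pow_left₀ (by positivity) hu 2
    rw [mul_pow, sq_abs] at this
    nlinarith [sq_nonneg u]
  have h1 := abs_sqrt_sub_sqrt_le (aux t ht) (aux s hs)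
  have h2 : |1 - t ^ 2 * (‖h‖ ^ 2 - c ^ 2) - (1 - s ^ 2 * (‖h‖ ^ 2 - c ^ 2))|
      ≤ ‖h‖ * |t - s| := by
    have e1 : 1 - t ^ 2 * (‖h‖ ^ 2 - c ^ 2) - (1 - s ^ 2 * (‖h‖ ^ 2 - c ^ 2))
      = -((t - s) * ((t + s) * (‖h‖ ^ 2 - c ^ 2))) := by ring
    rw [e1, abs_neg, abs_mul, mul_comm, abs_mul, abs_of_nonneg (by linarith : 0 ≤ ‖h‖ ^ 2 - c ^ 2)]
    refine mul_le_mul_of_nonneg_right ?_ (abs_nonneg _)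
    calc |t + s| * (‖h‖ ^ 2 - c ^ 2) ≤ (|t| + |s|) * ‖h‖ ^ 2 := by
          gcongr
          · exact abs_add_le t s
          · linarith
      _ = (|t| * ‖h‖ + |s| * ‖h‖) * ‖h‖ := by ring
      _ ≤ 1 * ‖h‖ := by gcongr; linarith
      _ = _ := one_mul _
  have h3 : radialBound h t e - radialBound h s e = (t - s) * c +
      (√(1 - t ^ 2 * (‖h‖ ^ 2 - c ^ 2)) - √(1 - s ^ 2 * (‖h‖ ^ 2 - c ^ 2))) := by
    unfold radialBound; ring
  rw [h3]
  refine (abs_add_le _ _).trans ?_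
  rw [abs_mul]
  nlinarith [abs_nonneg (t - s)]

theorem hasDerivAt_radialBound (h e : V) : HasDerivAt (fun t => radialBound h t e) ⟪e, h⟫ 0 := by
  unfold radialBound
  have h1 : HasDerivAt (fun t : ℝ => 1 - t ^ 2 * (‖h‖ ^ 2 - ⟪e, h⟫ ^ 2)) 0 0 := by
    have := (((hasDerivAt_id (0 : ℝ)).pow 2).mul_const (‖h‖ ^ 2 - ⟪e, h⟫ ^ 2)).const_sub 1
    simpa using this
  have h2 := ((hasDerivAt_id (0 : ℝ)).mul_const ⟪e, h⟫).add (h1.sqrt (by simp))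
  simp only [one_mul, zero_div, add_zero] at h2
  exact h2

/-- The derivative of the integral over a translated ball is a surface integral. -/
theorem hasDerivAt_integral_ball {φ : V → ℝ} (hφ : Continuous φ) (h : V) :
    HasDerivAt (fun t : ℝ => ∫ x in ball (t • h) 1, φ x)
      (∫ e : sphere (0 : V) 1, φ e * ⟪(e : V), h⟫ ∂(volume : Measure V).toSphere) 0 := by
  set m := Module.finrank ℝ V - 1
  obtain ⟨B, hB0, hB⟩ := exists_bound_radial hφ m
  -- For `|t| < δ` the shift has norm at most 1/2, which keeps the radius in `[0, 2]` and the
  -- argument of the square root above 1/4.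
  set δ : ℝ := 1 / (2 * (‖h‖ + 1))
  have hδ : 0 < δ := by positivity
  have hsmall : ∀ t ∈ ball (0 : ℝ) δ, |t| * ‖h‖ ≤ 1 / 2 := fun t ht => by
    rw [mem_ball_zero_iff, Real.norm_eq_abs] at ht
    calc |t| * ‖h‖ ≤ δ * (‖h‖ + 1) := by gcongr; linarith
      _ = 1 / 2 := by simp only [δ]; field_simp
  have hcont : ∀ e : V, Continuous fun ρ : ℝ => ρ ^ m * φ (ρ • e) := fun e => by fun_prop
  have hle2 : ∀ (e : V) (t : ℝ), ‖e‖ = 1 → |t| * ‖h‖ ≤ 1 / 2 →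
      radialBound h t e ∈ Icc (0 : ℝ) 2 := fun e t he ht => by
    have h1 : |t * ⟪e, h⟫| ≤ 1 / 2 := by
      rw [abs_mul]
      refine le_trans ?_ ht
      have := abs_le_of_sq_le_sq (inner_sq_le_of_norm_eq_one he h) (norm_nonneg _)
      gcongr
    have hc := inner_sq_le_of_norm_eq_one he h
    have : (|t| * ‖h‖) ^ 2 ≤ (1 / 2) ^ 2 := pow_le_pow_left₀ (by positivity) ht 2
    rw [mul_pow, sq_abs] at this
    have h2 : 1 / 2 ≤ √(1 - t ^ 2 * (‖h‖ ^ 2 - ⟪e, h⟫ ^ 2)) :=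
      Real.le_sqrt_of_sq_le (by nlinarith [sq_nonneg t, sq_nonneg ⟪e, h⟫])
    have h3 : √(1 - t ^ 2 * (‖h‖ ^ 2 - ⟪e, h⟫ ^ 2)) ≤ 1 :=
      Real.sqrt_le_one.2 (by nlinarith [sq_nonneg t])
    unfold radialBound
    have := abs_le.1 h1
    constructor <;> linarith
  have hFcont : ∀ t : ℝ, Continuous fun e : sphere (0 : V) 1 =>
      ∫ ρ in (0 : ℝ)..radialBound h t e, ρ ^ m * φ (ρ • e.1) := fun t => by
    refine intervalIntegral.continuous_parametric_intervalIntegral_of_continuous ?_ ?_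
    · fun_prop
    · exact (continuous_radialBound h t).comp continuous_subtype_val
  have key := (hasDerivAt_integral_of_dominated_loc_of_lip
    (μ := (volume : Measure V).toSphere) (𝕜 := ℝ) (x₀ := 0)
    (F := fun (t : ℝ) (e : sphere (0 : V) 1) =>
      ∫ ρ in (0 : ℝ)..radialBound h t e, ρ ^ m * φ (ρ • e.1))
    (F' := fun e => φ e * ⟪(e : V), h⟫) (bound := fun _ => B * (2 * ‖h‖))
    (ball_mem_nhds (0 : ℝ) hδ) (Eventually.of_forall fun t => (hFcont t).aestronglyMeasurable)
    ?_ ?_ ?_ (integrable_const _) ?_).2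
  · refine key.congr_of_eventuallyEq ?_
    filter_upwards [ball_mem_nhds (0 : ℝ) hδ] with t ht
    exact integral_ball_eq hφ (by linarith [hsmall t ht])
  · exact (hFcont 0).integrable_of_hasCompactSupport (HasCompactSupport.of_compactSpace _)
  · exact (by fun_prop : Continuous fun e : sphere (0 : V) 1 =>
      φ e * ⟪(e : V), h⟫).aestronglyMeasurable
  · refine Eventually.of_forall fun e => ?_
    have he : ‖(e : V)‖ = 1 := by simp
    refine LipschitzOnWith.of_dist_le_mul fun t ht s hs => ?_
    have e1 : (Real.nnabs (B * (2 * ‖h‖)) : ℝ) = B * (2 * ‖h‖) := by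
      rw [Real.coe_nnabs, abs_of_nonneg (by positivity)]
    rw [e1, Real.dist_eq, Real.dist_eq,
      intervalIntegral.integral_interval_sub_left ((hcont e).intervalIntegrable _ _)
        ((hcont e).intervalIntegrable _ _)]
    have hb := intervalIntegral.norm_integral_le_of_norm_le_const (C := B)
      (a := radialBound h s e) (b := radialBound h t e)
      (f := fun ρ => ρ ^ m * φ (ρ • e.1)) (fun ρ hρ => by
        refine hB e ρ he ?_
        have := uIoc_subset_uIcc hρ
        exact (convex_Icc (0 : ℝ) 2).ordConnected.uIcc_subset (hle2 e s he (hsmall s hs))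
          (hle2 e t he (hsmall t ht)) this)
    rw [Real.norm_eq_abs] at hb
    refine hb.trans ?_
    rw [mul_assoc]
    exact mul_le_mul_of_nonneg_left (abs_radialBound_sub_le he (hsmall t ht) (hsmall s hs)) hB0
  · refine Eventually.of_forall fun e => ?_
    -- At radius 1 the factor `ρ ^ m` equals 1, so the chain rule produces exactly `φ e * ⟪e, h⟫`.
    have h0 : radialBound h 0 (e : V) = 1 := by simp [radialBound]
    have h1 : HasDerivAt (fun R : ℝ => ∫ ρ in (0 : ℝ)..R, ρ ^ m * φ (ρ • e.1)) (φ e)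
        (radialBound h 0 (e : V)) := by
      have := intervalIntegral.integral_hasDerivAt_right ((hcont e).intervalIntegrable 0 1)
        ((hcont e).stronglyMeasurableAtFilter _ _) (hcont e).continuousAt
      rw [h0]
      simpa using this
    exact h1.comp (0 : ℝ) (hasDerivAt_radialBound h (e : V))

end BallDerivative

/-! ### The uniform distributions on the sphere and the ball. -/

section Uniform

open Set Metric Measure Filter Topology

variable {n : ℕ} [NeZero n]

theorem integral_sphereUniform (g : E n → ℝ) :
    ∫ e, g e ∂sphereUniform n = ((volume : Measure (E n)).toSphere.real univ)⁻¹ *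
      ∫ e : sphere (0 : E n) 1, g e ∂(volume : Measure (E n)).toSphere := by
  rw [sphereUniform, (MeasurableEmbedding.subtype_coe isClosed_sphere.measurableSet).integral_map,
    integral_smul_measure]
  simp [measureReal_def]

instance : IsProbabilityMeasure (sphereUniform n) := by
  have h0 : (volume : Measure (E n)).toSphere univ ≠ 0 := by
    rw [ne_eq, measure_univ_eq_zero]; exact toSphere_ne_zero _
  refine ⟨?_⟩
  rw [sphereUniform, Measure.map_apply measurable_subtype_coe MeasurableSet.univ]
  simp only [preimage_univ, Measure.smul_apply, smul_eq_mul]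
  exact ENNReal.inv_mul_cancel h0 (measure_ne_top _ _)

theorem ae_sphereUniform_norm : ∀ᵐ e ∂sphereUniform n, ‖e‖ = 1 := by
  rw [sphereUniform, ae_map_iff measurable_subtype_coe.aemeasurable
    (isClosed_eq continuous_norm continuous_const).measurableSet]
  exact Eventually.of_forall fun e => by simp

theorem integrable_sphereUniform {g : E n → ℝ} (hg : Continuous g) :
    Integrable g (sphereUniform n) := by
  obtain ⟨B, hB⟩ := (isCompact_sphere (0 : E n) 1).exists_bound_of_continuousOn hg.continuousOn
  refine Integrable.of_bound hg.aestronglyMeasurable B ?_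
  filter_upwards [ae_sphereUniform_norm (n := n)] with e he
  exact hB e (by simpa using he)

theorem volume_real_unitBall_pos : 0 < (volume : Measure (E n)).real (ball 0 1) :=
  ENNReal.toReal_pos (measure_ball_pos _ _ one_pos).ne' measure_ball_lt_top.ne

theorem toSphere_real_univ_pos : 0 < (volume : Measure (E n)).toSphere.real univ := by
  rw [toSphere_real_apply_univ, finrank_euclideanSpace_fin]
  have := volume_real_unitBall_pos (n := n)
  have : (0 : ℝ) < n := Nat.cast_pos.2 (NeZero.pos n)
  positivity

theorem volume_closedBall_ne_zero : (volume : Measure (E n)) (closedBall 0 1) ≠ 0 :=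
  (measure_closedBall_pos _ _ one_pos).ne'

instance : IsProbabilityMeasure (ballUniform n) := by
  unfold ballUniform
  exact cond_isProbabilityMeasure_of_finite volume_closedBall_ne_zero
    measure_closedBall_lt_top.ne

theorem ae_ballUniform_norm : ∀ᵐ b ∂ballUniform n, ‖b‖ ≤ 1 := by
  unfold ballUniform
  filter_upwards [ae_cond_mem (isClosed_closedBall (x := (0 : E n)) (ε := 1)).measurableSet]
    with b hb
  simpa using hb

theorem integrable_ballUniform {g : E n → ℝ} (hg : Continuous g) :
    Integrable g (ballUniform n) := by
  obtain ⟨B, hB⟩ :=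
    (isCompact_closedBall (0 : E n) 1).exists_bound_of_continuousOn hg.continuousOn
  refine Integrable.of_bound hg.aestronglyMeasurable B ?_
  filter_upwards [ae_ballUniform_norm (n := n)] with e he
  exact hB e (by simpa using he)

theorem ball_ae_eq_closedBall :
    ball (0 : E n) 1 =ᵐ[volume] closedBall (0 : E n) 1 :=
  ae_eq_of_subset_of_measure_ge ball_subset_closedBall
    (addHaar_closedBall_eq_addHaar_ball _ _ _).le measurableSet_ball.nullMeasurableSet
    measure_closedBall_lt_top.ne

theorem integral_ballUniform (g : E n → ℝ) :
    ∫ b, g b ∂ballUniform n = ((volume : Measure (E n)).real (ball 0 1))⁻¹ *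
      ∫ b in ball (0 : E n) 1, g b := by
  rw [ballUniform, ProbabilityTheory.cond, integral_smul_measure,
    ← setIntegral_congr_set (ball_ae_eq_closedBall (n := n)), measureReal_def,
    addHaar_closedBall_eq_addHaar_ball, ENNReal.toReal_inv, smul_eq_mul]

/-- The gradient of the ball average of `φ` at the origin. -/
theorem hasDerivAt_integral_ballUniform {φ : E n → ℝ} (hφ : Continuous φ) (h : E n) :
    HasDerivAt (fun t : ℝ => ∫ b, φ (b + t • h) ∂ballUniform n)
      (n * ∫ e, φ e * ⟪e, h⟫ ∂sphereUniform n) 0 := by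
  have key := (hasDerivAt_integral_ball hφ h).const_mul ((volume : Measure (E n)).real (ball 0 1))⁻¹
  have e1 : ∀ t : ℝ, ∫ b, φ (b + t • h) ∂ballUniform n
      = ((volume : Measure (E n)).real (ball 0 1))⁻¹ * ∫ x in ball (t • h) 1, φ x := fun t => by
    rw [integral_ballUniform]
    congr 1
    rw [← (measurePreserving_add_right volume (t • h)).setIntegral_preimage_emb
      (Homeomorph.addRight (t • h)).measurableEmbedding φ]
    congr 2
    ext b
    simp [mem_ball, dist_eq_norm]
  have e2 : n * ∫ e, φ e * ⟪e, h⟫ ∂sphereUniform n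
      = ((volume : Measure (E n)).real (ball 0 1))⁻¹ *
        ∫ e : sphere (0 : E n) 1, φ e * ⟪(e : E n), h⟫ ∂(volume : Measure (E n)).toSphere := by
    rw [integral_sphereUniform, toSphere_real_apply_univ, finrank_euclideanSpace_fin]
    have := NeZero.ne n
    field_simp
  simp_rw [e1]
  rwa [e2]

/-- Symmetry of the sphere is read off from the symmetry of the ball: both sides come from
derivatives of the same ball average, and derivatives are unique. -/
theorem integral_sphereUniform_neg_mul_inner {φ : E n → ℝ} (hφ : Continuous φ) (h : E n) :
    ∫ e, φ (-e) * ⟪e, h⟫ ∂sphereUniform n = -∫ e, φ e * ⟪e, h⟫ ∂sphereUniform n := by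
  have h1 := hasDerivAt_integral_ballUniform (φ := fun x => φ (-x)) (by fun_prop) h
  have h2 := hasDerivAt_integral_ballUniform hφ (-h)
  have e1 : ∀ t : ℝ, ∫ b, φ (-(b + t • h)) ∂ballUniform n = ∫ b, φ (b + t • -h) ∂ballUniform n := by
    intro t
    rw [integral_ballUniform, integral_ballUniform]
    congr 1
    rw [← (Measure.measurePreserving_neg volume).setIntegral_preimage_emb
      (Homeomorph.neg (E n)).measurableEmbedding (fun b => φ (b + t • -h))]
    have : (Neg.neg ⁻¹' ball (0 : E n) 1) = ball 0 1 := by ext; simp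
    rw [this]
    simp only [smul_neg, neg_add]
  simp_rw [e1] at h1
  have h3 := h1.unique h2
  simp only [inner_neg_right, mul_neg, integral_neg] at h3
  have hn : (n : ℝ) ≠ 0 := Nat.cast_ne_zero.2 (NeZero.ne n)
  have : (n : ℝ) * (∫ e, φ (-e) * ⟪e, h⟫ ∂sphereUniform n)
      = n * -∫ e, φ e * ⟪e, h⟫ ∂sphereUniform n := by rw [h3]; ring
  exact mul_left_cancel₀ hn this

end Uniform

/-! ### Concentration on the sphere, deduced from the Gaussian case. -/

section SphereConcentration

open Set Metric Measure Filter Topology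

variable {V : Type*} [NormedAddCommGroup V] [InnerProductSpace ℝ V]

/-- The positively homogeneous extension of the odd part of a function on the unit sphere. -/
noncomputable def oddExtension (f : V → ℝ) (x : V) : ℝ :=
  ‖x‖ * (f (‖x‖⁻¹ • x) - f (-(‖x‖⁻¹ • x)))

theorem oddExtension_neg (f : V → ℝ) (x : V) : oddExtension f (-x) = -oddExtension f x := by
  simp only [oddExtension, norm_neg, smul_neg, neg_neg]; ring

theorem oddExtension_smul (f : V → ℝ) {e : V} (he : ‖e‖ = 1) {ρ : ℝ} (hρ : 0 < ρ) :
    oddExtension f (ρ • e) = ρ * (f e - f (-e)) := by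
  have : ‖ρ • e‖ = ρ := by rw [norm_smul, he, mul_one, Real.norm_of_nonneg hρ.le]
  rw [oddExtension, this, smul_smul, inv_mul_cancel₀ hρ.ne', one_smul]

/-- The odd part is bounded by `2 K` on the sphere, which controls a change of radius. A change of
direction costs `2 K ‖y‖ ‖x' - y'‖ ≤ 4 K ‖x - y‖`. -/
theorem lipschitzWith_oddExtension {f : V → ℝ} {K : NNReal}
    (hf : LipschitzOnWith K f (sphere 0 1)) : LipschitzWith (6 * K) (oddExtension f) := by
  have hK : (0 : ℝ) ≤ K := K.2
  have hLip : ∀ x y : V, ‖x‖ = 1 → ‖y‖ = 1 → |f x - f y| ≤ K * ‖x - y‖ := fun x y hx hy => by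
    have := hf.dist_le_mul x (by simpa using hx) y (by simpa using hy)
    rwa [Real.dist_eq, dist_eq_norm] at this
  have hbd : ∀ x : V, ‖x‖ = 1 → |f x - f (-x)| ≤ 2 * K := fun x hx => by
    refine (hLip x (-x) hx (by simpa using hx)).trans ?_
    rw [sub_neg_eq_add, ← two_smul ℝ, norm_smul, hx]
    norm_num
    linarith
  have hunit : ∀ x : V, x ≠ 0 → ‖‖x‖⁻¹ • x‖ = 1 := fun x hx => by
    rw [norm_smul, norm_inv, norm_norm, inv_mul_cancel₀ (norm_ne_zero_iff.2 hx)]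
  have hzero : ∀ x : V, |oddExtension f x| ≤ 2 * K * ‖x‖ := fun x => by
    rcases eq_or_ne x 0 with rfl | hx
    · simp [oddExtension]
    · rw [oddExtension, abs_mul, abs_norm, mul_comm]
      exact mul_le_mul_of_nonneg_right (hbd _ (hunit x hx)) (norm_nonneg _)
  refine LipschitzWith.of_dist_le_mul fun x y => ?_
  rw [Real.dist_eq, dist_eq_norm]
  push_cast
  rcases eq_or_ne x 0 with rfl | hx
  · have h0 : oddExtension f 0 = 0 := by simp [oddExtension]
    rw [h0, zero_sub, abs_neg, zero_sub, norm_neg]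
    nlinarith [hzero y, norm_nonneg y]
  rcases eq_or_ne y 0 with rfl | hy
  · have h0 : oddExtension f 0 = 0 := by simp [oddExtension]
    rw [h0, sub_zero, sub_zero]
    nlinarith [hzero x, norm_nonneg x]
  set x' := ‖x‖⁻¹ • x with hx'
  set y' := ‖y‖⁻¹ • y with hy'
  have hux := hunit x hx
  have huy := hunit y hy
  have hd : ‖y‖ * ‖x' - y'‖ ≤ 2 * ‖x - y‖ := by
    have e1 : ‖y‖ * ‖x' - y'‖ = ‖(x - y) + (‖y‖ - ‖x‖) • x'‖ := by
      rw [← norm_norm y, ← norm_smul, norm_norm]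
      congr 1
      have hxx : ‖x‖ • x' = x := by
        rw [hx', smul_smul, mul_inv_cancel₀ (norm_ne_zero_iff.2 hx), one_smul]
      have hyy : ‖y‖ • y' = y := by
        rw [hy', smul_smul, mul_inv_cancel₀ (norm_ne_zero_iff.2 hy), one_smul]
      rw [smul_sub, sub_smul, hyy, hxx]
      abel
    rw [e1]
    refine (norm_add_le _ _).trans ?_
    rw [norm_smul, hux, mul_one, Real.norm_eq_abs, abs_sub_comm]
    linarith [abs_norm_sub_norm_le x y]
  have hsplit : oddExtension f x - oddExtension f y
      = (‖x‖ - ‖y‖) * (f x' - f (-x')) + ‖y‖ * ((f x' - f y') - (f (-x') - f (-y'))) := by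
    simp only [oddExtension, ← hx', ← hy']; ring
  rw [hsplit]
  refine (abs_add_le _ _).trans ?_
  rw [abs_mul, abs_mul, abs_norm]
  have h1 : |(f x' - f y') - (f (-x') - f (-y'))| ≤ 2 * K * ‖x' - y'‖ := by
    refine (abs_sub _ _).trans ?_
    have h2 := hLip x' y' hux huy
    have h3 := hLip (-x') (-y') (by rwa [norm_neg]) (by rwa [norm_neg])
    rw [neg_sub_neg, norm_sub_rev] at h3
    linarith
  calc |‖x‖ - ‖y‖| * |f x' - f (-x')| + ‖y‖ * |(f x' - f y') - (f (-x') - f (-y'))|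
      ≤ ‖x - y‖ * (2 * K) + ‖y‖ * (2 * K * ‖x' - y'‖) := by
        gcongr
        · exact abs_norm_sub_norm_le x y
        · exact hbd x' hux
    _ = ‖x - y‖ * (2 * K) + 2 * K * (‖y‖ * ‖x' - y'‖) := by ring
    _ ≤ ‖x - y‖ * (2 * K) + 2 * K * (2 * ‖x - y‖) := by gcongr
    _ = 6 * K * ‖x - y‖ := by ring

theorem integral_pow_mul_gaussian (m : ℕ) :
    ∫ ρ in Ioi (0 : ℝ), ρ ^ m * Real.exp (-(1 / 2) * ρ ^ 2)
      = (1 / 2 : ℝ) ^ (-((m : ℝ) + 1) / 2) * (1 / 2) * Real.Gamma (((m : ℝ) + 1) / 2) := by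
  have h := integral_rpow_mul_exp_neg_mul_rpow (p := 2) (q := m) (b := 1 / 2) (by norm_num)
    (by have : (0 : ℝ) ≤ m := m.cast_nonneg
        linarith) (by norm_num)
  rw [← h]
  refine setIntegral_congr_fun measurableSet_Ioi fun ρ hρ => ?_
  simp

/-- The recursion of the Gamma function is applied twice. With `m + 1 = n` the factor is `n (n +
2)`, the source of the decay in the dimension. -/
theorem integral_pow_add_four_mul_gaussian (m : ℕ) :
    ∫ ρ in Ioi (0 : ℝ), ρ ^ m * (ρ ^ 4 * Real.exp (-(1 / 2) * ρ ^ 2))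
      = ((m : ℝ) + 1) * ((m : ℝ) + 3) * ∫ ρ in Ioi (0 : ℝ), ρ ^ m * Real.exp (-(1 / 2) * ρ ^ 2) := by
  have hm : (0 : ℝ) ≤ m := m.cast_nonneg
  simp_rw [← mul_assoc, ← pow_add]
  rw [integral_pow_mul_gaussian, integral_pow_mul_gaussian]
  push_cast
  rw [show ((m : ℝ) + 4 + 1) / 2 = ((m + 1) / 2 + 1) + 1 by ring,
    Real.Gamma_add_one (by positivity), Real.Gamma_add_one (by positivity),
    show -((m : ℝ) + 4 + 1) / 2 = -(m + 1) / 2 - (2 : ℕ) by push_cast; ring,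
    Real.rpow_sub_natCast (by norm_num)]
  ring

/-- The fourth moment of the odd part of a Lipschitz function on the sphere. -/
theorem integral_sub_neg_pow_four_le {n : ℕ} [NeZero n] {f : E n → ℝ} {K : NNReal}
    (hf : LipschitzOnWith K f (sphere 0 1)) :
    ∫ e, (f e - f (-e)) ^ 4 ∂sphereUniform n ≤ 10 ^ 6 * K ^ 4 / n ^ 2 := by
  have hn : (0 : ℝ) < n := Nat.cast_pos.2 (NeZero.pos n)
  have h := integral_pow_four_gaussian_le (lipschitzWith_oddExtension hf) (oddExtension_neg f)
  set σ := (volume : Measure (E n)).toSphere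
  set m := Module.finrank ℝ (E n) - 1 with hm
  have hmn : (m : ℝ) + 1 = n := by
    rw [hm, finrank_euclideanSpace_fin]
    exact_mod_cast Nat.sub_add_cancel (NeZero.one_le (n := n))
  set A := ∫ ρ in Ioi (0 : ℝ), ρ ^ m * Real.exp (-(1 / 2) * ρ ^ 2) with hA
  have e1 : ∫ x : E n, oddExtension f x ^ 4 * Real.exp (-(1 / 2) * ‖x‖ ^ 2)
      = (∫ e : sphere (0 : E n) 1, (f e - f (-e)) ^ 4 ∂σ) * (n * (n + 2) * A) := by
    have h4 := integral_pow_add_four_mul_gaussian m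
    rw [show (m : ℝ) + 3 = n + 2 by linarith, hmn] at h4
    rw [← h4]
    refine integral_angular_mul_radial volume _ (fun e => (f e.1 - f (-e.1)) ^ 4)
      (fun ρ => ρ ^ 4 * Real.exp (-(1 / 2) * ρ ^ 2)) fun e ρ hρ => ?_
    have he : ‖(e : E n)‖ = 1 := by simp
    rw [oddExtension_smul f he hρ, norm_smul, he, mul_one, Real.norm_of_nonneg hρ.le]
    ring
  have e2 : ∫ x : E n, Real.exp (-(1 / 2) * ‖x‖ ^ 2) = σ.real univ * A := by
    have := integral_angular_mul_radial (volume : Measure (E n))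
      (fun x => Real.exp (-(1 / 2) * ‖x‖ ^ 2)) (fun _ => 1)
      (fun ρ => Real.exp (-(1 / 2) * ρ ^ 2)) fun e ρ hρ => by
        rw [norm_smul, norm_eq_of_mem_sphere, mul_one, Real.norm_of_nonneg hρ.le, one_mul]
    rw [this]
    simp [hA, hm, σ]
  have hσ : 0 < σ.real univ := toSphere_real_univ_pos
  have hApos : 0 < A := by
    have hp := integral_gaussian_pos (V := E n)
    rw [e2] at hp
    exact pos_of_mul_pos_right hp hσ.le
  rw [integral_sphereUniform]
  rw [e1, e2] at h
  set J := ∫ e : sphere (0 : E n) 1, (f e - f (-e)) ^ 4 ∂σ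
  have hJ : 0 ≤ J := integral_nonneg fun e => by positivity
  -- With this bound the final constant is `6 · 100 · 6⁴ = 777600`, below `10 ^ 6`.
  have hpi : Real.pi ^ 4 ≤ 100 := by
    calc Real.pi ^ 4 ≤ 3.15 ^ 4 := by
          have := Real.pi_lt_d2
          have := Real.pi_pos
          gcongr
      _ ≤ 100 := by norm_num
  have h5 : J * (n * (n + 2)) ≤ 6 * Real.pi ^ 4 * (6 * K) ^ 4 * σ.real univ := by
    refine le_of_mul_le_mul_right ?_ hApos
    push_cast at h
    linarith
  rw [inv_mul_le_iff₀ hσ, mul_div_assoc', le_div_iff₀ (by positivity)]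
  have hK4 : (0 : ℝ) ≤ (K : ℝ) ^ 4 := by positivity
  calc J * n ^ 2 ≤ J * (n * (n + 2)) := by gcongr; nlinarith
    _ ≤ 6 * Real.pi ^ 4 * (6 * K) ^ 4 * σ.real univ := h5
    _ ≤ 6 * 100 * (6 * K) ^ 4 * σ.real univ := by gcongr
    _ ≤ σ.real univ * (10 ^ 6 * K ^ 4) := by nlinarith [mul_nonneg hK4 hσ.le]

end SphereConcentration

/-! ### The dual norm. -/

section DualNorm

variable {n : ℕ} {nrm : Seminorm ℝ (E n)}

theorem continuous_nrm (nrm : Seminorm ℝ (E n)) : Continuous nrm := by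
  have := nrm.convexOn.continuousOn isOpen_univ
  rwa [continuousOn_univ] at this

/-- The seminorm attains a positive minimum on the compact Euclidean sphere, unless the sphere is
empty, which happens for `n = 0`. -/
theorem exists_norm_le_nrm (h : ∀ x, nrm x = 0 → x = 0) :
    ∃ c : ℝ, 0 < c ∧ ∀ x, ‖x‖ ≤ c * nrm x := by
  rcases (Metric.sphere (0 : E n) 1).eq_empty_or_nonempty with he | hne
  · refine ⟨1, one_pos, fun x => ?_⟩
    rcases eq_or_ne x 0 with rfl | hx
    · simp
    · have : ‖x‖⁻¹ • x ∈ Metric.sphere (0 : E n) 1 := by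
        rw [mem_sphere_zero_iff_norm, norm_smul, norm_inv, norm_norm,
          inv_mul_cancel₀ (norm_ne_zero_iff.2 hx)]
      rw [he] at this
      exact this.elim
  obtain ⟨e, he, hmin⟩ := (isCompact_sphere (0 : E n) 1).exists_isMinOn hne
    (continuous_nrm nrm).continuousOn
  have hpos : 0 < nrm e := by
    refine lt_of_le_of_ne (apply_nonneg _ _) fun h0 => ?_
    have := h e h0.symm
    rw [this] at he
    simp at he
  refine ⟨(nrm e)⁻¹, inv_pos.2 hpos, fun x => ?_⟩
  rcases eq_or_ne x 0 with rfl | hx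
  · simp
  have hx' := norm_pos_iff.2 hx
  have h1 : ‖x‖⁻¹ • x ∈ Metric.sphere (0 : E n) 1 := by
    rw [mem_sphere_zero_iff_norm, norm_smul, norm_inv, norm_norm, inv_mul_cancel₀ hx'.ne']
  have h2 : nrm e ≤ nrm (‖x‖⁻¹ • x) := hmin h1
  rw [map_smul_eq_mul, norm_inv, norm_norm, ← div_eq_inv_mul, le_div_iff₀ hx'] at h2
  rw [← div_eq_inv_mul, le_div_iff₀ hpos]
  linarith

theorem bddAbove_dual (h : ∀ x, nrm x = 0 → x = 0) (y : E n) :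
    BddAbove ((fun x : E n => ⟪x, y⟫) '' {x | nrm x ≤ 1}) := by
  obtain ⟨c, hc, hcx⟩ := exists_norm_le_nrm h
  refine ⟨c * ‖y‖, ?_⟩
  rintro _ ⟨x, hx, rfl⟩
  refine (real_inner_le_norm x y).trans ?_
  refine mul_le_mul_of_nonneg_right ((hcx x).trans ?_) (norm_nonneg _)
  exact mul_le_of_le_one_right hc.le hx

theorem dualNorm_le {y : E n} {b : ℝ} (hb : ∀ x, nrm x ≤ 1 → ⟪x, y⟫ ≤ b) :
    dualNorm nrm y ≤ b := by
  refine csSup_le ⟨_, 0, by simp, rfl⟩ ?_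
  rintro _ ⟨x, hx, rfl⟩
  exact hb x hx

theorem inner_le_dualNorm (h : ∀ x, nrm x = 0 → x = 0) {x : E n} (hx : nrm x ≤ 1) (y : E n) :
    ⟪x, y⟫ ≤ dualNorm nrm y :=
  le_csSup (bddAbove_dual h y) ⟨x, hx, rfl⟩

theorem dualNorm_nonneg (h : ∀ x, nrm x = 0 → x = 0) (y : E n) : 0 ≤ dualNorm nrm y := by
  have := inner_le_dualNorm h (x := 0) (by simp) y
  simpa using this

theorem inner_le_nrm_mul_dualNorm (h : ∀ x, nrm x = 0 → x = 0) (x y : E n) :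
    ⟪x, y⟫ ≤ nrm x * dualNorm nrm y := by
  rcases eq_or_ne (nrm x) 0 with h0 | h0
  · rw [h x h0]; simp
  have hpos : 0 < nrm x := lt_of_le_of_ne (apply_nonneg _ _) (Ne.symm h0)
  have := inner_le_dualNorm h (x := (nrm x)⁻¹ • x) (by
    rw [map_smul_eq_mul, norm_inv, Real.norm_of_nonneg hpos.le, inv_mul_cancel₀ h0]) y
  rwa [real_inner_smul_left, inv_mul_le_iff₀ hpos] at this

theorem abs_inner_le_nrm_mul_dualNorm (h : ∀ x, nrm x = 0 → x = 0) (x y : E n) :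
    |⟪x, y⟫| ≤ nrm x * dualNorm nrm y := by
  refine abs_le'.2 ⟨inner_le_nrm_mul_dualNorm h x y, ?_⟩
  rw [← inner_neg_left]
  refine (inner_le_nrm_mul_dualNorm h (-x) y).trans_eq ?_
  rw [map_neg_eq_map]

theorem dualNorm_add_le (h : ∀ x, nrm x = 0 → x = 0) (y z : E n) :
    dualNorm nrm (y + z) ≤ dualNorm nrm y + dualNorm nrm z :=
  dualNorm_le fun x hx => by
    rw [inner_add_right]
    exact add_le_add (inner_le_dualNorm h hx y) (inner_le_dualNorm h hx z)

theorem dualNorm_smul_le (h : ∀ x, nrm x = 0 → x = 0) (a : ℝ) (y : E n) :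
    dualNorm nrm (a • y) ≤ |a| * dualNorm nrm y :=
  dualNorm_le fun x hx => by
    rw [real_inner_smul_right]
    refine (le_abs_self _).trans ?_
    rw [abs_mul]
    refine mul_le_mul_of_nonneg_left ?_ (abs_nonneg _)
    refine (abs_inner_le_nrm_mul_dualNorm h x y).trans ?_
    exact mul_le_of_le_one_left (dualNorm_nonneg h y) hx

theorem continuous_dualNorm (h : ∀ x, nrm x = 0 → x = 0) : Continuous (dualNorm nrm) := by
  obtain ⟨c, hc, hcx⟩ := exists_norm_le_nrm h
  have hle : ∀ y, dualNorm nrm y ≤ c * ‖y‖ := fun y => dualNorm_le fun x hx => by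
    refine (real_inner_le_norm x y).trans ?_
    refine mul_le_mul_of_nonneg_right ((hcx x).trans ?_) (norm_nonneg _)
    exact mul_le_of_le_one_right hc.le hx
  have key : ∀ y z, dualNorm nrm y - dualNorm nrm z ≤ c * ‖y - z‖ := fun y z => by
    have := dualNorm_add_le h (y - z) z
    rw [sub_add_cancel] at this
    linarith [hle (y - z)]
  refine (LipschitzWith.of_dist_le_mul (K := ⟨c, hc.le⟩) fun y z => ?_).continuous
  rw [Real.dist_eq, dist_eq_norm]
  refine abs_le'.2 ⟨key y z, ?_⟩
  rw [neg_sub]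
  refine (key z y).trans_eq ?_
  rw [norm_sub_rev]
  rfl

theorem dualNorm_pos (h : ∀ x, nrm x = 0 → x = 0) {y : E n} (hy : y ≠ 0) :
    0 < dualNorm nrm y := by
  have h1 := inner_le_nrm_mul_dualNorm h y y
  rw [real_inner_self_eq_norm_sq] at h1
  have : 0 < ‖y‖ ^ 2 := by have := norm_pos_iff.2 hy; positivity
  exact pos_of_mul_pos_right (this.trans_le h1) (apply_nonneg _ _)

end DualNorm

/-! ### First-order inequalities for gradients taken within a convex set. -/

section Segment

open Set Filter Topology

variable {n : ℕ} {Q : Set (E n)} {φ : E n → ℝ}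

theorem segment_mem (hQ : Convex ℝ Q) {x y : E n} (hx : x ∈ Q) (hy : y ∈ Q) {t : ℝ}
    (ht : t ∈ Icc (0 : ℝ) 1) : x + t • (y - x) ∈ Q :=
  hQ.add_smul_sub_mem hx hy ht

theorem hasDerivWithinAt_segment (hQ : Convex ℝ Q) {x y G : E n} (hx : x ∈ Q) (hy : y ∈ Q)
    {t : ℝ} (hG : HasGradientWithinAt φ G Q (x + t • (y - x))) :
    HasDerivWithinAt (fun s : ℝ => φ (x + s • (y - x))) ⟪G, y - x⟫ (Icc 0 1) t := by
  have h1 : HasDerivWithinAt (fun s : ℝ => x + s • (y - x)) (y - x) (Icc 0 1) t := by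
    have := (((hasDerivAt_id t).smul_const (y - x)).const_add x).hasDerivWithinAt (s := Icc 0 1)
    rw [one_smul] at this
    exact this
  have h2 := hG.hasFDerivWithinAt.comp_hasDerivWithinAt t h1 fun s hs => segment_mem hQ hx hy hs
  exact h2

/-- Only directions into `Q` are tested, so the ambiguity of `G` for `Q` with empty interior is
harmless. A countable sequence of slopes is taken since it also yields measurability in
`measurable_inner_gradient`. -/
theorem tendsto_segment_slope (hQ : Convex ℝ Q) {x y G : E n} (hx : x ∈ Q) (hy : y ∈ Q)
    (hG : HasGradientWithinAt φ G Q x) :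
    Tendsto (fun m : ℕ => ((m : ℝ) + 1) * (φ (x + ((m : ℝ) + 1)⁻¹ • (y - x)) - φ x)) atTop
      (𝓝 ⟪G, y - x⟫) := by
  have h := hasDerivWithinAt_segment (t := 0) hQ hx hy (by simpa using hG)
  rw [hasDerivWithinAt_iff_tendsto_slope] at h
  have ht : Tendsto (fun m : ℕ => ((m : ℝ) + 1)⁻¹) atTop (𝓝[Icc 0 1 \ {0}] 0) := by
    refine tendsto_nhdsWithin_iff.2 ⟨?_, Eventually.of_forall fun m => ⟨⟨by positivity, ?_⟩, ?_⟩⟩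
    · exact tendsto_inv_atTop_zero.comp
        (tendsto_atTop_add_const_right _ _ tendsto_natCast_atTop_atTop)
    · exact inv_le_one_of_one_le₀ (by linarith [(Nat.cast_nonneg m : (0 : ℝ) ≤ m)])
    · simp only [mem_singleton_iff, inv_eq_zero]; positivity
  refine (h.comp ht).congr fun m => ?_
  simp [slope_def_field]
  ring

theorem add_inner_le_of_convexOn (hφ : ConvexOn ℝ Q φ) {x y G : E n} (hx : x ∈ Q) (hy : y ∈ Q)
    (hG : HasGradientWithinAt φ G Q x) : φ x + ⟪G, y - x⟫ ≤ φ y := by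
  have hlim := tendsto_segment_slope hφ.1 hx hy hG
  have : ⟪G, y - x⟫ ≤ φ y - φ x := by
    refine le_of_tendsto hlim (Eventually.of_forall fun m => ?_)
    have hm : (0 : ℝ) < (m : ℝ) + 1 := by positivity
    set a : ℝ := ((m : ℝ) + 1)⁻¹ with ha
    have ha0 : 0 < a := inv_pos.2 hm
    have ha1 : a ≤ 1 := inv_le_one_of_one_le₀ (by linarith [(Nat.cast_nonneg m : (0 : ℝ) ≤ m)])
    have h := hφ.2 hx hy (sub_nonneg.2 ha1) ha0.le (by ring)
    have e : (1 - a) • x + a • y = x + a • (y - x) := by module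
    rw [e, smul_eq_mul, smul_eq_mul] at h
    rw [← le_div_iff₀' hm, div_eq_inv_mul, ← ha]
    linarith
  linarith

theorem inner_nonneg_of_isMinOn (hQ : Convex ℝ Q) {x y G : E n} (hx : x ∈ Q) (hy : y ∈ Q)
    (hG : HasGradientWithinAt φ G Q x) (hmin : IsMinOn φ Q x) : 0 ≤ ⟪G, y - x⟫ := by
  refine ge_of_tendsto (tendsto_segment_slope hQ hx hy hG) (Eventually.of_forall fun m => ?_)
  have hm : (0 : ℝ) < (m : ℝ) + 1 := by positivity
  refine mul_nonneg hm.le (sub_nonneg.2 (hmin (segment_mem hQ hx hy ⟨by positivity, ?_⟩)))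
  exact inv_le_one_of_one_le₀ (by linarith [(Nat.cast_nonneg m : (0 : ℝ) ≤ m)])

/-- The descent lemma on a convex set. -/
theorem le_add_inner_add_sq {nrm : Seminorm ℝ (E n)} (hn : ∀ x, nrm x = 0 → x = 0)
    (hQ : Convex ℝ Q) {gradφ : E n → E n} {L : ℝ}
    (hG : ∀ x ∈ Q, HasGradientWithinAt φ (gradφ x) Q x)
    (hL : ∀ x ∈ Q, ∀ y ∈ Q, dualNorm nrm (gradφ x - gradφ y) ≤ L * nrm (x - y))
    {x y : E n} (hx : x ∈ Q) (hy : y ∈ Q) :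
    φ y ≤ φ x + ⟪gradφ x, y - x⟫ + L / 2 * nrm (y - x) ^ 2 := by
  -- The subtracted quadratic has slope `L t ‖y - x‖²`, which dominates the change of the
  -- directional derivative; hence `ψ` decreases, and comparing `t = 0, 1` gives the claim.
  set ψ : ℝ → ℝ := fun t =>
    φ (x + t • (y - x)) - t * ⟪gradφ x, y - x⟫ - L / 2 * nrm (y - x) ^ 2 * t ^ 2 with hψ
  have hd : ∀ t ∈ Icc (0 : ℝ) 1, HasDerivWithinAt ψ (⟪gradφ (x + t • (y - x)), y - x⟫
      - ⟪gradφ x, y - x⟫ - L * nrm (y - x) ^ 2 * t) (Icc 0 1) t := fun t ht => by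
    have h1 := hasDerivWithinAt_segment hQ hx hy (hG _ (segment_mem hQ hx hy ht))
    have h2 := ((hasDerivAt_id t).mul_const ⟪gradφ x, y - x⟫).hasDerivWithinAt (s := Icc 0 1)
    have h3 := (((hasDerivAt_id t).pow 2).const_mul
      (L / 2 * nrm (y - x) ^ 2)).hasDerivWithinAt (s := Icc 0 1)
    have h4 := (h1.sub h2).sub h3
    refine h4.congr_deriv ?_
    simp
    ring
  have hanti : AntitoneOn ψ (Icc 0 1) := by
    refine antitoneOn_of_hasDerivWithinAt_nonpos (convex_Icc 0 1)
      (fun t ht => (hd t ht).continuousWithinAt)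
      (fun t ht => (hd t (interior_subset ht)).mono interior_subset) fun t ht => ?_
    have ht' := interior_subset ht
    have h1 := inner_le_nrm_mul_dualNorm hn (y - x) (gradφ (x + t • (y - x)) - gradφ x)
    rw [real_inner_comm, inner_sub_left] at h1
    have h2 := hL _ (segment_mem hQ hx hy ht') x hx
    rw [add_sub_cancel_left, map_smul_eq_mul, Real.norm_of_nonneg ht'.1] at h2
    have h3 := mul_le_mul_of_nonneg_left h2 (apply_nonneg nrm (y - x))
    nlinarith
  have h01 := hanti (left_mem_Icc.2 zero_le_one) (right_mem_Icc.2 zero_le_one) zero_le_one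
  simp only [hψ, one_smul, zero_smul, add_zero, add_sub_cancel] at h01
  linarith

end Segment

/-! ### Second-moment inequalities and consequences of the standing assumptions. -/

open Set Filter Topology

/-- The Cauchy-Schwarz inequality in terms of bounds for the second moments. -/
theorem integral_mul_le_of_sq_le {α : Type*} [MeasurableSpace α] {μ : Measure α} {X Y : α → ℝ}
    {A B : ℝ} (hA : 0 ≤ A) (hB : 0 < B) (hX : Integrable (fun a => X a ^ 2) μ)
    (hY : Integrable (fun a => Y a ^ 2) μ) (hXY : Integrable (fun a => X a * Y a) μ)
    (hXA : ∫ a, X a ^ 2 ∂μ ≤ A ^ 2) (hYB : ∫ a, Y a ^ 2 ∂μ ≤ B ^ 2) :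
    ∫ a, X a * Y a ∂μ ≤ A * B := by
  -- Young's inequality with weights adapted to `C` and `B`. Since `A` may vanish, it is replaced by
  -- a positive `C` that is sent to `A` at the end.
  have key : ∀ C : ℝ, 0 < C → A ≤ C → ∫ a, X a * Y a ∂μ ≤ C * B := fun C hC hAC => by
    have hXC : ∫ a, X a ^ 2 ∂μ ≤ C ^ 2 := hXA.trans (by gcongr)
    calc ∫ a, X a * Y a ∂μ ≤ ∫ a, (B / (2 * C) * X a ^ 2 + C / (2 * B) * Y a ^ 2) ∂μ := by
          refine integral_mono hXY ((hX.const_mul _).add (hY.const_mul _)) fun a => ?_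
          have h : 0 ≤ (B * X a - C * Y a) ^ 2 / (2 * B * C) := by positivity
          have e : (B * X a - C * Y a) ^ 2 / (2 * B * C)
            = B / (2 * C) * X a ^ 2 + C / (2 * B) * Y a ^ 2 - X a * Y a := by field_simp; ring
          simp only
          linarith
      _ = B / (2 * C) * ∫ a, X a ^ 2 ∂μ + C / (2 * B) * ∫ a, Y a ^ 2 ∂μ := by
          rw [integral_add (hX.const_mul _) (hY.const_mul _), integral_const_mul,
            integral_const_mul]
      _ ≤ B / (2 * C) * C ^ 2 + C / (2 * B) * B ^ 2 := by gcongr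
      _ = C * B := by field_simp; ring
  refine le_of_forall_pos_le_add fun η hη => ?_
  have h := key (A + η / B) (by positivity) (by linarith [div_pos hη hB])
  rwa [add_mul, div_mul_cancel₀ _ hB.ne'] at h

/-- The first moment is bounded by the root of the second one. -/
theorem integral_le_of_sq_le {α : Type*} [MeasurableSpace α] {μ : Measure α}
    [IsProbabilityMeasure μ] {X : α → ℝ} {A : ℝ} (hA : 0 ≤ A)
    (hX : Integrable (fun a => X a ^ 2) μ) (hX1 : Integrable X μ) (hXA : ∫ a, X a ^ 2 ∂μ ≤ A ^ 2) :
    ∫ a, X a ∂μ ≤ A := by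
  have := integral_mul_le_of_sq_le (Y := fun _ => 1) hA one_pos hX (by simp) (by simpa using hX1)
    hXA (by simp)
  simpa using this

namespace Problem

variable {n : ℕ} {Ξ : Type u} [MeasurableSpace Ξ] {S : Problem n Ξ}

theorem add_mem_Qs {x y : E n} (hx : x ∈ S.Q) (hy : ‖y‖ ≤ S.s) : x + y ∈ S.Qs :=
  ⟨x, hx, y, hy, rfl⟩

theorem mem_Qs {x : E n} (hx : x ∈ S.Q) (hs : 0 ≤ S.s) : x ∈ S.Qs := by
  have := add_mem_Qs (y := 0) hx (by simpa using hs)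
  rwa [add_zero] at this

theorem add_smul_mem_Qs {r : ℝ} (hr : 0 < r) (hrs : r ≤ S.s) {x e : E n} (hx : x ∈ S.Q)
    (he : ‖e‖ ≤ 1) : x + r • e ∈ S.Qs := by
  refine add_mem_Qs hx ?_
  rw [norm_smul, Real.norm_of_nonneg hr.le]
  exact (mul_le_of_le_one_right hr.le he).trans hrs

theorem sub_smul_mem_Qs {r : ℝ} (hr : 0 < r) (hrs : r ≤ S.s) {x e : E n} (hx : x ∈ S.Q)
    (he : ‖e‖ ≤ 1) : x - r • e ∈ S.Qs := by
  have := add_smul_mem_Qs hr hrs hx (e := -e) (by rwa [norm_neg])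
  rwa [smul_neg, ← sub_eq_add_neg] at this

/-- The same problem with a noiseless oracle. -/
def noiseless (S : Problem n Ξ) : Problem n Ξ := { S with noise := fun _ => 0, Δ := 0 }

namespace Assumptions

variable (hS : S.Assumptions)
include hS

theorem noiseless : S.noiseless.Assumptions :=
  { nrm_definite := hS.nrm_definite
    Q_compact := hS.Q_compact
    Q_convex := hS.Q_convex
    ν_diff := hS.ν_diff
    ν_strong := hS.ν_strong
    V_bdd := hS.V_bdd
    g_convex := hS.g_convex
    g_diff := hS.g_diff
    g_smooth := hS.g_smooth
    L_pos := hS.L_pos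
    P_prob := hS.P_prob
    fξ_meas := hS.fξ_meas
    f_convex := hS.f_convex
    f_mean := hS.f_mean
    fξ_grad := hS.fξ_grad
    Mξ_sq := hS.Mξ_sq
    M_pos := hS.M_pos
    noise_meas := measurable_const
    noise_bdd := fun x _ => by simp [Problem.noiseless] }

/-- The mean value inequality on `Qs`, whose convexity is part of `f_convex`. -/
theorem ae_fξ_lipschitz : ∀ᵐ ξ ∂S.P, ∀ x ∈ S.Qs, ∀ y ∈ S.Qs,
    |S.fξ x ξ - S.fξ y ξ| ≤ S.Mξ ξ * ‖x - y‖ := by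
  filter_upwards [hS.fξ_grad] with ξ hξ x hx y hy
  choose! G hG using hξ
  have := hS.f_convex.1.norm_image_sub_le_of_norm_hasFDerivWithin_le
    (f := fun y => S.fξ y ξ) (C := S.Mξ ξ) (fun z hz => (hG z hz).1.hasFDerivWithinAt)
    (fun z hz => by rw [LinearIsometryEquiv.norm_map]; exact (hG z hz).2) hy hx
  simpa [Real.norm_eq_abs] using this

theorem ae_Mξ_nonneg {x : E n} (hx : x ∈ S.Qs) : ∀ᵐ ξ ∂S.P, 0 ≤ S.Mξ ξ := by
  filter_upwards [hS.fξ_grad] with ξ hξ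
  obtain ⟨G, -, hG⟩ := hξ x hx
  exact (norm_nonneg _).trans hG

/-- Measurability of `Mξ` is recovered from that of its square, since `Mξ` is almost surely the
nonnegative root. -/
theorem integrable_Mξ {x : E n} (hx : x ∈ S.Qs) : Integrable S.Mξ S.P := by
  have := hS.P_prob
  have hm : AEStronglyMeasurable S.Mξ S.P := by
    refine (Real.continuous_sqrt.comp_aestronglyMeasurable
      hS.Mξ_sq.1.aestronglyMeasurable).congr ?_
    filter_upwards [hS.ae_Mξ_nonneg hx] with ξ hξ
    exact Real.sqrt_sq hξ
  exact ((memLp_two_iff_integrable_sq hm).2 hS.Mξ_sq.1).integrable one_le_two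

theorem integral_Mξ_le {x : E n} (hx : x ∈ S.Qs) : ∫ ξ, S.Mξ ξ ∂S.P ≤ S.M := by
  have := hS.P_prob
  exact integral_le_of_sq_le hS.M_pos.le hS.Mξ_sq.1 (hS.integrable_Mξ hx) hS.Mξ_sq.2.le

theorem f_lipschitz {x y : E n} (hx : x ∈ S.Qs) (hy : y ∈ S.Qs) :
    |S.f x - S.f y| ≤ S.M * ‖x - y‖ := by
  rw [← (hS.f_mean x hx).2, ← (hS.f_mean y hy).2,
    ← integral_sub (hS.f_mean x hx).1 (hS.f_mean y hy).1]
  refine (abs_integral_le_integral_abs).trans ?_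
  calc ∫ ξ, |S.fξ x ξ - S.fξ y ξ| ∂S.P ≤ ∫ ξ, S.Mξ ξ * ‖x - y‖ ∂S.P := by
        refine integral_mono_ae ((hS.f_mean x hx).1.sub (hS.f_mean y hy).1).abs
          ((hS.integrable_Mξ hx).mul_const _) ?_
        filter_upwards [hS.ae_fξ_lipschitz] with ξ hξ
        exact hξ x hx y hy
    _ = (∫ ξ, S.Mξ ξ ∂S.P) * ‖x - y‖ := integral_mul_const _ _
    _ ≤ _ := by
        have := hS.integral_Mξ_le hx
        gcongr

/-- Nothing is known about `f` outside `Qs`, not even measurability. In sphere and ball averages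
around points of `Q` it can be exchanged for a globally continuous function. -/
theorem exists_lipschitz_extension :
    ∃ φ : E n → ℝ, Continuous φ ∧ EqOn S.f φ S.Qs := by
  have : LipschitzOnWith ⟨S.M, hS.M_pos.le⟩ S.f S.Qs :=
    LipschitzOnWith.of_dist_le_mul fun x hx y hy => by
      rw [Real.dist_eq, dist_eq_norm]; exact hS.f_lipschitz hx hy
  obtain ⟨φ, hφ, he⟩ := this.extend_real
  exact ⟨φ, hφ.continuous, he⟩

theorem Δ_nonneg {x : E n} (hx : x ∈ S.Qs) : 0 ≤ S.Δ :=
  (abs_nonneg _).trans (hS.noise_bdd x hx)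

theorem bddAbove_dist : BddAbove {d | ∃ x ∈ S.Q, ∃ y ∈ S.Q, d = S.nrm (x - y)} := by
  have h : IsCompact ((fun z : E n × E n => S.nrm (z.1 - z.2)) '' S.Q ×ˢ S.Q) :=
    (hS.Q_compact.prod hS.Q_compact).image
      ((continuous_nrm S.nrm).comp (continuous_fst.sub continuous_snd))
  refine h.bddAbove.mono ?_
  rintro _ ⟨x, hx, y, hy, rfl⟩
  exact ⟨(x, y), ⟨hx, hy⟩, rfl⟩

theorem nrm_sub_le_DQ {x y : E n} (hx : x ∈ S.Q) (hy : y ∈ S.Q) : S.nrm (x - y) ≤ S.DQ :=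
  le_csSup hS.bddAbove_dist ⟨x, hx, y, hy, rfl⟩

theorem half_sq_le_V {x y : E n} (hx : x ∈ S.Q) (hy : y ∈ S.Q) :
    1 / 2 * S.nrm (y - x) ^ 2 ≤ S.V x y := by
  have := hS.ν_strong x hx y hy
  unfold V
  linarith

theorem V_nonneg {x y : E n} (hx : x ∈ S.Q) (hy : y ∈ S.Q) : 0 ≤ S.V x y :=
  le_trans (by positivity) (hS.half_sq_le_V hx hy)

theorem V_le {x y : E n} (hx : x ∈ S.Q) (hy : y ∈ S.Q) : S.V x y ≤ S.DQV ^ 2 / 2 := by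
  have h : √(2 * S.V x y) ≤ S.DQV := le_csSup hS.V_bdd ⟨x, hx, y, hy, rfl⟩
  have := Real.sqrt_le_iff.1 h
  linarith

theorem DQ_le_DQV {x₀ : E n} (hx₀ : x₀ ∈ S.Q) : S.DQ ≤ S.DQV := by
  refine csSup_le ⟨_, x₀, hx₀, x₀, hx₀, rfl⟩ ?_
  rintro _ ⟨x, hx, y, hy, rfl⟩
  refine le_trans (Real.le_sqrt_of_sq_le ?_) (le_csSup hS.V_bdd ⟨y, hy, x, hx, rfl⟩)
  linarith [hS.half_sq_le_V hy hx]

end Assumptions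

/-! ### The smoothed function `F`: convexity, distance to `f`, subgradients. -/

section Sphere

variable [NeZero n] {r p : ℝ}

theorem F_eq (hr : 0 < r) (hrs : r ≤ S.s) {φ : E n → ℝ} (hφ : EqOn S.f φ S.Qs)
    {x : E n} (hx : x ∈ S.Q) : S.F r x = ∫ b, φ (x + r • b) ∂ballUniform n := by
  refine integral_congr_ae ?_
  filter_upwards [ae_ballUniform_norm (n := n)] with b hb
  exact hφ (add_smul_mem_Qs hr hrs hx hb)

variable (hS : S.Assumptions)
include hS

theorem Assumptions.F_convexOn (hr : 0 < r) (hrs : r ≤ S.s) : ConvexOn ℝ S.Q (S.F r) := by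
  obtain ⟨φ, hφ, he⟩ := hS.exists_lipschitz_extension
  have hi : ∀ x : E n, Integrable (fun b => φ (x + r • b)) (ballUniform n) := fun x =>
    integrable_ballUniform (by fun_prop)
  refine ⟨hS.Q_convex, fun x hx y hy a b ha hb hab => ?_⟩
  rw [F_eq hr hrs he (hS.Q_convex hx hy ha hb hab), F_eq hr hrs he hx, F_eq hr hrs he hy,
    smul_eq_mul, smul_eq_mul, ← integral_const_mul, ← integral_const_mul,
    ← integral_add ((hi x).const_mul a) ((hi y).const_mul b)]
  refine integral_mono_ae (hi _) (((hi x).const_mul a).add ((hi y).const_mul b)) ?_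
  filter_upwards [ae_ballUniform_norm (n := n)] with z hz
  have h1 := add_smul_mem_Qs hr hrs hx hz
  have h2 := add_smul_mem_Qs hr hrs hy hz
  have h3 := hS.f_convex.2 h1 h2 ha hb hab
  have e : a • (x + r • z) + b • (y + r • z) = a • x + b • y + r • z := by
    rw [smul_add, smul_add, add_add_add_comm, ← add_smul, hab, one_smul]
  rw [e, he h1, he h2, he (add_smul_mem_Qs hr hrs (hS.Q_convex hx hy ha hb hab) hz)] at h3
  exact h3

theorem Assumptions.abs_F_sub_f_le (hr : 0 < r) (hrs : r ≤ S.s) {x : E n} (hx : x ∈ S.Q) :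
    |S.F r x - S.f x| ≤ r * S.M := by
  obtain ⟨φ, hφ, he⟩ := hS.exists_lipschitz_extension
  have hi : Integrable (fun b => φ (x + r • b)) (ballUniform n) :=
    integrable_ballUniform (by fun_prop)
  have h0 : S.f x = ∫ _, S.f x ∂ballUniform n := by simp
  rw [F_eq hr hrs he hx, h0, ← integral_sub hi (integrable_const _), ← Real.norm_eq_abs]
  refine (norm_integral_le_of_norm_le_const (C := r * S.M) ?_).trans (by simp)
  filter_upwards [ae_ballUniform_norm (n := n)] with b hb
  have h1 := add_smul_mem_Qs hr hrs hx hb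
  rw [← he h1, Real.norm_eq_abs]
  refine (hS.f_lipschitz h1 (mem_Qs hx (hr.le.trans hrs))).trans ?_
  rw [add_sub_cancel_left, norm_smul, Real.norm_of_nonneg hr.le]
  have := hS.M_pos
  calc S.M * (r * ‖b‖) ≤ S.M * (r * 1) := by gcongr
    _ = r * S.M := by ring

/-- The subgradient inequality for the smoothed function. -/
theorem Assumptions.F_sub_le_integral (hr : 0 < r) (hrs : r ≤ S.s) {v u : E n} (hv : v ∈ S.Q)
    (hu : u ∈ S.Q) :
    S.F r v - S.F r u ≤ ∫ e, (n : ℝ) / (2 * r) * (S.f (v + r • e) - S.f (v - r • e)) * ⟪e, v - u⟫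
      ∂sphereUniform n := by
  obtain ⟨φ, hφ, he⟩ := hS.exists_lipschitz_extension
  set ψ : E n → ℝ := fun b => φ (v + r • b) with hψ
  have hψc : Continuous ψ := by fun_prop
  have hd := hasDerivAt_integral_ballUniform hψc (r⁻¹ • (u - v))
  have hFe : ∀ t ∈ Icc (0 : ℝ) 1,
      ∫ b, ψ (b + t • r⁻¹ • (u - v)) ∂ballUniform n = S.F r (v + t • (u - v)) := fun t ht => by
    rw [F_eq hr hrs he (segment_mem hS.Q_convex hv hu ht)]
    congr 1
    funext b
    simp only [hψ]
    congr 1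
    rw [smul_add, smul_comm t, smul_smul r r⁻¹, mul_inv_cancel₀ hr.ne', one_smul]
    abel
  have hle : (n : ℝ) * ∫ e, ψ e * ⟪e, r⁻¹ • (u - v)⟫ ∂sphereUniform n ≤ S.F r u - S.F r v := by
    -- The translated average is known to equal `F` only for `t` in `[0, 1]`, where the shifted
    -- center stays in `Q`; so right slopes are compared.
    have hnhds : 𝓝[>] (0 : ℝ) ≤ 𝓝[≠] 0 := nhdsWithin_mono _ fun x hx => ne_of_gt (mem_Ioi.1 hx)
    have hslope := (hasDerivAt_iff_tendsto_slope_zero.1 hd).mono_left hnhds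
    refine le_of_tendsto hslope ?_
    have : Ioc (0 : ℝ) 1 ∈ 𝓝[>] (0 : ℝ) := Ioc_mem_nhdsGT one_pos
    filter_upwards [this] with t ht
    have h1 := hFe t ⟨ht.1.le, ht.2⟩
    have h0 := hFe 0 ⟨le_rfl, zero_le_one⟩
    rw [zero_add, h1, h0, zero_smul, add_zero, smul_eq_mul, inv_mul_le_iff₀ ht.1]
    have hc := (hS.F_convexOn hr hrs).2 hv hu (sub_nonneg.2 ht.2) ht.1.le (by ring)
    have e : (1 - t) • v + t • u = v + t • (u - v) := by module
    rw [e, smul_eq_mul, smul_eq_mul] at hc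
    linarith
  -- The two points `v + r e` and `v - r e` contribute equally, which turns `n / r` into `n / (2
  -- r)`.
  have hneg := integral_sphereUniform_neg_mul_inner hψc (v - u)
  have hi1 : Integrable (fun e => ψ e * ⟪e, v - u⟫) (sphereUniform n) :=
    integrable_sphereUniform (by fun_prop)
  have hi2 : Integrable (fun e => ψ (-e) * ⟪e, v - u⟫) (sphereUniform n) :=
    integrable_sphereUniform (by fun_prop)
  have e1 : ∫ e, (n : ℝ) / (2 * r) * (S.f (v + r • e) - S.f (v - r • e)) * ⟪e, v - u⟫
      ∂sphereUniform n = (n : ℝ) / r * ∫ e, ψ e * ⟪e, v - u⟫ ∂sphereUniform n := by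
    have : ∫ e, (n : ℝ) / (2 * r) * (S.f (v + r • e) - S.f (v - r • e)) * ⟪e, v - u⟫
      ∂sphereUniform n = (n : ℝ) / (2 * r) * ∫ e, (ψ e * ⟪e, v - u⟫ - ψ (-e) * ⟪e, v - u⟫)
        ∂sphereUniform n := by
      rw [← integral_const_mul]
      refine integral_congr_ae ?_
      filter_upwards [ae_sphereUniform_norm (n := n)] with e hee
      rw [he (add_smul_mem_Qs hr hrs hv hee.le), he (sub_smul_mem_Qs hr hrs hv hee.le)]
      simp only [hψ, smul_neg, ← sub_eq_add_neg]
      ring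
    rw [this, integral_sub hi1 hi2, hneg]
    field_simp
    ring
  rw [e1]
  have e2 : (n : ℝ) * ∫ e, ψ e * ⟪e, r⁻¹ • (u - v)⟫ ∂sphereUniform n
      = -((n : ℝ) / r * ∫ e, ψ e * ⟪e, v - u⟫ ∂sphereUniform n) := by
    have : ∀ e : E n, ψ e * ⟪e, r⁻¹ • (u - v)⟫ = -r⁻¹ * (ψ e * ⟪e, v - u⟫) := fun e => by
      rw [real_inner_smul_right, ← neg_sub v u, inner_neg_right]; ring
    simp_rw [this]
    rw [integral_const_mul]
    ring
  linarith

end Sphere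

end Problem

/-! ### Bias and second moment of the two-point estimator. -/

namespace Problem

variable {n : ℕ} {Ξ : Type u} [MeasurableSpace Ξ] {S : Problem n Ξ} [NeZero n] {r p : ℝ}

/-- The law of a single sample `(ξ, e)`. -/
noncomputable def sampleLaw (S : Problem n Ξ) : Measure (Ξ × E n) := S.P.prod (sphereUniform n)

/-- The bound for the second moment of the dual norm of the estimator. -/
noncomputable def sigmaSq (S : Problem n Ξ) (r p : ℝ) : ℝ :=
  500 * p ^ 2 * ((n : ℝ) * S.M ^ 2 + (n : ℝ) ^ 2 * S.Δ ^ 2 / r ^ 2)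

section Moments

variable (hS : S.Assumptions) (hp : S.IsPStar p)
include hS

/-- Strict positivity forces `0 < p`, as needed when `p ^ 2` serves as the positive bound in
`integral_mul_le_of_sq_le`. -/
theorem Assumptions.integral_dualNorm_pow_pos :
    0 < ∫ e, dualNorm S.nrm e ^ 4 ∂sphereUniform n := by
  refine lt_of_le_of_ne (integral_nonneg fun e => by positivity) fun h0 => ?_
  have hc := continuous_dualNorm hS.nrm_definite
  have h := (integral_eq_zero_iff_of_nonneg
    (fun e => pow_nonneg (dualNorm_nonneg hS.nrm_definite e) 4)
    (integrable_sphereUniform (hc.pow 4))).1 h0.symm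
  obtain ⟨e, he, he1⟩ := (h.and (ae_sphereUniform_norm (n := n))).exists
  have : 0 < dualNorm S.nrm e := dualNorm_pos hS.nrm_definite fun h => by simp [h] at he1
  simp only [Pi.zero_apply] at he
  exact (pow_pos this 4).ne' he

include hp

theorem Assumptions.p_pos : 0 < p :=
  (Real.rpow_pos_of_pos hS.integral_dualNorm_pow_pos _).trans_le hp

theorem Assumptions.integral_dualNorm_pow_le : ∫ e, dualNorm S.nrm e ^ 4 ∂sphereUniform n ≤ p ^ 4 := by
  have h0 := hS.integral_dualNorm_pow_pos
  set I := ∫ e, dualNorm S.nrm e ^ 4 ∂sphereUniform n with hI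
  have h1 : (I ^ (1 / 4 : ℝ)) ^ 4 = I := by
    rw [← Real.rpow_natCast, ← Real.rpow_mul h0.le]
    norm_num
  rw [← h1]
  exact pow_le_pow_left₀ (Real.rpow_nonneg h0.le _) hp 4

theorem Assumptions.integral_dualNorm_sq_le :
    ∫ e, dualNorm S.nrm e ^ 2 ∂sphereUniform n ≤ p ^ 2 := by
  have hc := continuous_dualNorm hS.nrm_definite
  refine integral_le_of_sq_le (by positivity) (integrable_sphereUniform (by fun_prop))
    (integrable_sphereUniform (by fun_prop)) ?_
  simp_rw [← pow_mul]
  exact hS.integral_dualNorm_pow_le hp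

theorem Assumptions.integral_dualNorm_le : ∫ e, dualNorm S.nrm e ∂sphereUniform n ≤ p := by
  have hc := continuous_dualNorm hS.nrm_definite
  exact integral_le_of_sq_le (hS.p_pos hp).le (integrable_sphereUniform (by fun_prop))
    (integrable_sphereUniform hc) (hS.integral_dualNorm_sq_le hp)

end Moments

theorem Assumptions.measurable_zoGrad (hS : S.Assumptions) (r : ℝ) :
    Measurable fun w : E n × (Ξ × E n) => S.zoGrad r w.1 w.2.1 w.2.2 := by
  have hf := hS.fξ_meas
  have hn := hS.noise_meas
  have hft : ∀ a : ℝ, Measurable fun w : E n × (Ξ × E n) =>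
      S.ftilde (w.1 + a • w.2.2) w.2.1 := fun a => by
    have hx : Measurable fun w : E n × (Ξ × E n) => w.1 + a • w.2.2 := by fun_prop
    exact (hf.comp (hx.prodMk (by fun_prop))).add (hn.comp hx)
  have h2 := hft (-r)
  simp only [neg_smul, ← sub_eq_add_neg] at h2
  exact (((hft r).sub h2).const_mul _).smul (by fun_prop)

section Oracle

variable (hS : S.Assumptions) (hp : S.IsPStar p) (hr : 0 < r) (hrs : r ≤ S.s)

/-- The increment of the noiseless oracle. -/
def incr (S : Problem n Ξ) (r : ℝ) (v : E n) (z : Ξ × E n) : ℝ :=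
  S.fξ (v + r • z.2) z.1 - S.fξ (v - r • z.2) z.1

theorem zoGrad_eq (v : E n) (z : Ξ × E n) :
    S.zoGrad r v z.1 z.2 = ((n : ℝ) / (2 * r) * (S.incr r v z
      + (S.noise (v + r • z.2) - S.noise (v - r • z.2)))) • z.2 := by
  unfold zoGrad ftilde incr
  congr 2
  ring

include hS

theorem Assumptions.measurable_incr (v : E n) : Measurable (S.incr r v) := by
  have hf := hS.fξ_meas
  have h1 : Measurable fun z : Ξ × E n => (v + r • z.2, z.1) := by fun_prop
  have h2 : Measurable fun z : Ξ × E n => (v - r • z.2, z.1) := by fun_prop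
  exact (hf.comp h1).sub (hf.comp h2)

theorem ae_sampleLaw_norm : ∀ᵐ z ∂S.sampleLaw, ‖z.2‖ = 1 := by
  have := hS.P_prob
  exact Measure.quasiMeasurePreserving_snd.ae (ae_sphereUniform_norm (n := n))

include hr hrs

theorem Assumptions.ae_abs_incr_le {v : E n} (hv : v ∈ S.Q) : ∀ᵐ ξ ∂S.P, 0 ≤ S.Mξ ξ ∧
    LipschitzOnWith (r * S.Mξ ξ).toNNReal (fun e => S.fξ (v + r • e) ξ) (Metric.sphere 0 1) ∧
    ∀ e : E n, ‖e‖ = 1 → |S.incr r v (ξ, e)| ≤ 2 * r * S.Mξ ξ := by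
  filter_upwards [hS.ae_fξ_lipschitz, hS.ae_Mξ_nonneg (mem_Qs hv (hr.le.trans hrs))] with ξ h1 h2
  refine ⟨h2, LipschitzOnWith.of_dist_le_mul fun x hx y hy => ?_, fun e he => ?_⟩
  · rw [mem_sphere_zero_iff_norm] at hx hy
    rw [Real.dist_eq, dist_eq_norm, Real.coe_toNNReal _ (by positivity)]
    refine (h1 _ (add_smul_mem_Qs hr hrs hv hx.le) _ (add_smul_mem_Qs hr hrs hv hy.le)).trans_eq ?_
    rw [add_sub_add_left_eq_sub, ← smul_sub, norm_smul, Real.norm_of_nonneg hr.le]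
    ring
  · refine (h1 _ (add_smul_mem_Qs hr hrs hv he.le) _ (sub_smul_mem_Qs hr hrs hv he.le)).trans_eq ?_
    have e1 : v + r • e - (v - r • e) = (2 * r) • e := by module
    rw [e1, norm_smul, he, Real.norm_of_nonneg (by positivity)]
    ring

theorem Assumptions.ae_sampleLaw_abs_incr_le {v : E n} (hv : v ∈ S.Q) :
    ∀ᵐ z ∂S.sampleLaw, ‖z.2‖ = 1 ∧ 0 ≤ S.Mξ z.1 ∧ |S.incr r v z| ≤ 2 * r * S.Mξ z.1 := by
  have := hS.P_prob
  have h := Measure.quasiMeasurePreserving_fst (μ := S.P) (ν := sphereUniform n) |>.ae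
    (hS.ae_abs_incr_le hr hrs hv)
  filter_upwards [ae_sampleLaw_norm hS, h] with z h1 h2
  exact ⟨h1, h2.1, h2.2.2 z.2 h1⟩

theorem Assumptions.abs_noise_sub_le {v e : E n} (hv : v ∈ S.Q) (he : ‖e‖ = 1) :
    |S.noise (v + r • e) - S.noise (v - r • e)| ≤ 2 * S.Δ := by
  have h1 := hS.noise_bdd _ (add_smul_mem_Qs hr hrs hv he.le)
  have h2 := hS.noise_bdd _ (sub_smul_mem_Qs hr hrs hv he.le)
  have := abs_sub (S.noise (v + r • e)) (S.noise (v - r • e))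
  linarith

theorem Assumptions.integrable_incr_sq {v : E n} (hv : v ∈ S.Q) :
    Integrable (fun z => S.incr r v z ^ 2 * dualNorm S.nrm z.2 ^ 2) S.sampleLaw := by
  have := hS.P_prob
  have hc := continuous_dualNorm hS.nrm_definite
  have hc2 : Continuous fun e => dualNorm S.nrm e ^ 2 := hc.pow 2
  have hb := (hS.Mξ_sq.1.mul_prod (integrable_sphereUniform (n := n) hc2)).const_mul
    ((2 * r) ^ 2)
  refine Integrable.mono' hb ?_ ?_
  · exact (((hS.measurable_incr v).pow_const 2).mul
      ((hc.measurable.comp measurable_snd).pow_const 2)).aestronglyMeasurable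
  · filter_upwards [hS.ae_sampleLaw_abs_incr_le hr hrs hv] with z hz
    rw [Real.norm_of_nonneg (by positivity)]
    have h1 := pow_le_pow_left₀ (abs_nonneg _) hz.2.2 2
    rw [sq_abs] at h1
    calc S.incr r v z ^ 2 * dualNorm S.nrm z.2 ^ 2
        ≤ (2 * r * S.Mξ z.1) ^ 2 * dualNorm S.nrm z.2 ^ 2 := by gcongr
      _ = (2 * r) ^ 2 * (S.Mξ z.1 ^ 2 * dualNorm S.nrm z.2 ^ 2) := by ring

include hp

/-- For fixed `ξ` the increment is the odd part of an `r Mξ`-Lipschitz function on the sphere, so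
its fourth moment is at most `10⁶ (r Mξ)⁴ / n²`. Cauchy-Schwarz separates it from the dual norm of
`e`, and averaging over `ξ` comes last. -/
theorem Assumptions.integral_incr_sq_le {v : E n} (hv : v ∈ S.Q) :
    ∫ z, S.incr r v z ^ 2 * dualNorm S.nrm z.2 ^ 2 ∂S.sampleLaw
      ≤ 10 ^ 3 * r ^ 2 * p ^ 2 / n * S.M ^ 2 := by
  have := hS.P_prob
  have hc := continuous_dualNorm hS.nrm_definite
  have hc2 : Continuous fun e => dualNorm S.nrm e ^ 2 := hc.pow 2
  have hp0 := hS.p_pos hp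
  have hi := hS.integrable_incr_sq hr hrs hv
  rw [sampleLaw] at hi ⊢
  rw [integral_prod _ hi, ← hS.Mξ_sq.2, ← integral_const_mul]
  refine integral_mono_ae hi.integral_prod_left (hS.Mξ_sq.1.const_mul _) ?_
  filter_upwards [hS.ae_abs_incr_le hr hrs hv] with ξ ⟨hM, hLip, hb⟩
  have hm : Measurable fun e : E n => S.incr r v (ξ, e) :=
    (hS.measurable_incr v).comp measurable_prodMk_left
  have hX : Integrable (fun e => (S.incr r v (ξ, e) ^ 2) ^ 2) (sphereUniform n) := by
    refine Integrable.of_bound ((hm.pow_const 2).pow_const 2).aestronglyMeasurable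
      (((2 * r * S.Mξ ξ) ^ 2) ^ 2) ?_
    filter_upwards [ae_sphereUniform_norm (n := n)] with e he
    rw [Real.norm_of_nonneg (by positivity), ← sq_abs (S.incr r v (ξ, e))]
    have := hb e he
    gcongr
  have hXY : Integrable (fun e => S.incr r v (ξ, e) ^ 2 * dualNorm S.nrm e ^ 2)
      (sphereUniform n) := by
    refine Integrable.mono' ((integrable_sphereUniform hc2).const_mul
      ((2 * r * S.Mξ ξ) ^ 2)) ((hm.pow_const 2).mul
      (hc.measurable.pow_const 2)).aestronglyMeasurable ?_
    filter_upwards [ae_sphereUniform_norm (n := n)] with e he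
    rw [Real.norm_of_nonneg (by positivity), ← sq_abs (S.incr r v (ξ, e))]
    have := hb e he
    gcongr
  have h4 := integral_sub_neg_pow_four_le hLip
  have hA : ∫ e, (S.incr r v (ξ, e) ^ 2) ^ 2 ∂sphereUniform n
      ≤ (10 ^ 3 * (r * S.Mξ ξ) ^ 2 / n) ^ 2 := by
    refine le_of_eq_of_le ?_ (h4.trans_eq ?_)
    · refine integral_congr_ae (Eventually.of_forall fun e => ?_)
      simp only [incr, smul_neg, ← sub_eq_add_neg]
      ring
    · rw [Real.coe_toNNReal _ (by positivity)]
      ring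
  have := integral_mul_le_of_sq_le (by positivity) (by positivity : 0 < p ^ 2) hX
    (integrable_sphereUniform (by fun_prop)) hXY hA (by
      simp_rw [← pow_mul]
      exact hS.integral_dualNorm_pow_le hp)
  refine this.trans_eq ?_
  ring

/-- The second moment of the dual norm of the estimator. -/
theorem Assumptions.integral_dualNorm_zoGrad_sq {v : E n} (hv : v ∈ S.Q) :
    Integrable (fun z => dualNorm S.nrm (S.zoGrad r v z.1 z.2) ^ 2) S.sampleLaw ∧
    ∫ z, dualNorm S.nrm (S.zoGrad r v z.1 z.2) ^ 2 ∂S.sampleLaw ≤ S.sigmaSq r p := by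
  have := hS.P_prob
  have hc := continuous_dualNorm hS.nrm_definite
  have hc2 : Continuous fun e => dualNorm S.nrm e ^ 2 := hc.pow 2
  have hn : (0 : ℝ) < n := Nat.cast_pos.2 (NeZero.pos n)
  have hi1 := hS.integrable_incr_sq hr hrs hv
  have hi2 : Integrable (fun z : Ξ × E n => dualNorm S.nrm z.2 ^ 2) S.sampleLaw :=
    (integrable_sphereUniform (n := n) hc2).comp_snd S.P
  have hi : Integrable (fun z : Ξ × E n => ((n : ℝ) / (2 * r)) ^ 2 *
      (2 * (S.incr r v z ^ 2 * dualNorm S.nrm z.2 ^ 2) + 8 * S.Δ ^ 2 * dualNorm S.nrm z.2 ^ 2))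
      S.sampleLaw := ((hi1.const_mul 2).add (hi2.const_mul (8 * S.Δ ^ 2))).const_mul _
  have hle : ∀ᵐ z ∂S.sampleLaw, dualNorm S.nrm (S.zoGrad r v z.1 z.2) ^ 2 ≤
      ((n : ℝ) / (2 * r)) ^ 2 *
      (2 * (S.incr r v z ^ 2 * dualNorm S.nrm z.2 ^ 2) + 8 * S.Δ ^ 2 * dualNorm S.nrm z.2 ^ 2) := by
    filter_upwards [ae_sampleLaw_norm hS] with z hz
    have h1 := hS.abs_noise_sub_le hr hrs hv hz
    rw [zoGrad_eq]
    set a := S.incr r v z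
    set b := S.noise (v + r • z.2) - S.noise (v - r • z.2)
    have h2 : b ^ 2 ≤ (2 * S.Δ) ^ 2 := by
      rw [← sq_abs]; exact pow_le_pow_left₀ (abs_nonneg _) h1 2
    have h3 := dualNorm_smul_le hS.nrm_definite ((n : ℝ) / (2 * r) * (a + b)) z.2
    calc _ ≤ (|(n : ℝ) / (2 * r) * (a + b)| * dualNorm S.nrm z.2) ^ 2 :=
          pow_le_pow_left₀ (dualNorm_nonneg hS.nrm_definite _) h3 2
      _ = ((n : ℝ) / (2 * r)) ^ 2 * ((a + b) ^ 2 * dualNorm S.nrm z.2 ^ 2) := by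
          rw [mul_pow, sq_abs]; ring
      _ ≤ ((n : ℝ) / (2 * r)) ^ 2 * ((2 * a ^ 2 + 8 * S.Δ ^ 2) * dualNorm S.nrm z.2 ^ 2) := by
          gcongr
          nlinarith [sq_nonneg (a - b)]
      _ = _ := by ring
  have hm : AEStronglyMeasurable (fun z : Ξ × E n => dualNorm S.nrm (S.zoGrad r v z.1 z.2) ^ 2)
      S.sampleLaw :=
    ((hc.measurable.comp ((hS.measurable_zoGrad r).comp
      measurable_prodMk_left)).pow_const 2).aestronglyMeasurable
  have hint : Integrable (fun z => dualNorm S.nrm (S.zoGrad r v z.1 z.2) ^ 2) S.sampleLaw := by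
    refine Integrable.mono' hi hm ?_
    filter_upwards [hle] with z hz
    rwa [Real.norm_of_nonneg (by positivity)]
  refine ⟨hint, (integral_mono_ae hint hi hle).trans ?_⟩
  rw [integral_const_mul, integral_add (hi1.const_mul 2) (hi2.const_mul _), integral_const_mul,
    integral_const_mul]
  have e2 : ∫ z : Ξ × E n, dualNorm S.nrm z.2 ^ 2 ∂S.sampleLaw ≤ p ^ 2 := by
    rw [sampleLaw, integral_fun_snd (fun e => dualNorm S.nrm e ^ 2)]
    simpa using hS.integral_dualNorm_sq_le hp
  have e1 := hS.integral_incr_sq_le hp hr hrs hv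
  -- The factor `n² / (4 r²)` meets `2000 r² p² M² / n` and `8 Δ² p²`. The first product is the
  -- origin of the constant 500; the second would need only 2.
  calc _ ≤ ((n : ℝ) / (2 * r)) ^ 2 * (2 * (10 ^ 3 * r ^ 2 * p ^ 2 / n * S.M ^ 2)
        + 8 * S.Δ ^ 2 * p ^ 2) := by gcongr
    _ = 500 * p ^ 2 * (n * S.M ^ 2) + 2 * p ^ 2 * ((n : ℝ) ^ 2 * S.Δ ^ 2 / r ^ 2) := by
        field_simp; ring
    _ ≤ 500 * p ^ 2 * (n * S.M ^ 2) + 500 * p ^ 2 * ((n : ℝ) ^ 2 * S.Δ ^ 2 / r ^ 2) := by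
        gcongr; norm_num
    _ = _ := by unfold sigmaSq; ring

/-- The estimator is a biased stochastic subgradient of the smoothed function. -/
theorem Assumptions.F_sub_le_integral_inner_zoGrad {v u : E n} (hv : v ∈ S.Q) (hu : u ∈ S.Q) :
    Integrable (fun z => ⟪S.zoGrad r v z.1 z.2, v - u⟫) S.sampleLaw ∧
    S.F r v - S.F r u - (n : ℝ) * S.Δ * S.DQ * p / r
      ≤ ∫ z, ⟪S.zoGrad r v z.1 z.2, v - u⟫ ∂S.sampleLaw := by
  have := hS.P_prob
  have hc := continuous_dualNorm hS.nrm_definite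
  have hsQ := mem_Qs hv (hr.le.trans hrs)
  have hΔ := hS.Δ_nonneg hsQ
  set a := (n : ℝ) / (2 * r) with ha
  have ha0 : 0 ≤ a := by positivity
  set b : Ξ × E n → ℝ := fun z => S.noise (v + r • z.2) - S.noise (v - r • z.2) with hb
  have hbm : Measurable b := by
    have := hS.noise_meas
    fun_prop
  have he1 : ∀ z : Ξ × E n, ⟪S.zoGrad r v z.1 z.2, v - u⟫
      = a * S.incr r v z * ⟪z.2, v - u⟫ + a * b z * ⟪z.2, v - u⟫ := fun z => by
    rw [zoGrad_eq, real_inner_smul_left]; ring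
  have hi1 : Integrable (fun z => a * S.incr r v z * ⟪z.2, v - u⟫) S.sampleLaw := by
    have hbd : Integrable (fun z : Ξ × E n => a * (2 * r) * ‖v - u‖ * S.Mξ z.1) S.sampleLaw :=
      ((hS.integrable_Mξ hsQ).comp_fst (sphereUniform n)).const_mul _
    refine Integrable.mono' hbd ?_ ?_
    · exact (((hS.measurable_incr v).const_mul a).mul
        (measurable_snd.inner measurable_const)).aestronglyMeasurable
    · filter_upwards [hS.ae_sampleLaw_abs_incr_le hr hrs hv] with z hz
      rw [Real.norm_eq_abs, abs_mul, abs_mul, abs_of_nonneg ha0]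
      have h1 := abs_real_inner_le_norm z.2 (v - u)
      rw [hz.1, one_mul] at h1
      have h2 := hz.2.2
      have h3 := hz.2.1
      calc a * |S.incr r v z| * |⟪z.2, v - u⟫| ≤ a * (2 * r * S.Mξ z.1) * ‖v - u‖ := by gcongr
        _ = _ := by ring
  have hble : ∀ᵐ z ∂S.sampleLaw, |a * b z * ⟪z.2, v - u⟫|
      ≤ (n : ℝ) * S.Δ * S.DQ / r * dualNorm S.nrm z.2 := by
    filter_upwards [ae_sampleLaw_norm hS] with z hz
    have h1 := hS.abs_noise_sub_le hr hrs hv hz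
    have h2 := abs_inner_le_nrm_mul_dualNorm hS.nrm_definite (v - u) z.2
    rw [real_inner_comm] at h2
    have h3 := hS.nrm_sub_le_DQ hv hu
    have h4 := dualNorm_nonneg hS.nrm_definite z.2
    rw [abs_mul, abs_mul, abs_of_nonneg ha0]
    calc a * |b z| * |⟪z.2, v - u⟫| ≤ a * (2 * S.Δ) * (S.DQ * dualNorm S.nrm z.2) := by
          gcongr
          exact h2.trans (by gcongr)
      _ = _ := by rw [ha]; field_simp
  have hdn : Integrable (fun z : Ξ × E n => (n : ℝ) * S.Δ * S.DQ / r * dualNorm S.nrm z.2)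
      S.sampleLaw := ((integrable_sphereUniform (n := n) hc).comp_snd S.P).const_mul _
  have hi2 : Integrable (fun z => a * b z * ⟪z.2, v - u⟫) S.sampleLaw :=
    Integrable.mono' hdn ((hbm.const_mul a).mul
      (measurable_snd.inner measurable_const)).aestronglyMeasurable hble
  simp_rw [he1]
  refine ⟨hi1.add hi2, ?_⟩
  rw [integral_add hi1 hi2]
  have hfirst : ∫ z, a * S.incr r v z * ⟪z.2, v - u⟫ ∂S.sampleLaw
      = ∫ e, a * (S.f (v + r • e) - S.f (v - r • e)) * ⟪e, v - u⟫ ∂sphereUniform n := by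
    rw [sampleLaw] at hi1 ⊢
    -- Integrating over `ξ` first, with `e` fixed, replaces `fξ` by `f`.
    rw [integral_prod_symm _ hi1]
    refine integral_congr_ae ?_
    filter_upwards [ae_sphereUniform_norm (n := n)] with e he
    have h1 := hS.f_mean _ (add_smul_mem_Qs hr hrs hv he.le)
    have h2 := hS.f_mean _ (sub_smul_mem_Qs hr hrs hv he.le)
    rw [integral_mul_const, integral_const_mul]
    congr 2
    rw [← h1.2, ← h2.2, ← integral_sub h1.1 h2.1]
    rfl
  have hsecond : -((n : ℝ) * S.Δ * S.DQ * p / r) ≤ ∫ z, a * b z * ⟪z.2, v - u⟫ ∂S.sampleLaw := by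
    have h1 : |∫ z, a * b z * ⟪z.2, v - u⟫ ∂S.sampleLaw|
        ≤ ∫ z : Ξ × E n, (n : ℝ) * S.Δ * S.DQ / r * dualNorm S.nrm z.2 ∂S.sampleLaw :=
      (abs_integral_le_integral_abs).trans (integral_mono_ae hi2.abs hdn hble)
    have h2 : ∫ z : Ξ × E n, dualNorm S.nrm z.2 ∂S.sampleLaw ≤ p := by
      rw [sampleLaw, integral_fun_snd (fun e => dualNorm S.nrm e)]
      simpa using hS.integral_dualNorm_le hp
    rw [integral_const_mul] at h1
    have hDQ : 0 ≤ S.DQ := (apply_nonneg _ _).trans (hS.nrm_sub_le_DQ hv hv)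
    have h3 : (n : ℝ) * S.Δ * S.DQ / r * ∫ z : Ξ × E n, dualNorm S.nrm z.2 ∂S.sampleLaw
        ≤ (n : ℝ) * S.Δ * S.DQ / r * p := by gcongr
    have h4 := (abs_le.1 (h1.trans h3)).1
    refine le_of_eq_of_le ?_ h4
    ring
  have := hS.F_sub_le_integral hr hrs hv hu
  rw [hfirst]
  linarith

/-- The noiseless problem has the same `F` and no bias. Its estimator is therefore an exact
stochastic subgradient, and the mean of its dual norm is a Lipschitz constant in the norm `nrm`. -/
theorem Assumptions.F_lipschitz {v u : E n} (hv : v ∈ S.Q) (hu : u ∈ S.Q) :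
    S.F r v - S.F r u ≤ √(S.sigmaSq r p) * S.nrm (v - u) := by
  have hP := hS.P_prob
  have hprob : IsProbabilityMeasure S.noiseless.sampleLaw :=
    inferInstanceAs (IsProbabilityMeasure (S.P.prod (sphereUniform n)))
  have h0 := hS.noiseless
  have hc := continuous_dualNorm hS.nrm_definite
  obtain ⟨hi, hle⟩ := h0.F_sub_le_integral_inner_zoGrad hp hr hrs hv hu
  obtain ⟨hi2, hle2⟩ := h0.integral_dualNorm_zoGrad_sq hp hr hrs hv
  have hsig : S.noiseless.sigmaSq r p ≤ S.sigmaSq r p := by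
    unfold sigmaSq
    simp only [Problem.noiseless]
    have : 0 ≤ (n : ℝ) ^ 2 * S.Δ ^ 2 / r ^ 2 := by positivity
    refine mul_le_mul_of_nonneg_left ?_ (by positivity)
    simpa using this
  have hi1 : Integrable (fun z => dualNorm S.nrm (S.noiseless.zoGrad r v z.1 z.2))
      S.noiseless.sampleLaw := by
    have hm : AEStronglyMeasurable (fun z : Ξ × E n =>
        dualNorm S.nrm (S.noiseless.zoGrad r v z.1 z.2)) S.noiseless.sampleLaw :=
      (hc.measurable.comp ((h0.measurable_zoGrad r).comp
        measurable_prodMk_left)).aestronglyMeasurable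
    exact ((memLp_two_iff_integrable_sq hm).2 hi2).integrable one_le_two
  have hsq : 0 ≤ S.sigmaSq r p := by unfold sigmaSq; positivity
  have h1 : ∫ z, dualNorm S.nrm (S.noiseless.zoGrad r v z.1 z.2) ∂S.noiseless.sampleLaw
      ≤ √(S.sigmaSq r p) :=
    integral_le_of_sq_le (Real.sqrt_nonneg _) hi2 hi1 (by
      rw [Real.sq_sqrt hsq]; exact hle2.trans hsig)
  have h2 : ∫ z, ⟪S.noiseless.zoGrad r v z.1 z.2, v - u⟫ ∂S.noiseless.sampleLaw
      ≤ ∫ z, S.nrm (v - u) * dualNorm S.nrm (S.noiseless.zoGrad r v z.1 z.2)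
        ∂S.noiseless.sampleLaw := by
    refine integral_mono hi (hi1.const_mul _) fun z => ?_
    simp only
    rw [real_inner_comm]
    exact inner_le_nrm_mul_dualNorm hS.nrm_definite _ _
  rw [integral_const_mul] at h2
  have h3 : S.noiseless.F r v - S.noiseless.F r u = S.F r v - S.F r u := rfl
  have h4 : (n : ℝ) * S.noiseless.Δ * S.noiseless.DQ * p / r = 0 := by simp [Problem.noiseless]
  rw [h3, h4, sub_zero] at hle
  have h5 := mul_le_mul_of_nonneg_left h1 (apply_nonneg S.nrm (v - u))
  linarith

end Oracle

end Problem

/-! ### The prox step: existence, optimality and progress. -/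

theorem argminOn_spec {n : ℕ} {Q : Set (E n)} {φ : E n → ℝ} (hQ : IsCompact Q) (hne : Q.Nonempty)
    (hφ : ContinuousOn φ Q) : argminOn Q φ ∈ Q ∧ IsMinOn φ Q (argminOn Q φ) := by
  obtain ⟨u, hu, hmin⟩ := hQ.exists_isMinOn hne hφ
  exact Classical.epsilon_spec (p := fun u => u ∈ Q ∧ IsMinOn φ Q u) ⟨u, hu, hmin⟩

namespace Problem

variable {n : ℕ} {Ξ : Type u} [MeasurableSpace Ξ] {S : Problem n Ξ}

/-- The objective of a step of the prox-sliding procedure. -/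
noncomputable def proxObj (S : Problem n Ξ) (xlow x v G : E n) (β q : ℝ) (w : E n) : ℝ :=
  S.lg xlow w + ⟪G, w⟫ + β * S.V x w + β * q * S.V v w

/-- A step of the prox-sliding procedure. -/
noncomputable def proxStep (S : Problem n Ξ) (xlow x v G : E n) (β q : ℝ) : E n :=
  argminOn S.Q (S.proxObj xlow x v G β q)

/-- The error term of a step of the prox-sliding procedure. -/
noncomputable def stepError (S : Problem n Ξ) (r σ : ℝ) (u v G : E n) (βq : ℝ) : ℝ :=
  S.F r v - S.F r u - ⟪G, v - u⟫ + (σ + dualNorm S.nrm G) ^ 2 / (2 * βq)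

namespace Assumptions

variable (hS : S.Assumptions)
include hS

theorem continuousOn_ν : ContinuousOn S.ν S.Q := fun x hx =>
  (hS.ν_diff x hx).hasFDerivWithinAt.continuousWithinAt

theorem continuousOn_g : ContinuousOn S.g S.Q := fun x hx =>
  (hS.g_diff x hx).hasFDerivWithinAt.continuousWithinAt

theorem continuousOn_proxObj (xlow x v G : E n) (β q : ℝ) :
    ContinuousOn (S.proxObj xlow x v G β q) S.Q := by
  have := hS.continuousOn_ν
  unfold proxObj lg V
  fun_prop

theorem proxStep_spec {x₀ : E n} (hx₀ : x₀ ∈ S.Q) (xlow x v G : E n) (β q : ℝ) :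
    S.proxStep xlow x v G β q ∈ S.Q ∧
      IsMinOn (S.proxObj xlow x v G β q) S.Q (S.proxStep xlow x v G β q) :=
  argminOn_spec hS.Q_compact ⟨x₀, hx₀⟩ (hS.continuousOn_proxObj xlow x v G β q)

theorem hasGradientWithinAt_proxObj (xlow x v G : E n) (β q : ℝ) {w : E n} (hw : w ∈ S.Q) :
    HasGradientWithinAt (S.proxObj xlow x v G β q) (S.gradg xlow + G
      + β • (S.gradν w - S.gradν x) + (β * q) • (S.gradν w - S.gradν v)) S.Q w := by
  rw [hasGradientWithinAt_iff_hasFDerivWithinAt]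
  have hν := (hS.ν_diff w hw).hasFDerivWithinAt
  have hlin : ∀ c a : E n, HasFDerivWithinAt (fun z : E n => ⟪c, z - a⟫)
      (InnerProductSpace.toDual ℝ (E n) c) S.Q w := fun c a =>
    ((InnerProductSpace.toDual ℝ (E n) c).hasFDerivAt.comp w
      ((hasFDerivAt_id w).sub_const a)).hasFDerivWithinAt
  have hV : ∀ a : E n, HasFDerivWithinAt (S.V a)
      (InnerProductSpace.toDual ℝ (E n) (S.gradν w - S.gradν a)) S.Q w := fun a => by
    have := (hν.sub_const (S.ν a)).sub (hlin (S.gradν a) a)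
    rw [map_sub]
    exact this
  have hG : HasFDerivWithinAt (fun z : E n => ⟪G, z⟫)
      (InnerProductSpace.toDual ℝ (E n) G) S.Q w :=
    (InnerProductSpace.toDual ℝ (E n) G).hasFDerivAt.hasFDerivWithinAt
  have h := ((((hlin (S.gradg xlow) xlow).const_add (S.g xlow)).add hG).add
    ((hV x).const_mul β)).add ((hV v).const_mul (β * q))
  rw [map_add, map_add, map_add, map_smul, map_smul]
  exact h

/-- The three-point inequality for a prox-sliding step. -/
theorem three_point {x₀ : E n} (hx₀ : x₀ ∈ S.Q) (xlow x v G : E n) (β q : ℝ) {u : E n}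
    (hu : u ∈ S.Q) :
    S.proxObj xlow x v G β q (S.proxStep xlow x v G β q)
      + β * (1 + q) * S.V (S.proxStep xlow x v G β q) u ≤ S.proxObj xlow x v G β q u := by
  obtain ⟨hw, hmin⟩ := hS.proxStep_spec hx₀ xlow x v G β q
  set w := S.proxStep xlow x v G β q
  -- The objective is `β (1 + q) ν` plus an affine function, so the optimality condition at `w` is
  -- already the claim after expanding the divergences.
  have h := inner_nonneg_of_isMinOn hS.Q_convex hw hu
    (hS.hasGradientWithinAt_proxObj xlow x v G β q hw) hmin
  simp only [inner_add_left, inner_sub_left, inner_sub_right, real_inner_smul_left] at h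
  simp only [proxObj, lg, V, inner_sub_right]
  linarith

theorem convexOn_V {x : E n} : ConvexOn ℝ S.Q (S.V x) := by
  refine ⟨hS.Q_convex, fun y hy z hz a b ha hb hab => ?_⟩
  have hw := hS.Q_convex hy hz ha hb hab
  set w := a • y + b • z with hwdef
  have key : ∀ y' ∈ S.Q, S.ν w + ⟪S.gradν w, y' - w⟫ ≤ S.ν y' := fun y' hy' => by
    have := hS.ν_strong w hw y' hy'
    have h0 : 0 ≤ 1 / 2 * S.nrm (y' - w) ^ 2 := by positivity
    linarith
  have h1 := mul_le_mul_of_nonneg_left (key y hy) ha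
  have h2 := mul_le_mul_of_nonneg_left (key z hz) hb
  have hb' : b = 1 - a := by linarith
  have e1 : ⟪S.gradν w, w⟫ = a * ⟪S.gradν w, y⟫ + b * ⟪S.gradν w, z⟫ := by
    conv_lhs => rw [hwdef, inner_add_right, real_inner_smul_right, real_inner_smul_right]
  have e2 : ⟪S.gradν x, w⟫ = a * ⟪S.gradν x, y⟫ + b * ⟪S.gradν x, z⟫ := by
    conv_lhs => rw [hwdef, inner_add_right, real_inner_smul_right, real_inner_smul_right]
  have h3 : S.ν w ≤ a * S.ν y + b * S.ν z := by
    simp only [inner_sub_right] at h1 h2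
    have e3 : a * (S.ν w - ⟪S.gradν w, w⟫) + b * (S.ν w - ⟪S.gradν w, w⟫)
      = S.ν w - ⟪S.gradν w, w⟫ := by rw [← add_mul, hab, one_mul]
    linarith
  have e4 : a * (S.ν x - ⟪S.gradν x, x⟫) + b * (S.ν x - ⟪S.gradν x, x⟫)
    = S.ν x - ⟪S.gradν x, x⟫ := by rw [← add_mul, hab, one_mul]
  simp only [V, inner_sub_right, smul_eq_mul]
  linarith

/-- The progress of a prox-sliding step. -/
theorem proxStep_progress {r σ : ℝ}
    (hF : ∀ y ∈ S.Q, ∀ z ∈ S.Q, S.F r y - S.F r z ≤ σ * S.nrm (y - z))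
    (xlow x G : E n) {v u : E n} (hv : v ∈ S.Q) (hu : u ∈ S.Q) {β q : ℝ} (hβ : 0 < β)
    (hq : 0 < q) :
    S.lg xlow (S.proxStep xlow x v G β q) + S.F r (S.proxStep xlow x v G β q)
      + β * S.V x (S.proxStep xlow x v G β q) + β * (1 + q) * S.V (S.proxStep xlow x v G β q) u
    ≤ S.lg xlow u + S.F r u + β * S.V x u + β * q * S.V v u + S.stepError r σ u v G (β * q) := by
  have h3 := hS.three_point hv xlow x v G β q hu
  have hw := (hS.proxStep_spec hv xlow x v G β q).1
  set w := S.proxStep xlow x v G β q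
  have hV := mul_le_mul_of_nonneg_left (hS.half_sq_le_V hv hw) (mul_pos hβ hq).le
  have hFw := hF w hw v hv
  have hG := (abs_le.1 (abs_inner_le_nrm_mul_dualNorm hS.nrm_definite (w - v) G)).1
  rw [real_inner_comm] at hG
  set d := S.nrm (w - v)
  have hbq := mul_pos hβ hq
  -- `F` and `G` were evaluated at the old point `v`. Moving to `w` costs `(σ + ‖G‖_*) d`, of which
  -- the quadratic part is paid by `β q V(v, w)`.
  have hyoung : (σ + dualNorm S.nrm G) * d ≤ (σ + dualNorm S.nrm G) ^ 2 / (2 * (β * q))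
      + β * q * (1 / 2 * d ^ 2) := by
    have h : 0 ≤ (σ + dualNorm S.nrm G - β * q * d) ^ 2 / (2 * (β * q)) := by positivity
    have e : (σ + dualNorm S.nrm G - β * q * d) ^ 2 / (2 * (β * q))
      = (σ + dualNorm S.nrm G) ^ 2 / (2 * (β * q)) + β * q * (1 / 2 * d ^ 2)
        - (σ + dualNorm S.nrm G) * d := by field_simp; ring
    linarith
  unfold proxObj at h3
  unfold stepError
  simp only [inner_sub_right] at hG ⊢
  linarith

theorem convexOn_prox_model {r : ℝ} (hF : ConvexOn ℝ S.Q (S.F r)) (xlow x : E n) {β : ℝ}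
    (hβ : 0 ≤ β) : ConvexOn ℝ S.Q (fun w => S.lg xlow w + S.F r w + β * S.V x w) := by
  have h1 : ConvexOn ℝ S.Q (S.lg xlow) := by
    refine ⟨hS.Q_convex, fun y _ z _ a b _ _ hab => le_of_eq ?_⟩
    simp only [lg, inner_sub_right, inner_add_right, real_inner_smul_right, smul_eq_mul]
    linear_combination -(S.g xlow - ⟪S.gradg xlow, xlow⟫) * hab
  exact (h1.add hF).add (hS.convexOn_V.smul hβ)

end Assumptions

end Problem

/-! ### The inner loop: prox-sliding. -/

section PS

variable {n : ℕ} {Ξ : Type u} [MeasurableSpace Ξ] {S : Problem n Ξ}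

theorem PS_succ_u (S : Problem n Ξ) (r : ℝ) (par : Params) (xlow x : E n) (β : ℝ) (ξ : ℕ → Ξ)
    (e : ℕ → E n) (t : ℕ) :
    (PS S r par (S.lg xlow) x β ξ e (t + 1)).u = S.proxStep xlow x
      (PS S r par (S.lg xlow) x β ξ e t).u
      (S.zoGrad r (PS S r par (S.lg xlow) x β ξ e t).u (ξ t) (e t)) β (par.p (t + 1)) := rfl

theorem PS_succ_utilde (S : Problem n Ξ) (r : ℝ) (par : Params) (h : E n → ℝ) (x : E n) (β : ℝ)
    (ξ : ℕ → Ξ) (e : ℕ → E n) (t : ℕ) :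
    (PS S r par h x β ξ e (t + 1)).utilde = (1 - par.θ (t + 1)) • (PS S r par h x β ξ e t).utilde
      + par.θ (t + 1) • (PS S r par h x β ξ e (t + 1)).u := rfl

theorem PS_zoCalls (S : Problem n Ξ) (r : ℝ) (par : Params) (h : E n → ℝ) (x : E n) (β : ℝ)
    (ξ : ℕ → Ξ) (e : ℕ → E n) (t : ℕ) : (PS S r par h x β ξ e t).zoCalls = 2 * t := by
  induction t with
  | zero => rfl
  | succ t ih => rw [PS, ih]; ring

theorem params_θ_mem (S : Problem n Ξ) (r p C : ℝ) (N t : ℕ) :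
    (params S r p C N).θ (t + 1) ∈ Icc (0 : ℝ) 1 := by
  simp only [params]
  push_cast
  have ht : (0 : ℝ) ≤ t := t.cast_nonneg
  refine ⟨by positivity, ?_⟩
  rw [div_le_one (by positivity)]
  nlinarith

theorem params_γ_mem (S : Problem n Ξ) (r p C : ℝ) (N k : ℕ) :
    (params S r p C N).γ (k + 1) ∈ Icc (0 : ℝ) 1 := by
  simp only [params]
  push_cast
  have ht : (0 : ℝ) ≤ k := k.cast_nonneg
  refine ⟨by positivity, ?_⟩
  rw [div_le_one (by positivity)]
  linarith

theorem convex_comb_mem {Q : Set (E n)} (hQ : Convex ℝ Q) {x y : E n} (hx : x ∈ Q) (hy : y ∈ Q)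
    {a : ℝ} (ha : a ∈ Icc (0 : ℝ) 1) : (1 - a) • x + a • y ∈ Q :=
  hQ hx hy (sub_nonneg.2 ha.2) ha.1 (by ring)

theorem PS_mem (hS : S.Assumptions) (r p C : ℝ) (N : ℕ) (xlow : E n) {x : E n} (hx : x ∈ S.Q)
    (β : ℝ) (ξ : ℕ → Ξ) (e : ℕ → E n) (t : ℕ) :
    (PS S r (params S r p C N) (S.lg xlow) x β ξ e t).u ∈ S.Q ∧
    (PS S r (params S r p C N) (S.lg xlow) x β ξ e t).utilde ∈ S.Q := by
  induction t with
  | zero => exact ⟨hx, hx⟩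
  | succ t ih =>
    have h1 : (PS S r (params S r p C N) (S.lg xlow) x β ξ e (t + 1)).u ∈ S.Q := by
      rw [PS_succ_u]
      exact (hS.proxStep_spec hx _ _ _ _ _ _).1
    refine ⟨h1, ?_⟩
    rw [PS_succ_utilde]
    exact convex_comb_mem hS.Q_convex ih.2 h1 (params_θ_mem S r p C N t)

/-- The progress of the prox-sliding procedure. -/
theorem PS_progress (hS : S.Assumptions) {r σ : ℝ}
    (hF : ∀ y ∈ S.Q, ∀ z ∈ S.Q, S.F r y - S.F r z ≤ σ * S.nrm (y - z))
    (hFc : ConvexOn ℝ S.Q (S.F r)) (p C : ℝ) (N : ℕ) (xlow : E n) {x u : E n} (hx : x ∈ S.Q)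
    (hu : u ∈ S.Q) {β : ℝ} (hβ : 0 < β) (ξ : ℕ → Ξ) (e : ℕ → E n) (T : ℕ) :
    let st := PS S r (params S r p C N) (S.lg xlow) x β ξ e
    (T : ℝ) * (T + 3) / 2 * (S.lg xlow (st T).utilde + S.F r (st T).utilde
        + β * S.V x (st T).utilde) + β * (((T : ℝ) + 1) * (T + 2) / 2) * S.V (st T).u u
      ≤ (T : ℝ) * (T + 3) / 2 * (S.lg xlow u + S.F r u + β * S.V x u) + β * S.V x u
        + ∑ t ∈ Finset.range T, ((t : ℝ) + 2) * S.stepError r σ u (st t).u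
          (S.zoGrad r (st t).u (ξ t) (e t)) (β * (((t : ℝ) + 1) / 2)) := by
  intro st
  induction T with
  | zero => simp [st, PS]
  | succ T ih =>
    obtain ⟨hmu, hmt⟩ : (st T).u ∈ S.Q ∧ (st T).utilde ∈ S.Q := PS_mem hS r p C N xlow hx β ξ e T
    have hmu1 := (PS_mem hS r p C N xlow hx β ξ e (T + 1)).1
    have hT : (0 : ℝ) ≤ T := T.cast_nonneg
    have hq : (params S r p C N).p (T + 1) = ((T : ℝ) + 1) / 2 := by simp [params]
    -- So `utilde` is the average of the iterates with weights `t + 1`, whose sum up to `T` is `T (T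
    -- + 3) / 2`.
    have hθ : (params S r p C N).θ (T + 1) * (((T : ℝ) + 1) * (T + 4) / 2) = T + 2 := by
      simp only [params]
      push_cast
      field_simp
      ring
    have hprog := hS.proxStep_progress hF xlow x (S.zoGrad r (st T).u (ξ T) (e T)) hmu hu hβ
      (q := ((T : ℝ) + 1) / 2) (by positivity)
    have hstep : (st (T + 1)).u = S.proxStep xlow x (st T).u
        (S.zoGrad r (st T).u (ξ T) (e T)) β (((T : ℝ) + 1) / 2) := by
      rw [← hq]; exact PS_succ_u S r _ xlow x β ξ e T
    rw [← hstep] at hprog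
    have hconv := (hS.convexOn_prox_model hFc xlow x hβ.le).2 hmt hmu1
      (sub_nonneg.2 (params_θ_mem S r p C N T).2) (params_θ_mem S r p C N T).1 (by ring)
    rw [← PS_succ_utilde] at hconv
    change S.lg xlow (st (T + 1)).utilde + S.F r (st (T + 1)).utilde
      + β * S.V x (st (T + 1)).utilde ≤ _ • (S.lg xlow (st T).utilde + S.F r (st T).utilde
        + β * S.V x (st T).utilde) + _ • (S.lg xlow (st (T + 1)).u + S.F r (st (T + 1)).u
      + β * S.V x (st (T + 1)).u) at hconv
    rw [smul_eq_mul, smul_eq_mul] at hconv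
    rw [Finset.sum_range_succ]
    push_cast
    set A := S.lg xlow (st T).utilde + S.F r (st T).utilde + β * S.V x (st T).utilde
    set A' := S.lg xlow (st (T + 1)).utilde + S.F r (st (T + 1)).utilde
      + β * S.V x (st (T + 1)).utilde
    set D := S.lg xlow (st (T + 1)).u + S.F r (st (T + 1)).u + β * S.V x (st (T + 1)).u
    set U := S.lg xlow u + S.F r u + β * S.V x u
    set R := ∑ t ∈ Finset.range T, ((t : ℝ) + 2) * S.stepError r σ u (st t).u
          (S.zoGrad r (st t).u (ξ t) (e t)) (β * (((t : ℝ) + 1) / 2))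
    set ε := S.stepError r σ u (st T).u (S.zoGrad r (st T).u (ξ T) (e T))
      (β * (((T : ℝ) + 1) / 2))
    set θ := (params S r p C N).θ (T + 1)
    have h1 : (((T : ℝ) + 1) * (T + 4) / 2) * A' ≤ T * (T + 3) / 2 * A + (T + 2) * D := by
      have := mul_le_mul_of_nonneg_left hconv
        (show (0 : ℝ) ≤ ((T : ℝ) + 1) * (T + 4) / 2 by positivity)
      refine this.trans_eq ?_
      linear_combination (D - A) * hθ
    -- With weight `T + 2`, the divergence from the old point has coefficient `β (T + 1)(T + 2) / 2`
    -- and the new one `β (T + 2)(T + 3) / 2`, so consecutive steps cancel.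
    have h2 := mul_le_mul_of_nonneg_left hprog (show (0 : ℝ) ≤ (T : ℝ) + 2 by positivity)
    linarith

end PS

/-- Uses `(T + 1)(T + 2) / 2 = T (T + 3) / 2 + 1`. The same factor `1 + 2 / (T (T + 3))` thus
appears on both divergences once the prox term of `U` is added. -/
theorem div_of_weighted_le {T A β v w U R : ℝ} (hT : 1 ≤ T)
    (h : T * (T + 3) / 2 * A + β * ((T + 1) * (T + 2) / 2) * w
      ≤ T * (T + 3) / 2 * U + β * v + R) :
    A + β * (1 + 2 / (T * (T + 3))) * w ≤ U + β * (2 / (T * (T + 3))) * v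
      + 2 / (T * (T + 3)) * R := by
  have e : T * (T + 3) / 2 * (2 / (T * (T + 3))) = 1 := by field_simp
  refine le_of_mul_le_mul_left ?_ (show 0 < T * (T + 3) / 2 by positivity)
  linear_combination h + (β * w - β * v - R) * e

/-! ### The outer loop: accelerated steps and the pathwise bound. -/

section Run

variable {n : ℕ} {Ξ : Type u} [MeasurableSpace Ξ] {S : Problem n Ξ}

/-- The point at which the outer iteration `k + 1` linearizes `g`. -/
noncomputable def linPoint (S : Problem n Ξ) (r : ℝ) (par : Params) (x₀ : E n) (ξ : ℕ × ℕ → Ξ)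
    (e : ℕ × ℕ → E n) (k : ℕ) : E n :=
  (1 - par.γ (k + 1)) • (run S r par x₀ ξ e k).xbar + par.γ (k + 1) • (run S r par x₀ ξ e k).x

/-- The state of the prox-sliding procedure in the outer iteration `k + 1` after `t` steps. -/
noncomputable def inner (S : Problem n Ξ) (r : ℝ) (par : Params) (x₀ : E n) (ξ : ℕ × ℕ → Ξ)
    (e : ℕ × ℕ → E n) (k t : ℕ) : PSState n :=
  PS S r par (S.lg (linPoint S r par x₀ ξ e k)) (run S r par x₀ ξ e k).x (par.β (k + 1))
    (fun t => ξ (k + 1, t)) (fun t => e (k + 1, t)) t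

/-- The error of the step `t + 1` of the outer iteration `k + 1`. -/
noncomputable def innerError (S : Problem n Ξ) (r σ : ℝ) (u : E n) (par : Params) (x₀ : E n)
    (ξ : ℕ × ℕ → Ξ) (e : ℕ × ℕ → E n) (k t : ℕ) : ℝ :=
  S.stepError r σ u (inner S r par x₀ ξ e k t).u
    (S.zoGrad r (inner S r par x₀ ξ e k t).u (ξ (k + 1, t)) (e (k + 1, t)))
    (par.β (k + 1) * (((t : ℝ) + 1) / 2))

/-- The averaged error of the outer iteration `k + 1`. -/
noncomputable def outerError (S : Problem n Ξ) (r σ : ℝ) (u : E n) (par : Params) (x₀ : E n)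
    (ξ : ℕ × ℕ → Ξ) (e : ℕ × ℕ → E n) (k : ℕ) : ℝ :=
  2 / ((par.T (k + 1) : ℝ) * (par.T (k + 1) + 3)) *
    ∑ t ∈ Finset.range (par.T (k + 1)), ((t : ℝ) + 2) * innerError S r σ u par x₀ ξ e k t

theorem params_T_mono (r : ℝ) (hS : S.Assumptions) (p C : ℝ) (N : ℕ) (hC : 0 ≤ C) {j k : ℕ} (hjk : j ≤ k) :
    (params S r p C N).T j ≤ (params S r p C N).T k := by
  simp only [params]
  have hL := hS.L_pos
  refine Nat.ceil_mono ?_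
  gcongr

variable (r : ℝ) (par : Params) (x₀ : E n) (ξ : ℕ × ℕ → Ξ) (e : ℕ × ℕ → E n)

theorem run_succ_x (k : ℕ) :
    (run S r par x₀ ξ e (k + 1)).x = (inner S r par x₀ ξ e k (par.T (k + 1))).u := rfl

theorem run_succ_xbar (k : ℕ) :
    (run S r par x₀ ξ e (k + 1)).xbar = (1 - par.γ (k + 1)) • (run S r par x₀ ξ e k).xbar
      + par.γ (k + 1) • (inner S r par x₀ ξ e k (par.T (k + 1))).utilde := rfl

theorem run_gradCalls (k : ℕ) : (run S r par x₀ ξ e k).gradCalls = k := by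
  induction k with
  | zero => rfl
  | succ k ih => rw [run, ih]

theorem run_zoCalls (k : ℕ) :
    (run S r par x₀ ξ e k).zoCalls = ∑ j ∈ Finset.range k, 2 * par.T (j + 1) := by
  induction k with
  | zero => rfl
  | succ k ih => rw [Finset.sum_range_succ, ← ih, run, PS_zoCalls]

variable {x₀} (hS : S.Assumptions) (hx₀ : x₀ ∈ S.Q) (p C : ℝ) (N : ℕ)
include hS hx₀

theorem run_mem (k : ℕ) :
    (run S r (params S r p C N) x₀ ξ e k).x ∈ S.Q ∧
    (run S r (params S r p C N) x₀ ξ e k).xbar ∈ S.Q := by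
  induction k with
  | zero => exact ⟨hx₀, hx₀⟩
  | succ k ih =>
    obtain ⟨h1, h2⟩ := PS_mem hS r p C N (linPoint S r (params S r p C N) x₀ ξ e k) ih.1
      ((params S r p C N).β (k + 1)) (fun t => ξ (k + 1, t)) (fun t => e (k + 1, t))
      ((params S r p C N).T (k + 1))
    exact ⟨h1, convex_comb_mem hS.Q_convex ih.2 h2 (params_γ_mem S r p C N k)⟩

theorem linPoint_mem (k : ℕ) : linPoint S r (params S r p C N) x₀ ξ e k ∈ S.Q :=
  convex_comb_mem hS.Q_convex (run_mem r ξ e hS hx₀ p C N k).2 (run_mem r ξ e hS hx₀ p C N k).1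
    (params_γ_mem S r p C N k)

theorem inner_mem (k t : ℕ) : (inner S r (params S r p C N) x₀ ξ e k t).u ∈ S.Q ∧
    (inner S r (params S r p C N) x₀ ξ e k t).utilde ∈ S.Q :=
  PS_mem hS r p C N _ (run_mem r ξ e hS hx₀ p C N k).1 _ _ _ t

/-- The progress of an outer iteration. -/
theorem run_progress {σ : ℝ}
    (hF : ∀ y ∈ S.Q, ∀ z ∈ S.Q, S.F r y - S.F r z ≤ σ * S.nrm (y - z))
    (hFc : ConvexOn ℝ S.Q (S.F r)) {u : E n} (hu : u ∈ S.Q) (k : ℕ)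
    (hT : 1 ≤ (params S r p C N).T (k + 1)) :
    let st := run S r (params S r p C N) x₀ ξ e
    let T : ℝ := ((params S r p C N).T (k + 1) : ℕ)
    ((k : ℝ) + 1) * (k + 2) / 2 * (S.Ψ r (st (k + 1)).xbar - S.Ψ r u)
        + 2 * S.L * (1 + 2 / (T * (T + 3))) * S.V (st (k + 1)).x u
      ≤ (k : ℝ) * (k + 1) / 2 * (S.Ψ r (st k).xbar - S.Ψ r u)
        + 2 * S.L * (1 + 2 / (T * (T + 3))) * S.V (st k).x u
        + ((k : ℝ) + 1) * outerError S r σ u (params S r p C N) x₀ ξ e k := by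
  intro st T
  have hk : (0 : ℝ) ≤ k := k.cast_nonneg
  have hL := hS.L_pos
  have hT0 : (1 : ℝ) ≤ T := Nat.one_le_cast.2 hT
  set β := (params S r p C N).β (k + 1) with hβdef
  set γ := (params S r p C N).γ (k + 1) with hγdef
  have hβ : β = 2 * S.L / (k + 1) := by simp [hβdef, params]
  have hγ : γ = 2 / (k + 2) := by
    simp only [hγdef, params]; push_cast; congr 1; ring
  have hβ0 : 0 < β := by rw [hβ]; positivity
  obtain ⟨hγ0, hγ1⟩ : γ ∈ Icc (0 : ℝ) 1 := params_γ_mem S r p C N k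
  obtain ⟨hxm, hbm⟩ : (st k).x ∈ S.Q ∧ (st k).xbar ∈ S.Q := run_mem r ξ e hS hx₀ p C N k
  obtain ⟨hxm1, hbm1⟩ : (st (k + 1)).x ∈ S.Q ∧ (st (k + 1)).xbar ∈ S.Q :=
    run_mem r ξ e hS hx₀ p C N (k + 1)
  set xl := linPoint S r (params S r p C N) x₀ ξ e k with hxl
  have hxlm : xl ∈ S.Q := linPoint_mem r ξ e hS hx₀ p C N k
  set ut := (inner S r (params S r p C N) x₀ ξ e k ((params S r p C N).T (k + 1))).utilde with hut
  have hutm : ut ∈ S.Q := (inner_mem r ξ e hS hx₀ p C N k _).2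
  have hps := PS_progress hS hF hFc p C N xl hxm hu hβ0 (fun t => ξ (k + 1, t))
    (fun t => e (k + 1, t)) ((params S r p C N).T (k + 1))
  simp only at hps
  change T * (T + 3) / 2 * (S.lg xl ut + S.F r ut + β * S.V (st k).x ut)
    + β * ((T + 1) * (T + 2) / 2) * S.V (st (k + 1)).x u
    ≤ T * (T + 3) / 2 * (S.lg xl u + S.F r u + β * S.V (st k).x u) + β * S.V (st k).x u
      + ∑ t ∈ Finset.range ((params S r p C N).T (k + 1)), ((t : ℝ) + 2) *
        innerError S r σ u (params S r p C N) x₀ ξ e k t at hps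
  have hps' : S.lg xl ut + S.F r ut + β * S.V (st k).x ut
      + β * (1 + 2 / (T * (T + 3))) * S.V (st (k + 1)).x u
      ≤ S.lg xl u + S.F r u + β * (1 + 2 / (T * (T + 3))) * S.V (st k).x u
        + outerError S r σ u (params S r p C N) x₀ ξ e k := by
    have h := div_of_weighted_le hT0 hps
    unfold outerError
    change _ ≤ _ + 2 / (T * (T + 3)) * _
    linarith
  have hxb : (st (k + 1)).xbar = (1 - γ) • (st k).xbar + γ • ut := rfl
  have hdesc := le_add_inner_add_sq hS.nrm_definite hS.Q_convex hS.g_diff hS.g_smooth hxlm hbm1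
  have hlin : S.g xl + ⟪S.gradg xl, (st (k + 1)).xbar - xl⟫
      = (1 - γ) * S.lg xl (st k).xbar + γ * S.lg xl ut := by
    simp only [Problem.lg, hxb, inner_sub_right, inner_add_right, real_inner_smul_right]
    ring
  have hgb : S.lg xl (st k).xbar ≤ S.g (st k).xbar :=
    add_inner_le_of_convexOn hS.g_convex hxlm hbm (hS.g_diff xl hxlm)
  have hgu : S.lg xl u ≤ S.g u :=
    add_inner_le_of_convexOn hS.g_convex hxlm hu (hS.g_diff xl hxlm)
  -- The descent error is therefore quadratic in `γ`; one factor `γ` is spent on `L γ ≤ β`, so that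
  -- the prox term absorbs it.
  have hdist : (st (k + 1)).xbar - xl = γ • (ut - (st k).x) := by
    rw [hxb]
    change (1 - γ) • (st k).xbar + γ • ut - ((1 - γ) • (st k).xbar + γ • (st k).x) = _
    module
  have hnrm : S.L / 2 * S.nrm ((st (k + 1)).xbar - xl) ^ 2 ≤ γ * (β * S.V (st k).x ut) := by
    rw [hdist, map_smul_eq_mul, Real.norm_of_nonneg hγ0, mul_pow]
    have h1 := hS.half_sq_le_V hxm hutm
    have h2 : S.L * γ ≤ β := by
      rw [hβ, hγ, mul_div_assoc', div_le_div_iff₀ (by positivity) (by positivity)]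
      nlinarith
    calc S.L / 2 * (γ ^ 2 * S.nrm (ut - (st k).x) ^ 2)
        = γ * ((S.L * γ) * (1 / 2 * S.nrm (ut - (st k).x) ^ 2)) := by ring
      _ ≤ γ * (β * S.V (st k).x ut) := by gcongr
  have hFb := hFc.2 hbm hutm (sub_nonneg.2 hγ1) hγ0 (by ring)
  rw [← hxb, smul_eq_mul, smul_eq_mul] at hFb
  have hmain : S.Ψ r (st (k + 1)).xbar - S.Ψ r u
      + γ * (β * (1 + 2 / (T * (T + 3))) * S.V (st (k + 1)).x u)
      ≤ (1 - γ) * (S.Ψ r (st k).xbar - S.Ψ r u)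
        + γ * (β * (1 + 2 / (T * (T + 3))) * S.V (st k).x u)
        + γ * outerError S r σ u (params S r p C N) x₀ ξ e k := by
    have h1 := mul_le_mul_of_nonneg_left hps' hγ0
    have h2 := mul_le_mul_of_nonneg_left hgb (sub_nonneg.2 hγ1)
    have h3 := mul_le_mul_of_nonneg_left hgu hγ0
    simp only [Problem.Ψ]
    linarith
  have h := mul_le_mul_of_nonneg_left hmain (show 0 ≤ ((k : ℝ) + 1) * (k + 2) / 2 by positivity)
  -- The weight `(k + 1)(k + 2) / 2` turns `1 - γ` into the previous weight and makes the leading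
  -- divergence coefficient `2 L` in every iteration.
  have c1 : ((k : ℝ) + 1) * (k + 2) / 2 * γ = k + 1 := by rw [hγ]; field_simp
  have c2 : ((k : ℝ) + 1) * (k + 2) / 2 * (1 - γ) = k * (k + 1) / 2 := by rw [hγ]; field_simp; ring
  have c3 : ((k : ℝ) + 1) * β = 2 * S.L := by rw [hβ]; field_simp
  have c4 : ((k : ℝ) + 1) * (k + 2) / 2 * γ * β = 2 * S.L := by rw [c1, c3]
  linear_combination h + ((1 + 2 / (T * (T + 3))) * S.V (st k).x u
    - (1 + 2 / (T * (T + 3))) * S.V (st (k + 1)).x u) * c4 + (S.Ψ r (st k).xbar - S.Ψ r u) * c2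
    + outerError S r σ u (params S r p C N) x₀ ξ e k * c1

/-- The pathwise bound for the method. -/
theorem run_bound {σ : ℝ}
    (hF : ∀ y ∈ S.Q, ∀ z ∈ S.Q, S.F r y - S.F r z ≤ σ * S.nrm (y - z))
    (hFc : ConvexOn ℝ S.Q (S.F r)) {u : E n} (hu : u ∈ S.Q) (hC : 0 ≤ C)
    (hT : 1 ≤ (params S r p C N).T 1) (k : ℕ) :
    (k : ℝ) * (k + 1) / 2 * (S.Ψ r (run S r (params S r p C N) x₀ ξ e k).xbar - S.Ψ r u)
      ≤ 3 / 2 * S.L * S.DQV ^ 2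
        + ∑ j ∈ Finset.range k, ((j : ℝ) + 1) * outerError S r σ u (params S r p C N) x₀ ξ e j := by
  have hL := hS.L_pos
  have hTk : ∀ k, 1 ≤ (params S r p C N).T (k + 1) := fun k =>
    hT.trans (params_T_mono r hS p C N hC (by omega))
  have hV0 : ∀ k, 0 ≤ S.V (run S r (params S r p C N) x₀ ξ e k).x u := fun k =>
    hS.V_nonneg (run_mem r ξ e hS hx₀ p C N k).1 hu
  have key : ∀ k : ℕ,
      (k : ℝ) * (k + 1) / 2 * (S.Ψ r (run S r (params S r p C N) x₀ ξ e k).xbar - S.Ψ r u)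
      + 2 * S.L * (1 + 2 / (((params S r p C N).T (k + 1) : ℝ)
        * ((params S r p C N).T (k + 1) + 3))) * S.V (run S r (params S r p C N) x₀ ξ e k).x u
      ≤ 3 / 2 * S.L * S.DQV ^ 2
        + ∑ j ∈ Finset.range k,
          ((j : ℝ) + 1) * outerError S r σ u (params S r p C N) x₀ ξ e j := by
    intro k
    induction k with
    | zero =>
      simp only [Nat.cast_zero, zero_mul, zero_div, zero_add, Finset.range_zero, Finset.sum_empty,
        add_zero]
      have h1 : (1 : ℝ) ≤ (params S r p C N).T 1 := by exact_mod_cast hT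
      set T := (((params S r p C N).T 1 : ℕ) : ℝ)
      -- As `T ≥ 1`, the initial divergence has coefficient at most `3 L`, and `V ≤ D_{Q,V}² / 2`.
      have h2 : 2 / (T * (T + 3)) ≤ 1 / 2 := by
        rw [div_le_div_iff₀ (by positivity) (by norm_num)]
        nlinarith
      have h3 := hS.V_le (run_mem r ξ e hS hx₀ p C N 0).1 hu
      have h4 := hV0 0
      calc _ ≤ 2 * S.L * (1 + 1 / 2) * (S.DQV ^ 2 / 2) := by gcongr
        _ = _ := by ring
    | succ k ih =>
      have h := run_progress r ξ e hS hx₀ p C N hF hFc hu k (hTk k)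
      simp only at h
      -- The factor `1 + 2 / (T (T + 3))` decreases in `T`, so growing inner loops let the
      -- divergences telescope as an inequality.
      have hmono : (((params S r p C N).T (k + 1) : ℕ) : ℝ) ≤ (params S r p C N).T (k + 1 + 1) := by
        exact_mod_cast params_T_mono r hS p C N hC (by omega)
      have h1 : (1 : ℝ) ≤ (params S r p C N).T (k + 1) := by exact_mod_cast hTk k
      have h2 : 2 * S.L * (1 + 2 / (((params S r p C N).T (k + 1 + 1) : ℝ)
            * ((params S r p C N).T (k + 1 + 1) + 3)))
            * S.V (run S r (params S r p C N) x₀ ξ e (k + 1)).x u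
          ≤ 2 * S.L * (1 + 2 / (((params S r p C N).T (k + 1) : ℝ)
            * ((params S r p C N).T (k + 1) + 3)))
            * S.V (run S r (params S r p C N) x₀ ξ e (k + 1)).x u := by
        have := hV0 (k + 1)
        gcongr
      rw [Finset.sum_range_succ]
      push_cast
      rw [show (k : ℝ) + 1 + 1 = k + 2 by ring]
      linarith
  have h1 := key k
  have h2 : 0 ≤ 2 * S.L * (1 + 2 / (((params S r p C N).T (k + 1) : ℝ)
        * ((params S r p C N).T (k + 1) + 3))) * S.V (run S r (params S r p C N) x₀ ξ e k).x u :=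
    mul_nonneg (by positivity) (hV0 k)
  linarith

end Run

/-! ### Measurability of minimizers and of directional derivatives. -/

section Argmin

variable {n : ℕ} {Ω : Type*} {m : MeasurableSpace Ω} {Q : Set (E n)}

theorem measurable_comp_of_continuousOn {φ : E n → ℝ} (hφ : ContinuousOn φ Q) {w : Ω → E n}
    (hw : Measurable w) (hwQ : ∀ ω, w ω ∈ Q) : Measurable fun ω => φ (w ω) :=
  (continuousOn_iff_continuous_domRestrict.1 hφ).measurable.comp (hw.subtype_mk (h := hwQ))

/-- Gradients within a convex set are measurable in the directions of the set. -/
theorem measurable_inner_gradient (hQ : Convex ℝ Q) {φ : E n → ℝ} {gradφ : E n → E n}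
    (hφ : ∀ x ∈ Q, HasGradientWithinAt φ (gradφ x) Q x) {x : Ω → E n} (hx : Measurable x)
    (hxQ : ∀ ω, x ω ∈ Q) {y : E n} (hy : y ∈ Q) :
    Measurable fun ω => ⟪gradφ (x ω), y - x ω⟫ := by
  have hc : ContinuousOn φ Q := fun x hx => (hφ x hx).hasFDerivWithinAt.continuousWithinAt
  refine measurable_of_tendsto_metrizable (f := fun (k : ℕ) ω => ((k : ℝ) + 1) *
    (φ (x ω + ((k : ℝ) + 1)⁻¹ • (y - x ω)) - φ (x ω))) (fun k => ?_)
    (tendsto_pi_nhds.2 fun ω => tendsto_segment_slope hQ (hxQ ω) hy (hφ _ (hxQ ω)))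
  have hmem : ((k : ℝ) + 1)⁻¹ ∈ Icc (0 : ℝ) 1 :=
    ⟨by positivity, inv_le_one_of_one_le₀ (by linarith [(Nat.cast_nonneg k : (0 : ℝ) ≤ k)])⟩
  refine ((measurable_comp_of_continuousOn hc ?_ fun ω =>
    segment_mem hQ (hxQ ω) hy hmem).sub (measurable_comp_of_continuousOn hc hx hxQ)).const_mul _
  fun_prop

/-- The unique minimizer of a Carathéodory function over a compact set is measurable. -/
theorem measurable_of_unique_minimizer (hQ : IsCompact Q) {J : Ω → E n → ℝ} {w : Ω → E n}
    (hw : ∀ ω, w ω ∈ Q) (hJc : ∀ ω, ContinuousOn (J ω) Q)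
    (hJm : ∀ y ∈ Q, Measurable fun ω => J ω y)
    (hmin : ∀ ω, ∀ y ∈ Q, y ≠ w ω → J ω (w ω) < J ω y) : Measurable w := by
  refine measurable_of_isClosed fun F hF => ?_
  rcases (F ∩ Q).eq_empty_or_nonempty with he | hne
  · have : w ⁻¹' F = ∅ := by
      ext ω
      simp only [mem_preimage, mem_empty_iff_false, iff_false]
      intro h
      have : w ω ∈ F ∩ Q := ⟨h, hw ω⟩
      rw [he] at this
      exact this
    rw [this]
    exact MeasurableSet.empty
  have hneQ : Q.Nonempty := hne.mono inter_subset_right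
  have : Nonempty ↥(F ∩ Q) := hne.to_subtype
  have : Nonempty ↥Q := hneQ.to_subtype
  set d := TopologicalSpace.denseSeq ↥(F ∩ Q)
  set d' := TopologicalSpace.denseSeq ↥Q
  have hd := TopologicalSpace.denseRange_denseSeq ↥(F ∩ Q)
  have hd' := TopologicalSpace.denseRange_denseSeq ↥Q
  have approx : ∀ {A : Set (E n)} {s : ℕ → ↥A} (_ : DenseRange s) (_ : A ⊆ Q) (ω : Ω)
      {y : E n} (_ : y ∈ A) {c : ℝ} (_ : J ω y < c), ∃ k, J ω (s k) < c := by
    intro A s hs hA ω y hy c hc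
    have hcont : Continuous fun z : ↥A => J ω z :=
      continuousOn_iff_continuous_domRestrict.1 ((hJc ω).mono hA)
    exact hs.exists_mem_open (isOpen_lt hcont continuous_const) ⟨⟨y, hy⟩, hc⟩
  -- The minimizer lies in `F` exactly when the infimum of `J` over `F ∩ Q` does not exceed that
  -- over `Q`; dense sequences express this by countably many comparisons.
  have hset : w ⁻¹' F = ⋂ (i : ℕ), ⋂ (j : ℕ), ⋃ (k : ℕ),
      {ω | J ω (d k) < J ω (d' j) + 1 / ((i : ℝ) + 1)} := by
    ext ω
    simp only [mem_preimage, mem_iInter, mem_iUnion, mem_ofPred_eq]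
    constructor
    · intro hωF i j
      refine approx hd inter_subset_right ω (y := w ω) ⟨hωF, hw ω⟩ ?_
      have hpos : 0 < 1 / ((i : ℝ) + 1) := by positivity
      rcases eq_or_ne (d' j : E n) (w ω) with h | h
      · rw [h]; linarith
      · linarith [hmin ω _ (d' j).2 h]
    · intro h
      obtain ⟨y, hy, hymin⟩ := (hQ.inter_left hF).exists_isMinOn hne
        ((hJc ω).mono inter_subset_right)
      by_contra hωF
      have hyw : y ≠ w ω := fun h => hωF (h ▸ hy.1)
      have hlt := hmin ω y hy.2 hyw
      obtain ⟨i, hi⟩ := exists_nat_one_div_lt (half_pos (sub_pos.2 hlt))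
      obtain ⟨j, hj⟩ := approx hd' Subset.rfl ω (hw ω)
        (show J ω (w ω) < J ω (w ω) + (J ω y - J ω (w ω)) / 2 by linarith)
      obtain ⟨k, hk⟩ := h i j
      have := hymin (d k).2
      simp only [mem_ofPred_eq] at this
      linarith
  rw [hset]
  exact MeasurableSet.iInter fun i => MeasurableSet.iInter fun j => MeasurableSet.iUnion fun k =>
    measurableSet_lt (hJm _ (d k).2.2) ((hJm _ (d' j).2).add_const _)

end Argmin

/-! ### Measurability of the iterates. -/

section Measurability

variable {n : ℕ} {Ξ : Type u} [MeasurableSpace Ξ] {S : Problem n Ξ} [NeZero n]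
  (hS : S.Assumptions) {Ω : Type*} {m : MeasurableSpace Ω}
include hS

theorem measurable_zoGrad_comp (r : ℝ) {v : Ω → E n} {ξ : Ω → Ξ} {e : Ω → E n} (hv : Measurable v)
    (hs : Measurable fun ω => (ξ ω, e ω)) : Measurable fun ω => S.zoGrad r (v ω) (ξ ω) (e ω) := by
  have h1 := hS.measurable_zoGrad r
  have h2 : Measurable fun ω => (v ω, (ξ ω, e ω)) := hv.prodMk hs
  have h3 := h1.comp h2
  simp only [Function.comp_def] at h3
  exact h3

theorem measurable_V {x : Ω → E n} (hx : Measurable x) (hxQ : ∀ ω, x ω ∈ S.Q) {y : E n}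
    (hy : y ∈ S.Q) : Measurable fun ω => S.V (x ω) y :=
  ((measurable_const).sub (measurable_comp_of_continuousOn hS.continuousOn_ν hx hxQ)).sub
    (measurable_inner_gradient hS.Q_convex hS.ν_diff hx hxQ hy)

theorem measurable_proxStep {xlow x v G : Ω → E n} (hxl : Measurable xlow) (hx : Measurable x)
    (hv : Measurable v) (hG : Measurable G) (hxlQ : ∀ ω, xlow ω ∈ S.Q) (hxQ : ∀ ω, x ω ∈ S.Q)
    (hvQ : ∀ ω, v ω ∈ S.Q) {β q : ℝ} (hβ : 0 < β) (hq : 0 < q) :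
    Measurable fun ω => S.proxStep (xlow ω) (x ω) (v ω) (G ω) β q := by
  refine measurable_of_unique_minimizer hS.Q_compact
    (J := fun ω => S.proxObj (xlow ω) (x ω) (v ω) (G ω) β q)
    (fun ω => (hS.proxStep_spec (hvQ ω) _ _ _ _ _ _).1)
    (fun ω => hS.continuousOn_proxObj _ _ _ _ _ _) (fun y hy => ?_) (fun ω y hy hne => ?_)
  · exact ((((measurable_comp_of_continuousOn hS.continuousOn_g hxl hxlQ).add
      (measurable_inner_gradient hS.Q_convex hS.g_diff hxl hxlQ hy)).add
      (hG.inner measurable_const)).add ((measurable_V hS hx hxQ hy).const_mul β)).add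
      ((measurable_V hS hv hvQ hy).const_mul (β * q))
  -- The divergence term in the three-point inequality is positive for `y` different from the
  -- minimizer, which gives uniqueness.
  · have h := hS.three_point (hvQ ω) (xlow ω) (x ω) (v ω) (G ω) β q hy
    have hV := hS.half_sq_le_V (hS.proxStep_spec (hvQ ω) (xlow ω) (x ω) (v ω) (G ω) β q).1 hy
    have hpos : 0 < S.nrm (y - S.proxStep (xlow ω) (x ω) (v ω) (G ω) β q) := by
      refine lt_of_le_of_ne (apply_nonneg _ _) fun h0 => hne ?_
      exact sub_eq_zero.1 (hS.nrm_definite _ h0.symm)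
    have : 0 < S.V (S.proxStep (xlow ω) (x ω) (v ω) (G ω) β q) y :=
      lt_of_lt_of_le (by positivity) hV
    have : 0 < β * (1 + q) * S.V (S.proxStep (xlow ω) (x ω) (v ω) (G ω) β q) y := by positivity
    linarith

theorem measurable_PS (r p C : ℝ) (N : ℕ) {xlow x : Ω → E n} (hxl : Measurable xlow)
    (hx : Measurable x) (hxlQ : ∀ ω, xlow ω ∈ S.Q) (hxQ : ∀ ω, x ω ∈ S.Q) {β : ℝ} (hβ : 0 < β)
    {ξ : ℕ → Ω → Ξ} {e : ℕ → Ω → E n} (t : ℕ)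
    (hs : ∀ s < t, Measurable fun ω => (ξ s ω, e s ω)) :
    Measurable (fun ω => (PS S r (params S r p C N) (S.lg (xlow ω)) (x ω) β (fun t => ξ t ω)
      (fun t => e t ω) t).u) ∧
    Measurable (fun ω => (PS S r (params S r p C N) (S.lg (xlow ω)) (x ω) β (fun t => ξ t ω)
      (fun t => e t ω) t).utilde) := by
  induction t with
  | zero => exact ⟨hx, hx⟩
  | succ t ih =>
    obtain ⟨h1, h2⟩ := ih fun s hst => hs s (by omega)
    have hG : Measurable fun ω => S.zoGrad r (PS S r (params S r p C N) (S.lg (xlow ω)) (x ω) β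
        (fun t => ξ t ω) (fun t => e t ω) t).u (ξ t ω) (e t ω) :=
      measurable_zoGrad_comp hS r h1 (hs t (by omega))
    have hq : 0 < (params S r p C N).p (t + 1) := by
      simp only [params]; push_cast; positivity
    have h3 := measurable_proxStep hS hxl hx h1 hG hxlQ hxQ
      (fun ω => (PS_mem hS r p C N _ (hxQ ω) _ _ _ _).1) hβ hq
    refine ⟨h3, ?_⟩
    have h3' : Measurable fun ω => (PS S r (params S r p C N) (S.lg (xlow ω)) (x ω) β
        (fun t => ξ t ω) (fun t => e t ω) (t + 1)).u := h3
    simp only [PS_succ_utilde]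
    fun_prop

theorem params_β_pos (r p C : ℝ) (N k : ℕ) : 0 < (params S r p C N).β (k + 1) := by
  have := hS.L_pos
  simp only [params]
  push_cast
  positivity

variable {x₀ : E n} (hx₀ : x₀ ∈ S.Q) (r p C : ℝ) (N : ℕ) {ξ : ℕ × ℕ → Ω → Ξ}
  {e : ℕ × ℕ → Ω → E n}
include hx₀

theorem measurable_run (k : ℕ)
    (hs : ∀ i : ℕ × ℕ, i.1 ≤ k → Measurable fun ω => (ξ i ω, e i ω)) :
    Measurable (fun ω => (run S r (params S r p C N) x₀ (fun i => ξ i ω) (fun i => e i ω) k).x) ∧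
    Measurable (fun ω =>
      (run S r (params S r p C N) x₀ (fun i => ξ i ω) (fun i => e i ω) k).xbar) := by
  induction k with
  | zero => exact ⟨measurable_const, measurable_const⟩
  | succ k ih =>
    obtain ⟨h1, h2⟩ := ih fun i hi => hs i (by omega)
    have hl : Measurable fun ω => linPoint S r (params S r p C N) x₀ (fun i => ξ i ω)
        (fun i => e i ω) k := by
      simp only [linPoint]
      fun_prop
    obtain ⟨h3, h4⟩ := measurable_PS hS r p C N hl h1
      (fun ω => linPoint_mem r _ _ hS hx₀ p C N k) (fun ω => (run_mem r _ _ hS hx₀ p C N k).1)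
      (params_β_pos hS r p C N k) (ξ := fun t => ξ (k + 1, t)) (e := fun t => e (k + 1, t))
      ((params S r p C N).T (k + 1)) fun s _ => hs _ le_rfl
    simp only [run_succ_x, run_succ_xbar, inner]
    exact ⟨h3, by fun_prop⟩

/-- The σ-algebra on `Ω` is arbitrary and only the earlier samples need be measurable. Taking the
σ-algebra they generate shows that the iterate depends on the past alone. -/
theorem measurable_inner (k t : ℕ)
    (hs : ∀ i : ℕ × ℕ, i.1 ≤ k ∨ (i.1 = k + 1 ∧ i.2 < t) → Measurable fun ω => (ξ i ω, e i ω)) :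
    Measurable fun ω =>
      (inner S r (params S r p C N) x₀ (fun i => ξ i ω) (fun i => e i ω) k t).u := by
  obtain ⟨h1, h2⟩ := measurable_run hS hx₀ r p C N k fun i hi => hs i (Or.inl hi)
  have hl : Measurable fun ω => linPoint S r (params S r p C N) x₀ (fun i => ξ i ω)
      (fun i => e i ω) k := by
    simp only [linPoint]
    fun_prop
  simp only [inner]
  exact (measurable_PS hS r p C N hl h1
    (fun ω => linPoint_mem r _ _ hS hx₀ p C N k) (fun ω => (run_mem r _ _ hS hx₀ p C N k).1)
    (params_β_pos hS r p C N k) (ξ := fun t => ξ (k + 1, t)) (e := fun t => e (k + 1, t))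
    t fun s hst => hs _ (Or.inr ⟨rfl, hst⟩)).1

end Measurability

/-! ### Expectations of functions of two independent variables. -/

section Fubini

variable {Ω α β : Type*} [MeasurableSpace Ω] [MeasurableSpace α] [MeasurableSpace β]
  {μ : Measure Ω} [IsProbabilityMeasure μ] {v : Ω → α} {X : Ω → β} {h : α × β → ℝ}

theorem integrable_comp_of_indepFun (hv : Measurable v) (hX : Measurable X)
    (hvX : IndepFun v X μ) (hh : Measurable h) {Q : Set α} (hQ : MeasurableSet Q)
    (hvQ : ∀ ω, v ω ∈ Q) {c : ℝ} (hh0 : ∀ w, 0 ≤ h w)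
    (hint : ∀ a ∈ Q, Integrable (fun z => h (a, z)) (μ.map X))
    (hle : ∀ a ∈ Q, ∫ z, h (a, z) ∂μ.map X ≤ c) : Integrable (fun ω => h (v ω, X ω)) μ := by
  have := Measure.isProbabilityMeasure_map (μ := μ) hv.aemeasurable
  have := Measure.isProbabilityMeasure_map (μ := μ) hX.aemeasurable
  have hlaw := (indepFun_iff_map_prod_eq_prod_map_map hv.aemeasurable hX.aemeasurable).1 hvX
  have hae : ∀ᵐ a ∂μ.map v, a ∈ Q := (ae_map_iff hv.aemeasurable hQ).2 (ae_of_all _ hvQ)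
  have hi : Integrable h (μ.map fun ω => (v ω, X ω)) := by
    rw [hlaw, integrable_prod_iff hh.aestronglyMeasurable]
    refine ⟨hae.mono fun a ha => hint a ha, ?_⟩
    refine (integrable_const c).mono'
      (hh.stronglyMeasurable.norm.integral_prod_right'.aestronglyMeasurable) ?_
    filter_upwards [hae] with a ha
    rw [Real.norm_of_nonneg (integral_nonneg fun _ => norm_nonneg _)]
    simpa only [Real.norm_of_nonneg (hh0 _)] using hle a ha
  exact hi.comp_measurable (hv.prodMk hX)

theorem integral_comp_of_indepFun (hv : Measurable v) (hX : Measurable X)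
    (hvX : IndepFun v X μ) (hh : Measurable h) (hi : Integrable (fun ω => h (v ω, X ω)) μ) :
    Integrable (fun ω => ∫ z, h (v ω, z) ∂μ.map X) μ ∧
      ∫ ω, h (v ω, X ω) ∂μ = ∫ ω, ∫ z, h (v ω, z) ∂μ.map X ∂μ := by
  have := Measure.isProbabilityMeasure_map (μ := μ) hv.aemeasurable
  have := Measure.isProbabilityMeasure_map (μ := μ) hX.aemeasurable
  have hlaw := (indepFun_iff_map_prod_eq_prod_map_map hv.aemeasurable hX.aemeasurable).1 hvX
  have hi' : Integrable h ((μ.map v).prod (μ.map X)) := by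
    rw [← hlaw]
    exact (integrable_map_measure hh.aestronglyMeasurable (hv.prodMk hX).aemeasurable).2 hi
  have hm := hh.stronglyMeasurable.integral_prod_right' (ν := μ.map X)
  refine ⟨hi'.integral_prod_left.comp_measurable hv, ?_⟩
  rw [← integral_map (f := fun a => ∫ z, h (a, z) ∂μ.map X) hv.aemeasurable
    hm.aestronglyMeasurable, ← integral_prod _ hi', ← hlaw,
    integral_map (hv.prodMk hX).aemeasurable hh.aestronglyMeasurable]

end Fubini

/-! ### The expected error of a single step. -/

section Expectation

variable {n : ℕ} {Ξ : Type u} [MeasurableSpace Ξ] {S : Problem n Ξ} [NeZero n] {r p : ℝ}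
  (hS : S.Assumptions) (hp : S.IsPStar p) (hr : 0 < r) (hrs : r ≤ S.s)
include hS hp hr hrs

/-- Continuity gives boundedness on the compact `Q` and measurability along measurable iterates. -/
theorem continuousOn_F : ContinuousOn (S.F r) S.Q := by
  intro u hu
  refine tendsto_iff_norm_sub_tendsto_zero.2 ?_
  have hlim : Tendsto (fun v => √(S.sigmaSq r p) * S.nrm (v - u)) (𝓝[S.Q] u) (𝓝 0) := by
    have hc : Continuous fun v => √(S.sigmaSq r p) * S.nrm (v - u) :=
      continuous_const.mul ((continuous_nrm S.nrm).comp (continuous_id.sub continuous_const))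
    have := hc.tendsto u
    simp only [sub_self, map_zero, mul_zero] at this
    exact this.mono_left nhdsWithin_le_nhds
  refine squeeze_zero' (Eventually.of_forall fun _ => norm_nonneg _) ?_ hlim
  filter_upwards [self_mem_nhdsWithin] with v hv
  refine abs_le.2 ⟨?_, hS.F_lipschitz hp hr hrs hv hu⟩
  have := hS.F_lipschitz hp hr hrs hu hv
  rw [map_sub_rev] at this
  linarith

theorem integral_stepError_le {Ω : Type*} [MeasurableSpace Ω] {μ : Measure Ω}
    [IsProbabilityMeasure μ] {v : Ω → E n} (hv : Measurable v) (hvQ : ∀ ω, v ω ∈ S.Q)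
    {ξ : Ω → Ξ} {e : Ω → E n} (hs : Measurable fun ω => (ξ ω, e ω))
    (hind : IndepFun v (fun ω => (ξ ω, e ω)) μ)
    (hlaw : μ.map (fun ω => (ξ ω, e ω)) = S.sampleLaw) {u : E n} (hu : u ∈ S.Q) {b : ℝ}
    (hb : 0 < b) :
    Integrable (fun ω => S.stepError r (√(S.sigmaSq r p)) u (v ω)
      (S.zoGrad r (v ω) (ξ ω) (e ω)) b) μ ∧
    ∫ ω, S.stepError r (√(S.sigmaSq r p)) u (v ω) (S.zoGrad r (v ω) (ξ ω) (e ω)) b ∂μ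
      ≤ n * S.Δ * S.DQ * p / r + 2 * S.sigmaSq r p / b := by
  have hdn := continuous_dualNorm hS.nrm_definite
  have hσ0 : 0 ≤ S.sigmaSq r p := by unfold Problem.sigmaSq; positivity
  have hm := hS.measurable_zoGrad r
  have hG : Measurable fun ω => S.zoGrad r (v ω) (ξ ω) (e ω) := measurable_zoGrad_comp hS r hv hs
  have hd : Measurable fun ω => dualNorm S.nrm (S.zoGrad r (v ω) (ξ ω) (e ω)) :=
    hdn.measurable.comp hG
  have hFc := continuousOn_F hS hp hr hrs
  have hFi : Integrable (fun ω => S.F r (v ω) - S.F r u) μ := by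
    obtain ⟨K, hK⟩ := hS.Q_compact.exists_bound_of_continuousOn hFc
    refine Integrable.sub ?_ (integrable_const _)
    exact (integrable_const K).mono'
      (measurable_comp_of_continuousOn hFc hv hvQ).aestronglyMeasurable
      (ae_of_all _ fun ω => hK _ (hvQ ω))
  have hmd : Measurable fun w : E n × (Ξ × E n) =>
      dualNorm S.nrm (S.zoGrad r w.1 w.2.1 w.2.2) ^ 2 := (hdn.measurable.comp hm).pow_const 2
  have hmi : Measurable fun w : E n × (Ξ × E n) =>
      ⟪S.zoGrad r w.1 w.2.1 w.2.2, w.1 - u⟫ := hm.inner (measurable_fst.sub_const u)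
  have hdi : Integrable (fun ω => dualNorm S.nrm (S.zoGrad r (v ω) (ξ ω) (e ω)) ^ 2) μ := by
    refine integrable_comp_of_indepFun hv hs hind hmd hS.Q_compact.measurableSet hvQ
      (c := S.sigmaSq r p) (fun _ => sq_nonneg _) (fun a ha => ?_) (fun a ha => ?_) <;> rw [hlaw]
    · exact (hS.integral_dualNorm_zoGrad_sq hp hr hrs ha).1
    · exact (hS.integral_dualNorm_zoGrad_sq hp hr hrs ha).2
  have hii : Integrable (fun ω => ⟪S.zoGrad r (v ω) (ξ ω) (e ω), v ω - u⟫) μ := by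
    refine ((integrable_const S.DQ).add (hdi.const_mul S.DQ)).mono'
      (hG.inner (hv.sub_const u)).aestronglyMeasurable (ae_of_all _ fun ω => ?_)
    have h1 := abs_inner_le_nrm_mul_dualNorm hS.nrm_definite (v ω - u)
      (S.zoGrad r (v ω) (ξ ω) (e ω))
    have h2 := hS.nrm_sub_le_DQ (hvQ ω) hu
    have h3 := dualNorm_nonneg hS.nrm_definite (S.zoGrad r (v ω) (ξ ω) (e ω))
    have h4 : 0 ≤ S.nrm (v ω - u) := apply_nonneg _ _
    rw [Real.norm_eq_abs, real_inner_comm]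
    set d := dualNorm S.nrm (S.zoGrad r (v ω) (ξ ω) (e ω))
    calc _ ≤ S.nrm (v ω - u) * d := h1
      _ ≤ S.DQ * (1 + d ^ 2) := by
        have : d ≤ 1 + d ^ 2 := by nlinarith [sq_nonneg (d - 1)]
        have : 0 ≤ S.DQ := h4.trans h2
        gcongr
      _ = S.DQ + S.DQ * d ^ 2 := by ring
  have hEd : ∫ ω, dualNorm S.nrm (S.zoGrad r (v ω) (ξ ω) (e ω)) ^ 2 ∂μ ≤ S.sigmaSq r p := by
    obtain ⟨h1, h2⟩ := integral_comp_of_indepFun hv hs hind hmd hdi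
    simp only at h1 h2
    rw [h2]
    refine (integral_mono h1 (integrable_const (S.sigmaSq r p)) fun ω => ?_).trans (by simp)
    simp only [hlaw]
    exact (hS.integral_dualNorm_zoGrad_sq hp hr hrs (hvQ ω)).2
  have hEi : ∫ ω, (S.F r (v ω) - S.F r u) ∂μ - n * S.Δ * S.DQ * p / r
      ≤ ∫ ω, ⟪S.zoGrad r (v ω) (ξ ω) (e ω), v ω - u⟫ ∂μ := by
    obtain ⟨h1, h2⟩ := integral_comp_of_indepFun hv hs hind hmi hii
    simp only at h1 h2
    rw [h2]
    have h3 : ∫ ω, (S.F r (v ω) - S.F r u) ∂μ - n * S.Δ * S.DQ * p / r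
        = ∫ ω, (S.F r (v ω) - S.F r u - n * S.Δ * S.DQ * p / r) ∂μ := by
      rw [integral_sub hFi (integrable_const _)]
      simp
    rw [h3]
    refine integral_mono (hFi.sub (integrable_const _)) h1 fun ω => ?_
    simp only [hlaw]
    exact (hS.F_sub_le_integral_inner_zoGrad hp hr hrs (hvQ ω) hu).2
  set σ := √(S.sigmaSq r p)
  have hσ : σ ^ 2 = S.sigmaSq r p := Real.sq_sqrt hσ0
  -- Both squares have mean at most `sigmaSq`, so the total is at most `4 sigmaSq`; division by `2
  -- b` leaves `2 sigmaSq / b`.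
  have hsq : ∀ ω, (σ + dualNorm S.nrm (S.zoGrad r (v ω) (ξ ω) (e ω))) ^ 2
      ≤ 2 * S.sigmaSq r p + 2 * dualNorm S.nrm (S.zoGrad r (v ω) (ξ ω) (e ω)) ^ 2 := fun ω => by
    rw [← hσ]
    nlinarith [sq_nonneg (σ - dualNorm S.nrm (S.zoGrad r (v ω) (ξ ω) (e ω)))]
  have hupper : Integrable (fun ω => 2 * S.sigmaSq r p
      + 2 * dualNorm S.nrm (S.zoGrad r (v ω) (ξ ω) (e ω)) ^ 2) μ :=
    (integrable_const _).add (hdi.const_mul 2)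
  have hsqi : Integrable (fun ω => (σ + dualNorm S.nrm (S.zoGrad r (v ω) (ξ ω) (e ω))) ^ 2) μ :=
    hupper.mono' ((hd.const_add σ).pow_const 2).aestronglyMeasurable (ae_of_all _ fun ω => by
      rw [Real.norm_of_nonneg (sq_nonneg _)]
      exact hsq ω)
  have hEsq : ∫ ω, (σ + dualNorm S.nrm (S.zoGrad r (v ω) (ξ ω) (e ω))) ^ 2 ∂μ
      ≤ 4 * S.sigmaSq r p := by
    refine (integral_mono hsqi hupper hsq).trans ?_
    rw [integral_add (integrable_const _) (hdi.const_mul 2)]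
    simp only [integral_const_mul, integral_const, probReal_univ, one_smul]
    linarith
  have hfi : Integrable (fun ω => S.F r (v ω) - S.F r u
      - ⟪S.zoGrad r (v ω) (ξ ω) (e ω), v ω - u⟫) μ := hFi.sub hii
  refine ⟨hfi.add (hsqi.div_const (2 * b)), ?_⟩
  simp only [Problem.stepError]
  rw [integral_add hfi (hsqi.div_const (2 * b)), integral_sub hFi hii,
    integral_div]
  have : (∫ ω, (σ + dualNorm S.nrm (S.zoGrad r (v ω) (ξ ω) (e ω))) ^ 2 ∂μ) / (2 * b)
      ≤ 2 * S.sigmaSq r p / b := by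
    rw [div_le_div_iff₀ (by positivity) hb]
    nlinarith
  linarith

theorem integral_innerError_le {Ω : Type*} [MeasurableSpace Ω] {μ : Measure Ω}
    [IsProbabilityMeasure μ] {ξ : ℕ × ℕ → Ω → Ξ} {e : ℕ × ℕ → Ω → E n}
    (hs : IsSampling S μ ξ e) {x₀ u : E n} (hx₀ : x₀ ∈ S.Q) (hu : u ∈ S.Q) (C : ℝ) (N k t : ℕ) :
    Integrable (fun ω => innerError S r (√(S.sigmaSq r p)) u (params S r p C N) x₀
      (fun i => ξ i ω) (fun i => e i ω) k t) μ ∧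
    ∫ ω, innerError S r (√(S.sigmaSq r p)) u (params S r p C N) x₀
      (fun i => ξ i ω) (fun i => e i ω) k t ∂μ
      ≤ n * S.Δ * S.DQ * p / r + 2 * S.sigmaSq r p / (S.L * (t + 1) / (k + 1)) := by
  have hX : ∀ i, Measurable fun ω => (ξ i ω, e i ω) := fun i => (hs.meas_ξ i).prodMk (hs.meas_e i)
  -- A set of indices containing all samples used before this step. It omits `(k + 1, t)`, so the
  -- current iterate is independent of the fresh sample.
  set A : Set (ℕ × ℕ) := {i | i.1 ≤ k ∨ (i.1 = k + 1 ∧ i.2 < t)} with hA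
  set m' : ℕ × ℕ → MeasurableSpace Ω :=
    fun i => MeasurableSpace.comap (fun ω => (ξ i ω, e i ω)) inferInstance with hm'
  have hdisj : Disjoint A {(k + 1, t)} := by
    rw [disjoint_singleton_right]
    simp [hA]
  have hpast : Measurable[⨆ i ∈ A, m' i] fun ω =>
      (inner S r (params S r p C N) x₀ (fun i => ξ i ω) (fun i => e i ω) k t).u := by
    refine measurable_inner (m := ⨆ i ∈ A, m' i) hS hx₀ r p C N k t fun i hi => ?_
    exact (comap_measurable _).mono (le_iSup₂ (f := fun i (_ : i ∈ A) => m' i) i hi) le_rfl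
  have hind : IndepFun
      (fun ω => (inner S r (params S r p C N) x₀ (fun i => ξ i ω) (fun i => e i ω) k t).u)
      (fun ω => (ξ (k + 1, t) ω, e (k + 1, t) ω)) μ := by
    rw [IndepFun_iff_Indep]
    have h := indep_iSup_of_disjoint (fun i => (hX i).comap_le) hs.indep.iIndep hdisj
    refine indep_of_indep_of_le h hpast.comap_le ?_
    simp
  have h := integral_stepError_le hS hp hr hrs
    (measurable_inner hS hx₀ r p C N k t fun i _ => hX i)
    (fun ω => (inner_mem r _ _ hS hx₀ p C N k t).1) (hX (k + 1, t)) hind (hs.law _) hu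
    (b := (params S r p C N).β (k + 1) * (((t : ℝ) + 1) / 2))
    (mul_pos (params_β_pos hS r p C N k) (by positivity))
  have hβ : (params S r p C N).β (k + 1) * (((t : ℝ) + 1) / 2) = S.L * (t + 1) / (k + 1) := by
    simp only [params]
    push_cast
    ring
  rw [← hβ]
  exact h

end Expectation

theorem sum_range_add_one (N : ℕ) :
    ∑ j ∈ Finset.range N, ((j : ℝ) + 1) = (N : ℝ) * (N + 1) / 2 := by
  induction N with
  | zero => simp
  | succ N ih =>
    rw [Finset.sum_range_succ, ih]
    push_cast
    ring

theorem sum_range_add_two (N : ℕ) :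
    ∑ j ∈ Finset.range N, ((j : ℝ) + 2) = (N : ℝ) * (N + 3) / 2 := by
  induction N with
  | zero => simp
  | succ N ih =>
    rw [Finset.sum_range_succ, ih]
    push_cast
    ring

/-! ### Summing the expected errors: the convergence bounds. -/

section ExpectedError

variable {n : ℕ} {Ξ : Type u} [MeasurableSpace Ξ] {S : Problem n Ξ} {r p : ℝ}

namespace Problem.Assumptions

variable (hS : S.Assumptions)
include hS

theorem DQV_nonneg : 0 ≤ S.DQV := by
  refine Real.sSup_nonneg ?_
  rintro _ ⟨x, -, y, -, rfl⟩
  exact Real.sqrt_nonneg _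

theorem DQ_nonneg : 0 ≤ S.DQ := by
  refine Real.sSup_nonneg ?_
  rintro _ ⟨x, -, y, -, rfl⟩
  exact apply_nonneg _ _

theorem eq_of_DQV_eq_zero (h : S.DQV = 0) {x y : E n} (hx : x ∈ S.Q) (hy : y ∈ S.Q) : x = y := by
  have h1 := hS.nrm_sub_le_DQ hx hy
  have h2 := hS.DQ_le_DQV hx
  exact sub_eq_zero.1 (hS.nrm_definite _
    (le_antisymm (h1.trans (h2.trans h.le)) (apply_nonneg _ _)))

end Problem.Assumptions

variable [NeZero n] (hS : S.Assumptions) (hp : S.IsPStar p) (hr : 0 < r) (hrs : r ≤ S.s)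
include hS hp hr

theorem sigmaSq_pos : 0 < S.sigmaSq r p := by
  have h1 := hS.p_pos hp
  have h2 := hS.M_pos
  have h3 : (0 : ℝ) < n := Nat.cast_pos.2 (NeZero.pos n)
  unfold Problem.sigmaSq
  positivity

/-- Here `C = 1000` is twice the constant 500 of `sigmaSq`; before rounding there is equality. For
`DQV = 0` both sides vanish by the convention for division by zero. -/
theorem le_params_T (N k : ℕ) :
    8 * N * k ^ 2 * S.sigmaSq r p / (3 * S.DQV ^ 2 * S.L ^ 2) ≤ (params S r p 1000 N).T k := by
  refine le_trans (le_of_eq ?_) (Nat.le_ceil _)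
  unfold Problem.sigmaSq
  by_cases hD : S.DQV = 0
  · simp [hD]
  · have := hS.L_pos
    field_simp
    ring

theorem one_le_params_T (hD : 0 < S.DQV) {N : ℕ} (hN : 1 ≤ N) (k : ℕ) :
    1 ≤ (params S r p 1000 N).T (k + 1) := by
  have h1 := sigmaSq_pos hS hp hr
  have h2 := le_params_T hS hp hr N (k + 1)
  have h3 := hS.L_pos
  have h4 : (0 : ℝ) < N := Nat.cast_pos.2 hN
  have h5 : (0 : ℝ) < (params S r p 1000 N).T (k + 1) := lt_of_lt_of_le (by positivity) h2
  exact_mod_cast h5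

include hrs

variable {Ω : Type*} [MeasurableSpace Ω] {μ : Measure Ω} [IsProbabilityMeasure μ]

theorem integrable_Ψ_comp {v : Ω → E n} (hv : Measurable v) (hvQ : ∀ ω, v ω ∈ S.Q) :
    Integrable (fun ω => S.Ψ r (v ω)) μ := by
  have hc : ContinuousOn (S.Ψ r) S.Q := (continuousOn_F hS hp hr hrs).add hS.continuousOn_g
  obtain ⟨K, hK⟩ := hS.Q_compact.exists_bound_of_continuousOn hc
  exact (integrable_const K).mono' (measurable_comp_of_continuousOn hc hv hvQ).aestronglyMeasurable
    (ae_of_all _ fun ω => hK _ (hvQ ω))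

theorem integrable_Ψ₀_comp {v : Ω → E n} (hv : Measurable v) (hvQ : ∀ ω, v ω ∈ S.Q) :
    Integrable (fun ω => S.Ψ₀ (v ω)) μ := by
  obtain ⟨φ, hφ, he⟩ := hS.exists_lipschitz_extension
  have hf : ContinuousOn S.f S.Q :=
    hφ.continuousOn.congr fun x hx => he (Problem.mem_Qs hx (hr.le.trans hrs))
  have hc : ContinuousOn S.Ψ₀ S.Q := hf.add hS.continuousOn_g
  obtain ⟨K, hK⟩ := hS.Q_compact.exists_bound_of_continuousOn hc
  exact (integrable_const K).mono' (measurable_comp_of_continuousOn hc hv hvQ).aestronglyMeasurable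
    (ae_of_all _ fun ω => hK _ (hvQ ω))

variable {ξ : ℕ × ℕ → Ω → Ξ} {e : ℕ × ℕ → Ω → E n} (hs : IsSampling S μ ξ e) {x₀ u : E n}
  (hx₀ : x₀ ∈ S.Q)
include hs hx₀

theorem integral_outerError_le (hu : u ∈ S.Q) (hD : 0 < S.DQV) {N : ℕ} (hN : 1 ≤ N) (k : ℕ) :
    Integrable (fun ω => outerError S r (√(S.sigmaSq r p)) u (params S r p 1000 N) x₀
      (fun i => ξ i ω) (fun i => e i ω) k) μ ∧
    ∫ ω, outerError S r (√(S.sigmaSq r p)) u (params S r p 1000 N) x₀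
      (fun i => ξ i ω) (fun i => e i ω) k ∂μ
      ≤ n * S.Δ * S.DQ * p / r + 3 * S.L * S.DQV ^ 2 / (N * (k + 1)) := by
  have hin := fun t => integral_innerError_le hS hp hr hrs hs hx₀ hu 1000 N k t
  have hT := one_le_params_T hS hp hr hD hN k
  have hTlb := le_params_T hS hp hr N (k + 1)
  simp only [outerError]
  set T := (params S r p 1000 N).T (k + 1)
  have hT0 : (1 : ℝ) ≤ T := by exact_mod_cast hT
  have hL := hS.L_pos
  have hσ := sigmaSq_pos hS hp hr
  have hN0 : (0 : ℝ) < N := Nat.cast_pos.2 hN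
  have hi := fun t => (hin t).1.const_mul ((t : ℝ) + 2)
  refine ⟨(integrable_finsetSum _ fun t _ => hi t).const_mul _, ?_⟩
  rw [integral_const_mul, integral_finsetSum _ fun t _ => hi t]
  simp only [integral_const_mul]
  set B := n * S.Δ * S.DQ * p / r
  have hle : ∑ t ∈ Finset.range T, ((t : ℝ) + 2) * ∫ ω, innerError S r (√(S.sigmaSq r p)) u
      (params S r p 1000 N) x₀ (fun i => ξ i ω) (fun i => e i ω) k t ∂μ
      ≤ ∑ t ∈ Finset.range T, (((t : ℝ) + 2) * B + 4 * S.sigmaSq r p * (k + 1) / S.L) := by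
    refine Finset.sum_le_sum fun t _ => ?_
    refine (mul_le_mul_of_nonneg_left (hin t).2 (by positivity)).trans ?_
    rw [mul_add]
    gcongr
    rw [mul_div_assoc', div_div_eq_mul_div, div_le_div_iff₀ (by positivity) hL]
    have : (t : ℝ) + 2 ≤ 2 * (t + 1) := by linarith [(Nat.cast_nonneg t : (0 : ℝ) ≤ t)]
    calc ((t : ℝ) + 2) * (2 * S.sigmaSq r p) * (k + 1) * S.L
        ≤ 2 * (t + 1) * (2 * S.sigmaSq r p) * (k + 1) * S.L := by gcongr
      _ = _ := by ring
  rw [Finset.sum_add_distrib, ← Finset.sum_mul, sum_range_add_two, Finset.sum_const,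
    Finset.card_range, nsmul_eq_mul] at hle
  have h1 := mul_le_mul_of_nonneg_left hle (show 0 ≤ 2 / ((T : ℝ) * (T + 3)) by positivity)
  refine h1.trans ?_
  have h2 : 2 / ((T : ℝ) * (T + 3)) * ((T : ℝ) * (T + 3) / 2 * B
      + T * (4 * S.sigmaSq r p * (k + 1) / S.L))
      = B + 8 * S.sigmaSq r p * (k + 1) / (S.L * (T + 3)) := by
    field_simp
    ring
  rw [h2]
  -- The lower bound on `T` with index `k + 1` gains `(k + 1)²` against the `k + 1` in the variance
  -- term.
  refine (add_le_add_iff_left B).2 ?_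
  push_cast at hTlb
  have h4 := (div_le_iff₀ (by positivity)).1 hTlb
  rw [div_le_div_iff₀ (by positivity) (by positivity)]
  have h3 : 0 ≤ S.L ^ 2 * S.DQV ^ 2 := by positivity
  linarith

theorem measurable_zoSA_xbar (N : ℕ) : Measurable fun ω =>
    (zoSA S r p 1000 N x₀ (fun i => ξ i ω) (fun i => e i ω)).xbar :=
  (measurable_run hS hx₀ r p 1000 N N fun i _ => (hs.meas_ξ i).prodMk (hs.meas_e i)).2

/-- The bound in expectation for the smoothed objective. -/
theorem integral_Ψ_sub_le (hu : u ∈ S.Q) {N : ℕ} (hN : 1 ≤ N) :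
    ∫ ω, (S.Ψ r (zoSA S r p 1000 N x₀ (fun i => ξ i ω) (fun i => e i ω)).xbar - S.Ψ r u) ∂μ
      ≤ 12 * S.L * S.DQV ^ 2 / (N * (N + 1)) + n * S.Δ * S.DQ * p / r := by
  have hmem : ∀ ω, (zoSA S r p 1000 N x₀ (fun i => ξ i ω) (fun i => e i ω)).xbar ∈ S.Q :=
    fun ω => (run_mem r _ _ hS hx₀ p 1000 N N).2
  have hL := hS.L_pos
  have hN0 : (0 : ℝ) < N := Nat.cast_pos.2 hN
  have hpp := hS.p_pos hp
  have hΔ := hS.Δ_nonneg (Problem.mem_Qs hx₀ (hr.le.trans hrs))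
  have hDQ := hS.DQ_nonneg
  -- If `DQV = 0`, then every `T k` is 0, but `Q` is a single point and the left side vanishes.
  rcases hS.DQV_nonneg.eq_or_lt with hD | hD
  · have : ∀ ω, (zoSA S r p 1000 N x₀ (fun i => ξ i ω) (fun i => e i ω)).xbar = u :=
      fun ω => hS.eq_of_DQV_eq_zero hD.symm (hmem ω) hu
    simp only [this, sub_self, integral_zero]
    positivity
  have hi : Integrable (fun ω => S.Ψ r (zoSA S r p 1000 N x₀ (fun i => ξ i ω)
      (fun i => e i ω)).xbar - S.Ψ r u) μ :=
    (integrable_Ψ_comp hS hp hr hrs (measurable_zoSA_xbar hS hp hr hrs hs hx₀ N) hmem).sub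
      (integrable_const _)
  have ho := integral_outerError_le hS hp hr hrs hs hx₀ hu hD hN
  set B := n * S.Δ * S.DQ * p / r
  have hpath := fun ω => run_bound r (fun i => ξ i ω) (fun i => e i ω) hS hx₀ p 1000 N
    (fun y hy z hz => hS.F_lipschitz hp hr hrs hy hz) (hS.F_convexOn hr hrs) hu (by norm_num)
    (one_le_params_T hS hp hr hD hN 0) N
  have hoi := fun j : ℕ => (ho j).1.const_mul ((j : ℝ) + 1)
  have hsi := integrable_finsetSum (Finset.range N) fun j _ => hoi j
  have h1 := integral_mono (hi.const_mul ((N : ℝ) * (N + 1) / 2))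
    ((integrable_const (3 / 2 * S.L * S.DQV ^ 2)).add hsi) hpath
  simp only [Pi.add_apply] at h1
  rw [integral_const_mul, integral_add (integrable_const _) hsi,
    integral_finsetSum _ fun j _ => hoi j] at h1
  simp only [integral_const_mul, integral_const, probReal_univ, one_smul] at h1
  -- The weight `j + 1` cancels, each outer iteration costs `3 L DQV² / N`, and all of them together
  -- `3 L DQV²`.
  have h2 : ∑ j ∈ Finset.range N, ((j : ℝ) + 1) * ∫ ω, outerError S r (√(S.sigmaSq r p)) u
      (params S r p 1000 N) x₀ (fun i => ξ i ω) (fun i => e i ω) j ∂μ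
      ≤ ∑ j ∈ Finset.range N, (((j : ℝ) + 1) * B + 3 * S.L * S.DQV ^ 2 / N) := by
    refine Finset.sum_le_sum fun j _ => ?_
    refine (mul_le_mul_of_nonneg_left (ho j).2 (by positivity)).trans (le_of_eq ?_)
    field_simp
  rw [Finset.sum_add_distrib, ← Finset.sum_mul, sum_range_add_one, Finset.sum_const,
    Finset.card_range, nsmul_eq_mul, mul_div_cancel₀ _ hN0.ne'] at h2
  refine le_of_mul_le_mul_left ?_ (show 0 < (N : ℝ) * (N + 1) / 2 by positivity)
  -- The initial term `3/2` and the variance term `3` fit into the available `6`.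
  have h3 : (N : ℝ) * (N + 1) / 2 * (12 * S.L * S.DQV ^ 2 / (N * (N + 1)) + B)
      = 6 * S.L * S.DQV ^ 2 + (N : ℝ) * (N + 1) / 2 * B := by
    field_simp
    ring
  rw [h3]
  have h4 : 0 ≤ S.L * S.DQV ^ 2 := by positivity
  refine le_trans h1 ?_
  linarith

/-- The bound in expectation for the original objective. -/
theorem integral_Ψ₀_sub_le (hu : u ∈ S.Q) {N : ℕ} (hN : 1 ≤ N) :
    ∫ ω, (S.Ψ₀ (zoSA S r p 1000 N x₀ (fun i => ξ i ω) (fun i => e i ω)).xbar - S.Ψ₀ u) ∂μ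
      ≤ 2 * r * S.M + 12 * S.L * S.DQV ^ 2 / (N * (N + 1)) + n * S.Δ * S.DQ * p / r := by
  have hmem : ∀ ω, (zoSA S r p 1000 N x₀ (fun i => ξ i ω) (fun i => e i ω)).xbar ∈ S.Q :=
    fun ω => (run_mem r _ _ hS hx₀ p 1000 N N).2
  have hm := measurable_zoSA_xbar hS hp hr hrs hs hx₀ N
  have hi : Integrable (fun ω => S.Ψ r (zoSA S r p 1000 N x₀ (fun i => ξ i ω)
      (fun i => e i ω)).xbar - S.Ψ r u) μ :=
    (integrable_Ψ_comp hS hp hr hrs hm hmem).sub (integrable_const _)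
  have hi0 : Integrable (fun ω => S.Ψ₀ (zoSA S r p 1000 N x₀ (fun i => ξ i ω)
      (fun i => e i ω)).xbar - S.Ψ₀ u) μ :=
    (integrable_Ψ₀_comp hS hp hr hrs hm hmem).sub (integrable_const _)
  have h1 := integral_Ψ_sub_le hS hp hr hrs hs hx₀ hu hN
  have h2 := integral_mono hi0 ((integrable_const (2 * r * S.M)).add hi) fun ω => by
    have h3 := abs_le.1 (hS.abs_F_sub_f_le hr hrs (hmem ω))
    have h4 := abs_le.1 (hS.abs_F_sub_f_le hr hrs hu)
    simp only [Pi.add_apply, Problem.Ψ, Problem.Ψ₀]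
    linarith [h3.1, h4.2]
  simp only [Pi.add_apply] at h2
  rw [integral_add (integrable_const _) hi] at h2
  simp only [integral_const, probReal_univ, one_smul] at h2
  linarith

end ExpectedError

/-! ### Parameter choices and oracle complexity. -/

section Complexity

variable {n : ℕ} {Ξ : Type u} [MeasurableSpace Ξ] {S : Problem n Ξ} {r p ε c₁ c₂ c₃ c₄ c₅ : ℝ}

/-- Used with `q = p` for the bias and with `q = 1` for the noise part of the variance; the maximum
in the bound on `Δ` serves both. -/
theorem mul_noise_le [NeZero n] (hM : 0 < S.M) (hDQ : 0 < S.DQ) (hr : 0 < r)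
    (hΔ : 0 ≤ S.Δ) (hε : 0 < ε) (hc₁ : 0 < c₁) (hc₃ : 0 < c₃) (h1 : c₁ * (ε / S.M) ≤ r)
    (h3 : S.Δ ≤ c₃ * (ε ^ 2 / ((n : ℝ) * S.M * S.DQ * max p 1))) {q : ℝ} (hq : q ≤ max p 1) :
    n * S.Δ * S.DQ * q / r ≤ c₃ / c₁ * ε := by
  have hn : (0 : ℝ) < n := Nat.cast_pos.2 (NeZero.pos n)
  have hm : 0 < max p 1 := lt_of_lt_of_le one_pos (le_max_right p 1)
  rw [mul_div_assoc', le_div_iff₀ (by positivity)] at h3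
  rw [mul_div_assoc', div_le_iff₀ hM] at h1
  rw [div_le_iff₀ hr]
  have h4 : n * S.Δ * S.DQ * q ≤ n * S.Δ * S.DQ * max p 1 := by gcongr
  refine h4.trans (le_of_mul_le_mul_right ?_ hM)
  calc n * S.Δ * S.DQ * max p 1 * S.M = S.Δ * (n * S.M * S.DQ * max p 1) := by ring
    _ ≤ c₃ * ε ^ 2 := h3
    _ = c₃ / c₁ * ε * (c₁ * ε) := by field_simp
    _ ≤ c₃ / c₁ * ε * (r * S.M) := by gcongr
    _ = _ := by ring

theorem sq_noise_le [NeZero n] (hM : 0 < S.M) (hDQ : 0 < S.DQ) (hr : 0 < r)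
    (hΔ : 0 ≤ S.Δ) (hε : 0 < ε) (hc₁ : 0 < c₁) (hc₃ : 0 < c₃) (h1 : c₁ * (ε / S.M) ≤ r)
    (h3 : S.Δ ≤ c₃ * (ε ^ 2 / ((n : ℝ) * S.M * S.DQ * max p 1)))
    (h4 : ε ≤ c₄ * (√(n : ℝ) * S.M * S.DQ)) :
    (n : ℝ) ^ 2 * S.Δ ^ 2 / r ^ 2 ≤ (c₃ / c₁ * c₄) ^ 2 * (n * S.M ^ 2) := by
  have h5 := mul_noise_le (q := 1) hM hDQ hr hΔ hε hc₁ hc₃ h1 h3 (le_max_right p 1)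
  have h6 : n * S.Δ / r ≤ c₃ / c₁ * c₄ * (√(n : ℝ) * S.M) := by
    refine le_of_mul_le_mul_right ?_ hDQ
    calc n * S.Δ / r * S.DQ = n * S.Δ * S.DQ * 1 / r := by ring
      _ ≤ c₃ / c₁ * ε := h5
      _ ≤ c₃ / c₁ * (c₄ * (√(n : ℝ) * S.M * S.DQ)) := by gcongr
      _ = _ := by ring
  calc (n : ℝ) ^ 2 * S.Δ ^ 2 / r ^ 2 = (n * S.Δ / r) ^ 2 := by ring
    _ ≤ (c₃ / c₁ * c₄ * (√(n : ℝ) * S.M)) ^ 2 := by gcongr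
    _ = (c₃ / c₁ * c₄) ^ 2 * (√(n : ℝ) ^ 2 * S.M ^ 2) := by ring
    _ = _ := by rw [Real.sq_sqrt n.cast_nonneg]

/-- Each inner step makes two calls. Replacing every `T j` by the largest keeps the order `N⁴`, and
the rounding contributes `2 N`. -/
theorem run_zoCalls_le (hS : S.Assumptions) (hD : 0 < S.DQV) {C a : ℝ} (hC : 0 ≤ C)
    (hn : (n : ℝ) ^ 2 * S.Δ ^ 2 / r ^ 2 ≤ a * (n * S.M ^ 2)) (N : ℕ) (x₀ : E n) (ξ : ℕ × ℕ → Ξ)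
    (e : ℕ × ℕ → E n) : ((run S r (params S r p C N) x₀ ξ e N).zoCalls : ℝ)
      ≤ 2 * N + 8 / 3 * C * (1 + a) * (N ^ 4 / (S.L ^ 2 * S.DQV ^ 2)) * (p ^ 2 * n * S.M ^ 2) := by
  have hL := hS.L_pos
  rw [run_zoCalls]
  have hT : ((params S r p C N).T N : ℝ)
      ≤ 4 / 3 * C * (1 + a) * (N ^ 3 / (S.L ^ 2 * S.DQV ^ 2)) * (p ^ 2 * n * S.M ^ 2) + 1 := by
    have h0 : 0 ≤ C * (N : ℝ) * p ^ 2 * ((n : ℝ) * S.M ^ 2 + (n : ℝ) ^ 2 * S.Δ ^ 2 / r ^ 2)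
        * (N : ℝ) ^ 2 / (3 * S.DQV ^ 2 / 4 * S.L ^ 2) := by positivity
    refine (Nat.ceil_lt_add_one h0).le.trans ?_
    gcongr ?_ + 1
    calc _ ≤ C * (N : ℝ) * p ^ 2 * ((n : ℝ) * S.M ^ 2 + a * (n * S.M ^ 2))
        * (N : ℝ) ^ 2 / (3 * S.DQV ^ 2 / 4 * S.L ^ 2) := by gcongr
      _ = _ := by field_simp
  have h1 : ∑ j ∈ Finset.range N, 2 * (params S r p C N).T (j + 1)
      ≤ ∑ _j ∈ Finset.range N, 2 * (params S r p C N).T N :=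
    Finset.sum_le_sum fun j hj => Nat.mul_le_mul_left 2
      (params_T_mono r hS p C N hC (Finset.mem_range.1 hj))
  rw [Finset.sum_const, Finset.card_range, smul_eq_mul] at h1
  calc ((∑ j ∈ Finset.range N, 2 * (params S r p C N).T (j + 1) : ℕ) : ℝ)
      ≤ ((N * (2 * (params S r p C N).T N) : ℕ) : ℝ) := Nat.cast_le.2 h1
    _ = N * (2 * (params S r p C N).T N) := by push_cast; ring
    _ ≤ N * (2 * (4 / 3 * C * (1 + a) * (N ^ 3 / (S.L ^ 2 * S.DQV ^ 2))
        * (p ^ 2 * n * S.M ^ 2) + 1)) := by gcongr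
    _ = _ := by ring

/-- The number of outer iterations for a relative accuracy. -/
theorem exists_iterations {A η c : ℝ} (hA : 0 < A) (hη : 0 < η) (hc : 0 < c) (h : 1 ≤ c * A) :
    ∃ N : ℕ, 1 ≤ N ∧ 12 * A / ((N : ℝ) * (N + 1)) ≤ η ∧ (N : ℝ) ≤ (√(12 / η) + √c) * √A := by
  have hs : 0 < √(12 / η) * √A := by positivity
  refine ⟨⌈√(12 / η) * √A⌉₊, Nat.ceil_pos.2 hs, ?_, ?_⟩
  · have h1 := Nat.le_ceil (√(12 / η) * √A)
    set N := ⌈√(12 / η) * √A⌉₊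
    have hN : (0 : ℝ) < N := lt_of_lt_of_le hs h1
    have h2 := pow_le_pow_left₀ hs.le h1 2
    rw [mul_pow, Real.sq_sqrt (by positivity), Real.sq_sqrt hA.le, div_mul_eq_mul_div,
      div_le_iff₀ hη] at h2
    rw [div_le_iff₀ (by positivity)]
    nlinarith
  · refine (Nat.ceil_lt_add_one hs.le).le.trans ?_
    -- The lower bound on `A` absorbs the 1 lost by rounding up.
    have h2 : 1 ≤ √c * √A := by
      rw [← Real.sqrt_mul hc.le]
      exact Real.one_le_sqrt.2 h
    linarith

end Complexity

end ZoSA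

theorem mainTheorem7 :
    ∃ C : ℝ, 0 < C ∧
      -- convergence, for the smoothed and for the original objective
      (∀ (n : ℕ) (_ : 1 ≤ n) (Ξ : Type u) [MeasurableSpace Ξ] (S : ZoSA.Problem n Ξ)
        (_ : S.Assumptions) (r p : ℝ) (_ : 0 < r) (_ : r ≤ S.s) (_ : S.IsPStar p)
        (N : ℕ) (_ : 1 ≤ N) (x₀ : ZoSA.E n) (_ : x₀ ∈ S.Q)
        (Ω : Type v) [MeasurableSpace Ω] (μ : Measure Ω) [IsProbabilityMeasure μ]
        (ξ : ℕ × ℕ → Ω → Ξ) (e : ℕ × ℕ → Ω → ZoSA.E n) (_ : ZoSA.IsSampling S μ ξ e)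
        (xbar : Ω → ZoSA.E n)
        (_ : ∀ ω, xbar ω = (ZoSA.zoSA S r p C N x₀ (fun i => ξ i ω) (fun i => e i ω)).xbar),
        (∀ ω, xbar ω ∈ S.Q) ∧
        (Integrable (fun ω => S.Ψ r (xbar ω)) μ ∧
          ∀ xstar ∈ S.Q, IsMinOn (S.Ψ r) S.Q xstar →
            ∫ ω, (S.Ψ r (xbar ω) - S.Ψ r xstar) ∂μ
              ≤ 12 * S.L * S.DQV ^ 2 / ((N : ℝ) * ((N : ℝ) + 1))
                + (n : ℝ) * S.Δ * S.DQ * p / r) ∧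
        (Integrable (fun ω => S.Ψ₀ (xbar ω)) μ ∧
          ∀ xstar ∈ S.Q, IsMinOn S.Ψ₀ S.Q xstar →
            ∫ ω, (S.Ψ₀ (xbar ω) - S.Ψ₀ xstar) ∂μ
              ≤ 2 * r * S.M + 12 * S.L * S.DQV ^ 2 / ((N : ℝ) * ((N : ℝ) + 1))
                + (n : ℝ) * S.Δ * S.DQ * p / r)) ∧
      -- oracle complexity
      (∀ c₁ c₂ c₃ c₄ c₅ : ℝ, 0 < c₁ → 0 < c₂ → 0 < c₃ → 0 < c₄ → 0 < c₅ →
        2 * c₂ + c₃ / c₁ < 1 →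
        ∃ K : ℝ, 0 < K ∧
          ∀ (n : ℕ) (_ : 1 ≤ n) (Ξ : Type u) [MeasurableSpace Ξ] (S : ZoSA.Problem n Ξ)
            (_ : S.Assumptions) (r p ε : ℝ) (_ : 0 < r) (_ : r ≤ S.s) (_ : S.IsPStar p)
            (_ : 0 < ε) (_ : c₁ * (ε / S.M) ≤ r) (_ : r ≤ c₂ * (ε / S.M))
            (_ : S.Δ ≤ c₃ * (ε ^ 2 / ((n : ℝ) * S.M * S.DQ * max p 1)))
            (_ : ε ≤ c₄ * (√(n : ℝ) * S.M * S.DQ))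
            (_ : ε ≤ c₅ * (S.L * S.DQV ^ 2)),
            ∃ N : ℕ, 1 ≤ N ∧
              ∀ (x₀ : ZoSA.E n) (_ : x₀ ∈ S.Q)
                (Ω : Type v) [MeasurableSpace Ω] (μ : Measure Ω) [IsProbabilityMeasure μ]
                (ξ : ℕ × ℕ → Ω → Ξ) (e : ℕ × ℕ → Ω → ZoSA.E n)
                (_ : ZoSA.IsSampling S μ ξ e)
                (out : Ω → ZoSA.State n)
                (_ : ∀ ω, out ω = ZoSA.zoSA S r p C N x₀ (fun i => ξ i ω) (fun i => e i ω)),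
                (Integrable (fun ω => S.Ψ₀ (out ω).xbar) μ ∧
                  ∀ xstar ∈ S.Q, IsMinOn S.Ψ₀ S.Q xstar →
                    ∫ ω, S.Ψ₀ (out ω).xbar ∂μ - S.Ψ₀ xstar ≤ ε) ∧
                ∀ ω, ((out ω).gradCalls : ℝ) ≤ K * √(S.L * S.DQV ^ 2 / ε) ∧
                  ((out ω).zoCalls : ℝ) ≤
                    K * (√(S.L * S.DQV ^ 2 / ε)
                      + S.DQV ^ 2 * p ^ 2 * (n : ℝ) * S.M ^ 2 / ε ^ 2)) := by
  refine ⟨1000, by norm_num, ?_, ?_⟩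
  · intro n hn Ξ _ S hS r p hr hrs hp N hN x₀ hx₀ Ω _ μ _ ξ e hs xbar hxbar
    have : NeZero n := ⟨by omega⟩
    obtain rfl : xbar = _ := funext hxbar
    have hmem : ∀ ω, (ZoSA.zoSA S r p 1000 N x₀ (fun i => ξ i ω) (fun i => e i ω)).xbar ∈ S.Q :=
      fun ω => (ZoSA.run_mem r _ _ hS hx₀ p 1000 N N).2
    have hm := ZoSA.measurable_zoSA_xbar hS hp hr hrs hs hx₀ N
    exact ⟨hmem, ⟨ZoSA.integrable_Ψ_comp hS hp hr hrs hm hmem, fun xstar hx _ =>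
      ZoSA.integral_Ψ_sub_le hS hp hr hrs hs hx₀ hx hN⟩,
      ZoSA.integrable_Ψ₀_comp hS hp hr hrs hm hmem, fun xstar hx _ =>
      ZoSA.integral_Ψ₀_sub_le hS hp hr hrs hs hx₀ hx hN⟩
  · intro c₁ c₂ c₃ c₄ c₅ hc₁ hc₂ hc₃ hc₄ hc₅ hc
    -- The share of `ε` left for the optimization error after the smoothing error `2 c₂ ε` and the
    -- bias `(c₃ / c₁) ε`.
    set η := 1 - 2 * c₂ - c₃ / c₁ with hηdef
    have hη : 0 < η := by linarith
    set K₁ := √(12 / η) + √c₅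
    have hK₁ : 0 < K₁ := by positivity
    set a := (c₃ / c₁ * c₄) ^ 2 with ha
    -- `K₁` bounds `N` relative to the square root, and `a` bounds the noise variance relative to `n
    -- M²`.
    refine ⟨2 * K₁ + 8 / 3 * 1000 * (1 + a) * K₁ ^ 4, by positivity, ?_⟩
    intro n hn Ξ _ S hS r p ε hr hrs hp hε h1 h2 h3 h4 h5
    have : NeZero n := ⟨by omega⟩
    have hL := hS.L_pos
    have hM := hS.M_pos
    have hpp := hS.p_pos hp
    -- The upper bounds on the positive `ε` exclude degenerate diameters.
    have hDQ : 0 < S.DQ := by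
      refine hS.DQ_nonneg.lt_of_ne fun h => ?_
      rw [← h] at h4
      linarith
    have hD : 0 < S.DQV := by
      refine hS.DQV_nonneg.lt_of_ne fun h => ?_
      rw [← h] at h5
      norm_num at h5
      linarith
    obtain ⟨N, hN, hN1, hN2⟩ := ZoSA.exists_iterations (A := S.L * S.DQV ^ 2 / ε) (c := c₅)
      (by positivity) hη hc₅ (by rwa [mul_div_assoc', one_le_div hε])
    refine ⟨N, hN, ?_⟩
    intro x₀ hx₀ Ω _ μ _ ξ e hs out hout
    obtain rfl : out = _ := funext hout
    have hmem : ∀ ω, (ZoSA.zoSA S r p 1000 N x₀ (fun i => ξ i ω) (fun i => e i ω)).xbar ∈ S.Q :=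
      fun ω => (ZoSA.run_mem r _ _ hS hx₀ p 1000 N N).2
    have hm := ZoSA.measurable_zoSA_xbar hS hp hr hrs hs hx₀ N
    have hi := ZoSA.integrable_Ψ₀_comp (μ := μ) hS hp hr hrs hm hmem
    have hΔ := hS.Δ_nonneg (ZoSA.Problem.mem_Qs hx₀ (hr.le.trans hrs))
    refine ⟨⟨hi, fun xstar hx _ => ?_⟩, fun ω => ⟨?_, ?_⟩⟩
    · have h6 := ZoSA.integral_Ψ₀_sub_le hS hp hr hrs hs hx₀ hx hN
      rw [integral_sub hi (integrable_const _)] at h6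
      simp only [integral_const, probReal_univ, one_smul] at h6
      have h7 := ZoSA.mul_noise_le hM hDQ hr hΔ hε hc₁ hc₃ h1 h3 (le_max_left p 1)
      have h8 : 12 * S.L * S.DQV ^ 2 / ((N : ℝ) * (N + 1)) ≤ η * ε := by
        calc _ = 12 * (S.L * S.DQV ^ 2 / ε) / ((N : ℝ) * (N + 1)) * ε := by field_simp
          _ ≤ η * ε := by gcongr
      have h9 : r * S.M ≤ c₂ * ε := by
        rwa [mul_div_assoc', le_div_iff₀ hM] at h2
      calc _ ≤ _ := h6
        _ ≤ 2 * (c₂ * ε) + η * ε + c₃ / c₁ * ε := by linarith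
        _ = ε := by rw [hηdef]; ring
    · simp only [ZoSA.zoSA, ZoSA.run_gradCalls]
      refine hN2.trans (mul_le_mul_of_nonneg_right ?_ (Real.sqrt_nonneg _))
      have : 0 ≤ 8 / 3 * 1000 * (1 + a) * K₁ ^ 4 := by positivity
      linarith
    · have h6 := ZoSA.run_zoCalls_le (p := p) (C := 1000) hS hD (by norm_num)
        (ZoSA.sq_noise_le hM hDQ hr hΔ hε hc₁ hc₃ h1 h3 h4) N x₀ (fun i => ξ i ω)
        (fun i => e i ω)
      refine h6.trans ?_
      have h7 : (N : ℝ) ^ 4 ≤ K₁ ^ 4 * (S.L ^ 2 * S.DQV ^ 4 / ε ^ 2) := by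
        calc (N : ℝ) ^ 4 ≤ (K₁ * √(S.L * S.DQV ^ 2 / ε)) ^ 4 := by gcongr
          _ = K₁ ^ 4 * (√(S.L * S.DQV ^ 2 / ε) ^ 2) ^ 2 := by ring
          _ = _ := by rw [Real.sq_sqrt (by positivity)]; ring
      have h8 : (N : ℝ) ^ 4 / (S.L ^ 2 * S.DQV ^ 2) ≤ K₁ ^ 4 * (S.DQV ^ 2 / ε ^ 2) := by
        rw [div_le_iff₀ (by positivity)]
        refine h7.trans (le_of_eq ?_)
        ring
      set s := √(S.L * S.DQV ^ 2 / ε)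
      have hs0 : 0 ≤ s := Real.sqrt_nonneg _
      have hKa : 0 ≤ 8 / 3 * 1000 * (1 + a) * K₁ ^ 4 := by positivity
      have h9 : 0 ≤ S.DQV ^ 2 * p ^ 2 * n * S.M ^ 2 / ε ^ 2 := by positivity
      calc _ ≤ 2 * (K₁ * s) + 8 / 3 * 1000 * (1 + a) * (K₁ ^ 4 * (S.DQV ^ 2 / ε ^ 2))
            * (p ^ 2 * n * S.M ^ 2) := by gcongr
        _ = 2 * K₁ * s + 8 / 3 * 1000 * (1 + a) * K₁ ^ 4
            * (S.DQV ^ 2 * p ^ 2 * n * S.M ^ 2 / ε ^ 2) := by ring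
        _ ≤ _ := by
          have := mul_nonneg hKa hs0
          have := mul_nonneg hK₁.le h9
          rw [add_mul, mul_add, mul_add]
          linarith
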